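/- Let $\mu_+>0$, $\mu_-\in(0,1)$, $T>0$, let $U\subset\mathbb{R}^d$ be open and connected, and put $K=\mathbb{R}^d\setminus U$. For a continuous $v:\overline U\to[0,\infty)$ let $\Omega(v)=\{x\in\overline U: v(x)>0\}$, and for $x_0\in\partial\Omega(v)\cap U$ let $D_+v(x_0)$ be the set of $p\in\mathbb{R}^d$ with $v(x)\le p\cdot(x-x_0)+o(|x-x_0|)$ for $x\in\overline{\Omega(v)}$, and $D_-v(x_0)$ the set of $p$ with $v(x)\ge p\cdot(x-x_0)-o(|x-x_0|)$. A *supersolution* is such a $v$ that is superharmonic in $\Omega(v)\cap U$ with $|p|^2\le 1+\mu_+$ for all $p\in D_-v(x_0)$, $x_0\in\partial\Omega(v)\cap U$; a *subsolution* is such a $v$ that is subharmonic in $\Omega(v)\cap U$ with $|p|^2\ge 1-\mu_-$ for all $p\in D_+v(x_0)$, $x_0\in\partial\Omega(v)\cap U$; $v$ is *stable* if it is harmonic in $\Omega(v)\cap U$ and satisfies both slope conditions, that is, if it is a viscosity solution of $$\Delta v=0\ \text{ in }\Omega(v)\cap U,\qquad 1-\mu_-\le|\nabla v|^2\le 1+\mu_+\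 \text{ on }\partial\Omega(v)\cap U .$$ Let $F:[0,T]\to(0,\infty)$ be Lipschitz and let $Z$ be a finite set such that $F$ is monotone on each $[s,t]\subset[0,T]$ with $(s,t)\cap Z=\emptyset$. A function $u:[0,T]\times\overline U\to[0,\infty)$ is an *obstacle solution* driven by $F$ if $u(0)$ is stable; $u(t)=F(t)$ on $\partial U$ for all $t\in[0,T]$; and, whenever $0\le s<t\le T$ and $(s,t)\cap Z=\emptyset$, $u(t)$ is the minimal supersolution $v$ with $v=F(t)$ on $\partial U$ and $v\ge u(s)$ if $F$ is nondecreasing on $[s,t]$, and the maximal subsolution $v$ with $v=F(t)$ on $\partial U$ and $v\le u(s)$ if $F$ is nonincreasing on $[s,t]$. A nonempty set is *strongly star-shaped* if it is star-shaped with respect to every point of some neighborhood of the origin. **Corollary.** Let $u$ be an obstacle solution driven by $F$. Suppose that $K$ is bounded and strongly star-shaped with $C^2$ boundary, and that $\Omega(u(0))$ is bounded and $\Omega(u(0))\cup K$ is strongly star-shaped. Then the sets $\Omega(u(t))$ are (locally) Lipschitz in time on $[0,T]$ with respect to the Hausdorff distance $d_H$: there is a constant $C<\infty$ such that $$d_H\big(\Omega(u(s)),\Omega(u(t))\big)\le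 C\,|t-s|\qquad\text{for all } s,t\in[0,T].$$ -/

import Mathlib

open Set Filter Topology MeasureTheory
open scoped NNReal ENNReal

/-- The set `Ω(v) = {v > 0}`, for a function `v` on the closure of the domain `U`.
Only the values of `v` on `closure U` play a role, here and in all definitions below. -/
def posSet {d : ℕ} (U : Set (EuclideanSpace ℝ (Fin d))) (v : EuclideanSpace ℝ (Fin d) → ℝ) :
    Set (EuclideanSpace ℝ (Fin d)) :=
  {x | x ∈ closure U ∧ 0 < v x}

/-- Subharmonicity of a continuous function on an open set, by the sub-mean value property. -/
def IsSubharmonicOn {d : ℕ} (v : EuclideanSpace ℝ (Fin d) → ℝ)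
    (S : Set (EuclideanSpace ℝ (Fin d))) : Prop :=
  ContinuousOn v S ∧ ∀ (x : EuclideanSpace ℝ (Fin d)) (r : ℝ), 0 < r →
    Metric.closedBall x r ⊆ S → v x ≤ ⨍ y in Metric.ball x r, v y

/-- Superharmonicity of a continuous function on an open set, by the super-mean value property. -/
def IsSuperharmonicOn {d : ℕ} (v : EuclideanSpace ℝ (Fin d) → ℝ)
    (S : Set (EuclideanSpace ℝ (Fin d))) : Prop :=
  ContinuousOn v S ∧ ∀ (x : EuclideanSpace ℝ (Fin d)) (r : ℝ), 0 < r →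
    Metric.closedBall x r ⊆ S → (⨍ y in Metric.ball x r, v y) ≤ v x

/-- The superdifferential `D₊ v(x₀)` at a free boundary point `x₀ ∈ ∂Ω(v) ∩ U`: all `p` with
`v(x) ≤ p · (x - x₀) + o(|x - x₀|)` for `x` in the closure of `Ω(v)`. -/
def superDiff {d : ℕ} (U : Set (EuclideanSpace ℝ (Fin d))) (v : EuclideanSpace ℝ (Fin d) → ℝ)
    (x₀ : EuclideanSpace ℝ (Fin d)) : Set (EuclideanSpace ℝ (Fin d)) :=
  {p | ∀ ε : ℝ, 0 < ε → ∀ᶠ x in 𝓝[closure (posSet U v)] x₀,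
    v x ≤ inner ℝ p (x - x₀) + ε * ‖x - x₀‖}

/-- The subdifferential `D₋ v(x₀)` at a free boundary point `x₀ ∈ ∂Ω(v) ∩ U`: all `p` with
`v(x) ≥ p · (x - x₀) - o(|x - x₀|)`. -/
def subDiff {d : ℕ} (v : EuclideanSpace ℝ (Fin d) → ℝ)
    (x₀ : EuclideanSpace ℝ (Fin d)) : Set (EuclideanSpace ℝ (Fin d)) :=
  {p | ∀ ε : ℝ, 0 < ε → ∀ᶠ x in 𝓝 x₀, inner ℝ p (x - x₀) - ε * ‖x - x₀‖ ≤ v x}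

/-- `|∇v|² ≥ Q` on the free boundary `∂Ω(v) ∩ U`, in the viscosity sense. -/
def SlopeGE {d : ℕ} (U : Set (EuclideanSpace ℝ (Fin d))) (Q : ℝ)
    (v : EuclideanSpace ℝ (Fin d) → ℝ) : Prop :=
  ∀ x ∈ frontier (posSet U v) ∩ U, ∀ p ∈ superDiff U v x, Q ≤ ‖p‖ ^ 2

/-- `|∇v|² ≤ Q` on the free boundary `∂Ω(v) ∩ U`, in the viscosity sense. -/
def SlopeLE {d : ℕ} (U : Set (EuclideanSpace ℝ (Fin d))) (Q : ℝ)
    (v : EuclideanSpace ℝ (Fin d) → ℝ) : Prop :=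
  ∀ x ∈ frontier (posSet U v) ∩ U, ∀ p ∈ subDiff v x, ‖p‖ ^ 2 ≤ Q

/-- `v` is continuous and nonnegative on `closure U`. -/
def IsState {d : ℕ} (U : Set (EuclideanSpace ℝ (Fin d)))
    (v : EuclideanSpace ℝ (Fin d) → ℝ) : Prop :=
  ContinuousOn v (closure U) ∧ ∀ x ∈ closure U, 0 ≤ v x

/-- Viscosity solutions of the local stability condition
`Δv = 0` in `Ω(v) ∩ U`, `1 - μ₋ ≤ |∇v|² ≤ 1 + μ₊` on `∂Ω(v) ∩ U`. -/
def IsStable {d : ℕ} (U : Set (EuclideanSpace ℝ (Fin d))) (μp μm : ℝ)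
    (v : EuclideanSpace ℝ (Fin d) → ℝ) : Prop :=
  IsState U v ∧ InnerProductSpace.HarmonicOnNhd v (posSet U v ∩ U) ∧
    SlopeGE U (1 - μm) v ∧ SlopeLE U (1 + μp) v

/-- Viscosity supersolutions of the local stability condition. -/
def IsSupersolution {d : ℕ} (U : Set (EuclideanSpace ℝ (Fin d))) (μp : ℝ)
    (v : EuclideanSpace ℝ (Fin d) → ℝ) : Prop :=
  IsState U v ∧ IsSuperharmonicOn v (posSet U v ∩ U) ∧ SlopeLE U (1 + μp) v

/-- Viscosity subsolutions of the local stability condition. -/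
def IsSubsolution {d : ℕ} (U : Set (EuclideanSpace ℝ (Fin d))) (μm : ℝ)
    (v : EuclideanSpace ℝ (Fin d) → ℝ) : Prop :=
  IsState U v ∧ IsSubharmonicOn v (posSet U v ∩ U) ∧ SlopeGE U (1 - μm) v

/-- `v` is a supersolution with boundary value `f` on `∂U` that lies above `w`. -/
def IsSupersolutionAbove {d : ℕ} (U : Set (EuclideanSpace ℝ (Fin d))) (μp f : ℝ)
    (w v : EuclideanSpace ℝ (Fin d) → ℝ) : Prop :=
  IsSupersolution U μp v ∧ (∀ x ∈ frontier U, v x = f) ∧ ∀ x ∈ closure U, w x ≤ v x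

/-- `v` is a subsolution with boundary value `f` on `∂U` that lies below `w`. -/
def IsSubsolutionBelow {d : ℕ} (U : Set (EuclideanSpace ℝ (Fin d))) (μm f : ℝ)
    (w v : EuclideanSpace ℝ (Fin d) → ℝ) : Prop :=
  IsSubsolution U μm v ∧ (∀ x ∈ frontier U, v x = f) ∧ ∀ x ∈ closure U, v x ≤ w x

/-- `v` is the minimal supersolution with boundary value `f` above `w`. -/
def IsMinimalSupersolutionAbove {d : ℕ} (U : Set (EuclideanSpace ℝ (Fin d))) (μp f : ℝ)
    (w v : EuclideanSpace ℝ (Fin d) → ℝ) : Prop :=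
  IsSupersolutionAbove U μp f w v ∧
    ∀ v' : EuclideanSpace ℝ (Fin d) → ℝ, IsSupersolutionAbove U μp f w v' →
      ∀ x ∈ closure U, v x ≤ v' x

/-- `v` is the maximal subsolution with boundary value `f` below `w`. -/
def IsMaximalSubsolutionBelow {d : ℕ} (U : Set (EuclideanSpace ℝ (Fin d))) (μm f : ℝ)
    (w v : EuclideanSpace ℝ (Fin d) → ℝ) : Prop :=
  IsSubsolutionBelow U μm f w v ∧
    ∀ v' : EuclideanSpace ℝ (Fin d) → ℝ, IsSubsolutionBelow U μm f w v' →
      ∀ x ∈ closure U, v' x ≤ v x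

/-- The forcing `F : [0,T] → (0,∞)` is Lipschitz and changes monotonicity only on the
finite set `Z`. -/
structure IsForcing (T : ℝ) (Z : Set ℝ) (F : ℝ → ℝ) : Prop where
  pos : ∀ t ∈ Icc 0 T, 0 < F t
  lipschitz : ∃ L : ℝ≥0, LipschitzOnWith L F (Icc 0 T)
  finite : Z.Finite
  monotone : ∀ s ∈ Icc 0 T, ∀ t ∈ Icc 0 T, s < t → Disjoint (Ioo s t) Z →
    MonotoneOn F (Icc s t) ∨ AntitoneOn F (Icc s t)

/-- Obstacle solutions in `U` on `[0,T]`, driven by `F` on `∂U`. -/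
structure IsObstacleSolution {d : ℕ} (U : Set (EuclideanSpace ℝ (Fin d))) (μp μm T : ℝ)
    (Z : Set ℝ) (F : ℝ → ℝ) (u : ℝ → EuclideanSpace ℝ (Fin d) → ℝ) : Prop where
  initial : IsStable U μp μm (u 0)
  dirichlet : ∀ t ∈ Icc 0 T, ∀ x ∈ frontier U, u t x = F t
  increasing : ∀ s ∈ Icc 0 T, ∀ t ∈ Icc 0 T, s < t → Disjoint (Ioo s t) Z →
    MonotoneOn F (Icc s t) → IsMinimalSupersolutionAbove U μp (F t) (u s) (u t)
  decreasing : ∀ s ∈ Icc 0 T, ∀ t ∈ Icc 0 T, s < t → Disjoint (Ioo s t) Z →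
    AntitoneOn F (Icc s t) → IsMaximalSubsolutionBelow U μm (F t) (u s) (u t)

/-- A (nonempty) set is strongly star-shaped if it is star-shaped with respect to every point
of a neighborhood of the origin. -/
def IsStronglyStarShaped {d : ℕ} (A : Set (EuclideanSpace ℝ (Fin d))) : Prop :=
  A.Nonempty ∧ ∀ᶠ x in 𝓝 (0 : EuclideanSpace ℝ (Fin d)), StarConvex ℝ x A

/-- The boundary of the open set `U` (which is that of its complement) is of class `C²`: near
each boundary point, `U` is the set where a `C²` function with nonzero gradient is positive. -/
def HasC2Boundary {d : ℕ} (U : Set (EuclideanSpace ℝ (Fin d))) : Prop :=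
  ∀ x ∈ frontier U, ∃ ρ : EuclideanSpace ℝ (Fin d) → ℝ,
    ContDiffAt ℝ 2 ρ x ∧ fderiv ℝ ρ x ≠ 0 ∧ ∀ᶠ y in 𝓝 x, (y ∈ U ↔ 0 < ρ y)

/-! The equation and both slope conditions are invariant under the dilation `v ↦ c⁻¹ * v (c • ·)`,
and strong star-shapedness of `K` gives `c • closure U ⊆ U` for `c > 1`, so a state can be compared
with its own dilates. The quantity carried along the evolution is the inequality `u t (c • x) ≤ c *
u t x` for all `c > 1` (field `scale` of `IsStarState`).

Suppose the boundary value rises from `f` to `f'`, taking the state `w` to the minimal supersolution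
`v` above it. For `c > f' / f` the function `c * w (c⁻¹ • ·)` is a supersolution on `c • U`. It lies
above `w` by the dilation inequality, and it exceeds `f' ≥ v` near the boundary of `c • U`.
Minimality then forces `v (c • x) ≤ c * w x`. Hence every point of `Ω(v)`, contracted by `c⁻¹`,
lands in `Ω(w)` or in `K`, and the two positivity sets are at distance at most `(f' / f - 1) * R`,
where `R` bounds the norms involved. If the boundary value falls, the dilate of the old state is a
competitor for the maximal subsolution, which gives the mirror estimate. Since `F` is Lipschitz and
bounded below by a positive constant, these bounds are linear in `|t - s|`.

For the argument to be iterated, each state must be both a supersolution and a subsolution: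
minimality produces only the first, maximality only the second. The missing halves are
`IsMinimalSupersolutionAbove.isSubsolution` and `IsMaximalSubsolutionBelow.isSupersolution`. Inside
the positivity set one compares with nearly equal harmonic functions on a ball; at the free boundary
one compares with explicit barriers that would move the boundary if the slope condition failed. Both
comparisons glue a local competitor into the extremal function (`le_of_local`), which is why the
solution notions are rephrased pointwise as `SuperAt` and `SubAt`.

The potential theory rests on the mean value definition: sub-mean values are equivalent to a
nonnegative Laplacian for `C²` functions, subharmonicity is local, the maximum principle holds, and
polynomials solve the Dirichlet problem on a ball approximately. The initial dilation inequality is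
a harmonic comparison that uses the star-shape of `Ω(u 0) ∪ K`. Induction over the points of `Z`
assembles the monotone intervals. -/

/-! ### From nonnegative Laplacian to the sub-mean value property. -/

/-- The Laplacian as the sum of the pure second partial derivatives. -/
noncomputable def lap {d : ℕ} (f : EuclideanSpace ℝ (Fin d) → ℝ)
    (x : EuclideanSpace ℝ (Fin d)) : ℝ :=
  ∑ i, fderiv ℝ (fun y => fderiv ℝ f y (EuclideanSpace.single i 1)) x (EuclideanSpace.single i 1)

theorem average_ball_eq {d : ℕ} (f : EuclideanSpace ℝ (Fin d) → ℝ)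
    (x : EuclideanSpace ℝ (Fin d)) {r : ℝ} (hr : 0 < r) :
    ⨍ y in Metric.ball x r, f y = ⨍ z in Metric.ball (0 : EuclideanSpace ℝ (Fin d)) 1,
      f (x + r • z) := by
  have h1 : ∫ z in Metric.ball (0 : EuclideanSpace ℝ (Fin d)) 1, f (x + r • z) =
      (r ^ Module.finrank ℝ (EuclideanSpace ℝ (Fin d)))⁻¹ • ∫ y in Metric.ball x r, f y := by
    rw [Measure.setIntegral_comp_smul_of_pos volume (fun y => f (x + y)) _ hr]
    congr 1
    rw [smul_unitBall hr.ne', Real.norm_of_nonneg hr.le]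
    have := (measurePreserving_add_left (volume : Measure (EuclideanSpace ℝ (Fin d)))
      x).setIntegral_preimage_emb (measurableEmbedding_addLeft x) f (Metric.ball x r)
    rw [← this]
    congr 2
    ext y; simp
  rw [setAverage_eq, setAverage_eq, h1, smul_smul]
  congr 1
  rw [Measure.real, Measure.real, Measure.addHaar_ball_of_pos volume x hr, ENNReal.toReal_mul,
    ENNReal.toReal_ofReal (by positivity), mul_inv, mul_comm]

theorem fderiv_norm_sq_single {d : ℕ} {W : ℝ → ℝ} {c : ℝ} (z : EuclideanSpace ℝ (Fin d))
    (hW : HasDerivAt W c (‖z‖ ^ 2)) (i : Fin d) :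
    fderiv ℝ (fun z : EuclideanSpace ℝ (Fin d) => W (‖z‖ ^ 2)) z (EuclideanSpace.single i 1) =
      c * (2 * z i) := by
  have h := hW.comp_hasFDerivAt z (hasStrictFDerivAt_norm_sq z).hasFDerivAt
  have h2 := h.fderiv
  simp only [Function.comp_def] at h2
  rw [h2]
  simp [EuclideanSpace.inner_single_right]

theorem fderiv_apply_eq_sum {d : ℕ} (L : EuclideanSpace ℝ (Fin d) →L[ℝ] ℝ)
    (z : EuclideanSpace ℝ (Fin d)) :
    L z = ∑ i, z i * L (EuclideanSpace.single i 1) := by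
  conv_lhs => rw [← (EuclideanSpace.basisFun (Fin d) ℝ).sum_repr z]
  simp [map_sum]

theorem integrable_weight_mul {d : ℕ} {w : ℝ → ℝ} (hw : Continuous w)
    (hw1 : ∀ s, 1 ≤ s → w s = 0) {g : EuclideanSpace ℝ (Fin d) → ℝ} (hg : Continuous g) :
    Integrable (fun z => w (‖z‖ ^ 2) * g z) := by
  apply Continuous.integrable_of_hasCompactSupport (by fun_prop)
  apply HasCompactSupport.intro (isCompact_closedBall (0 : EuclideanSpace ℝ (Fin d)) 1)
  intro z hz
  rw [hw1, zero_mul]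
  simp only [Metric.mem_closedBall, dist_zero_right, not_le] at hz
  nlinarith

/-- The gradient of `W (‖z‖ ^ 2)` is `-2 * w (‖z‖ ^ 2) • z`, so integrating by parts in each
coordinate moves one derivative onto `fderiv ℝ f`; the chain rule supplies the factor `r`. Radial
weights of compact support replace integration over spheres. -/
theorem radial_ibp {d : ℕ} {w W : ℝ → ℝ} (hw : Continuous w) (hW : ∀ s, HasDerivAt W (-w s) s)
    (hw1 : ∀ s, 1 ≤ s → w s = 0) (hW1 : ∀ s, 1 ≤ s → W s = 0)
    {f : EuclideanSpace ℝ (Fin d) → ℝ} (hf : ContDiff ℝ 2 f) (x : EuclideanSpace ℝ (Fin d))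
    (r : ℝ) :
    ∫ z, w (‖z‖ ^ 2) * fderiv ℝ f (x + r • z) z =
      r / 2 * ∫ z, W (‖z‖ ^ 2) * lap f (x + r • z) := by
  have hWc : Continuous W := continuous_iff_continuousAt.2 fun s => (hW s).continuousAt
  have hWd : Differentiable ℝ (fun z : EuclideanSpace ℝ (Fin d) => W (‖z‖ ^ 2)) := fun z =>
    ((hW _).comp_hasFDerivAt z (hasStrictFDerivAt_norm_sq z).hasFDerivAt).differentiableAt
  have hD : ∀ i, ContDiff ℝ 1 fun y => fderiv ℝ f y (EuclideanSpace.single i 1) := fun i =>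
    (hf.fderiv_right (m := 1) (by norm_num)).clm_apply contDiff_const
  have hDD : ∀ i, Continuous fun y =>
      fderiv ℝ (fun y => fderiv ℝ f y (EuclideanSpace.single i 1)) y
        (EuclideanSpace.single i 1) := fun i =>
    ((hD i).continuous_fderiv (by norm_num)).clm_apply continuous_const
  have hi : ∀ i, ∫ z, w (‖z‖ ^ 2) * (z i * fderiv ℝ f (x + r • z) (EuclideanSpace.single i 1)) =
      r / 2 * ∫ z, W (‖z‖ ^ 2) *
        fderiv ℝ (fun y => fderiv ℝ f y (EuclideanSpace.single i 1)) (x + r • z)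
          (EuclideanSpace.single i 1) := by
    intro i
    set u : EuclideanSpace ℝ (Fin d) → ℝ :=
      fun z => fderiv ℝ f (x + r • z) (EuclideanSpace.single i 1) with hu
    have hud : ∀ z, fderiv ℝ u z (EuclideanSpace.single i 1) =
        r * fderiv ℝ (fun y => fderiv ℝ f y (EuclideanSpace.single i 1)) (x + r • z)
          (EuclideanSpace.single i 1) := by
      intro z
      have h1 : HasFDerivAt (fun z : EuclideanSpace ℝ (Fin d) => x + r • z)
          (r • ContinuousLinearMap.id ℝ (EuclideanSpace ℝ (Fin d))) z := by
        exact ((hasFDerivAt_id z).const_smul r).const_add x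
      have h2 := (((hD i).differentiable (by norm_num)) (x + r • z)).hasFDerivAt.comp z h1
      have h3 := h2.fderiv
      simp only [Function.comp_def] at h3
      rw [hu, h3]
      simp
    have hucont : ContDiff ℝ 1 u := (hD i).comp (by fun_prop)
    have hW' : ∀ z : EuclideanSpace ℝ (Fin d),
        fderiv ℝ (fun z : EuclideanSpace ℝ (Fin d) => W (‖z‖ ^ 2)) z (EuclideanSpace.single i 1) =
        -w (‖z‖ ^ 2) * (2 * z i) := fun z => fderiv_norm_sq_single z (hW _) i
    have key := integral_mul_fderiv_eq_neg_fderiv_mul_of_integrable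
      (μ := (volume : Measure (EuclideanSpace ℝ (Fin d)))) (f := u)
      (g := fun z => W (‖z‖ ^ 2)) (v := EuclideanSpace.single i 1) ?_ ?_ ?_
      (fun z _ => hucont.differentiable (by norm_num) z) (fun z _ => hWd z)
    · simp only [hW', hud] at key
      rw [← integral_const_mul]
      have e1 : ∫ z, w (‖z‖ ^ 2) * (z i * u z) = (-1/2) * ∫ z, u z * (-w (‖z‖ ^ 2) * (2 * z i)) := by
        rw [← integral_const_mul]; congr 1; ext z; ring
      change ∫ z, w (‖z‖ ^ 2) * (z i * u z) = _
      rw [e1, key, ← integral_neg, ← integral_const_mul]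
      congr 1; ext z; ring
    · have := integrable_weight_mul (d := d) hWc hW1 (g := fun z =>
        fderiv ℝ u z (EuclideanSpace.single i 1))
        ((hucont.continuous_fderiv (by norm_num)).clm_apply continuous_const)
      simpa only [mul_comm] using this
    · have := integrable_weight_mul (d := d) hw hw1 (g := fun z => u z * (-(2 * z i)))
        (hucont.continuous.mul (by fun_prop))
      refine this.congr (Eventually.of_forall fun z => ?_)
      simp only [hW']; ring
    · have := integrable_weight_mul (d := d) hWc hW1 hucont.continuous
      simpa only [mul_comm] using this
  have e1 : ∀ z, w (‖z‖ ^ 2) * fderiv ℝ f (x + r • z) z =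
      ∑ i, w (‖z‖ ^ 2) * (z i * fderiv ℝ f (x + r • z) (EuclideanSpace.single i 1)) := by
    intro z; rw [fderiv_apply_eq_sum, Finset.mul_sum]
  simp only [e1, lap, Finset.mul_sum]
  rw [integral_finsetSum, integral_finsetSum, Finset.mul_sum]
  · exact Finset.sum_congr rfl fun i _ => hi i
  · intro i _
    exact integrable_weight_mul hWc hW1 ((hDD i).comp (by fun_prop))
  · intro i _
    refine integrable_weight_mul hw hw1 (Continuous.mul (by fun_prop) ?_)
    exact ((hD i).continuous).comp (by fun_prop)

theorem weighted_mean_hasDerivAt {d : ℕ} {w : ℝ → ℝ} (hw : Continuous w)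
    (hw1 : ∀ s, 1 ≤ s → w s = 0)
    {f : EuclideanSpace ℝ (Fin d) → ℝ} (hf : ContDiff ℝ 2 f) (x : EuclideanSpace ℝ (Fin d))
    (r : ℝ) :
    HasDerivAt (fun r : ℝ => ∫ z, w (‖z‖ ^ 2) * f (x + r • z))
      (∫ z, w (‖z‖ ^ 2) * fderiv ℝ f (x + r • z) z) r := by
  have hDc : Continuous fun q : ℝ × EuclideanSpace ℝ (Fin d) =>
      fderiv ℝ f (x + q.1 • q.2) q.2 :=
    ((hf.continuous_fderiv (by norm_num)).comp (by fun_prop)).clm_apply (by fun_prop)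
  obtain ⟨C, hC⟩ := ((isCompact_closedBall r 1).prod
    (isCompact_closedBall (0 : EuclideanSpace ℝ (Fin d)) 1)).exists_bound_of_continuousOn
    hDc.continuousOn
  refine (hasDerivAt_integral_of_dominated_loc_of_deriv_le (𝕜 := ℝ)
    (bound := fun z => w (‖z‖ ^ 2) * 0 + |w (‖z‖ ^ 2)| * C)
    (F' := fun r z => w (‖z‖ ^ 2) * fderiv ℝ f (x + r • z) z)
    (Metric.closedBall_mem_nhds r one_pos) ?_ ?_ ?_ ?_ ?_ ?_).2
  · exact Eventually.of_forall fun r => (integrable_weight_mul hw hw1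
      (hf.continuous.comp (by fun_prop))).aestronglyMeasurable
  · exact integrable_weight_mul hw hw1 (hf.continuous.comp (by fun_prop))
  · exact (integrable_weight_mul hw hw1 (hDc.comp (by fun_prop :
      Continuous fun z : EuclideanSpace ℝ (Fin d) => (r, z)))).aestronglyMeasurable
  · refine Eventually.of_forall fun z s hs => ?_
    rw [norm_mul, mul_zero, zero_add, Real.norm_eq_abs]
    by_cases hz : ‖z‖ ≤ 1
    · exact mul_le_mul_of_nonneg_left (hC (s, z) ⟨hs, by simpa using hz⟩) (abs_nonneg _)
    · rw [hw1 _ (by nlinarith [not_le.1 hz])]; simp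
  · have := integrable_weight_mul (d := d) (w := fun s => |w s|) hw.abs
      (fun s hs => by simp [hw1 s hs]) (g := fun _ => C) continuous_const
    simpa using this
  · refine Eventually.of_forall fun z s hs => ?_
    apply HasDerivAt.const_mul
    have h1 : HasDerivAt (fun s : ℝ => x + s • z) z s := by
      simpa using ((hasDerivAt_id s).smul_const z).const_add x
    exact ((hf.differentiable (by norm_num)) (x + s • z)).hasFDerivAt.comp_hasDerivAt s h1

/-- The weighted mean of `f (x + r • z)` is nondecreasing in `r`: by `radial_ibp` its derivative is
`r / 2` times an integral of the Laplacian against a nonnegative weight. Compare `r = 0` with `r =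
R`. -/
theorem weighted_submean {d : ℕ} {w : ℝ → ℝ} (hw : Continuous w) (hw0 : ∀ s, 0 ≤ w s)
    (hw1 : ∀ s, 1 ≤ s → w s = 0)
    {f : EuclideanSpace ℝ (Fin d) → ℝ} (hf : ContDiff ℝ 2 f) {x : EuclideanSpace ℝ (Fin d)}
    {R : ℝ} (hR : 0 < R) (hl : ∀ y ∈ Metric.ball x R, 0 ≤ lap f y) :
    ∫ z : EuclideanSpace ℝ (Fin d), w (‖z‖ ^ 2) * f x ≤
      ∫ z, w (‖z‖ ^ 2) * f (x + R • z) := by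
  set W : ℝ → ℝ := fun s => ∫ t in s..1, w t with hWdef
  have hW : ∀ s, HasDerivAt W (-w s) s := fun s =>
    intervalIntegral.integral_hasDerivAt_left (hw.intervalIntegrable _ _)
      (hw.stronglyMeasurableAtFilter _ _) hw.continuousAt
  have hW1 : ∀ s, 1 ≤ s → W s = 0 := by
    intro s hs
    rw [hWdef]
    simp only
    rw [intervalIntegral.integral_symm, neg_eq_zero]
    apply intervalIntegral.integral_zero_ae
    refine Eventually.of_forall fun t ht => hw1 t ?_
    rw [uIoc_of_le hs] at ht
    exact ht.1.le
  have hW0 : ∀ s, 0 ≤ W s := by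
    intro s
    rcases le_total s 1 with h | h
    · exact intervalIntegral.integral_nonneg h fun t _ => hw0 t
    · rw [hW1 s h]
  have hder := weighted_mean_hasDerivAt hw hw1 hf x
  have hmono : MonotoneOn (fun r : ℝ => ∫ z, w (‖z‖ ^ 2) * f (x + r • z)) (Icc 0 R) := by
    apply monotoneOn_of_deriv_nonneg (convex_Icc 0 R)
    · exact fun r _ => (hder r).continuousAt.continuousWithinAt
    · exact fun r _ => (hder r).differentiableAt.differentiableWithinAt
    · intro r hr
      rw [interior_Icc] at hr
      rw [(hder r).deriv, radial_ibp hw hW hw1 hW1 hf x r]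
      refine mul_nonneg (by linarith [hr.1]) (integral_nonneg fun z => ?_)
      by_cases hz : ‖z‖ < 1
      · refine mul_nonneg (hW0 _) (hl _ ?_)
        simp only [Metric.mem_ball, dist_self_add_left, norm_smul, Real.norm_eq_abs,
          abs_of_pos hr.1]
        nlinarith [hr.1, hr.2, norm_nonneg z]
      · simp only [Pi.zero_apply]
        rw [hW1 _ (by nlinarith [not_lt.1 hz]), zero_mul]
  have := hmono ⟨le_rfl, hR.le⟩ ⟨hR.le, le_rfl⟩ hR.le
  simpa using this

theorem submean_of_lap_nonneg {d : ℕ} {f : EuclideanSpace ℝ (Fin d) → ℝ} (hf : ContDiff ℝ 2 f)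
    {x : EuclideanSpace ℝ (Fin d)} {R : ℝ} (hR : 0 < R)
    (hl : ∀ y ∈ Metric.ball x R, 0 ≤ lap f y) :
    f x ≤ ⨍ y in Metric.ball x R, f y := by
  rw [average_ball_eq f x hR]
  -- Continuous weights whose values at `‖z‖ ^ 2` converge pointwise to the indicator of the open
  -- unit ball.
  set w : ℕ → ℝ → ℝ := fun n s => max 0 (min 1 (n * (1 - s))) with hwdef
  have hw : ∀ n, Continuous (w n) := fun n => by simp only [hwdef]; fun_prop
  have hw0 : ∀ n s, 0 ≤ w n s := fun n s => le_max_left _ _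
  have hwle : ∀ n s, w n s ≤ 1 := fun n s => max_le zero_le_one (min_le_left _ _)
  have hw1 : ∀ n s, 1 ≤ s → w n s = 0 := by
    intro n s hs
    apply max_eq_left
    refine (min_le_right _ _).trans (mul_nonpos_of_nonneg_of_nonpos (by positivity) (by linarith))
  have hlim : ∀ g : EuclideanSpace ℝ (Fin d) → ℝ, Continuous g →
      Tendsto (fun n => ∫ z, w n (‖z‖ ^ 2) * g z) atTop
        (𝓝 (∫ z in Metric.ball (0 : EuclideanSpace ℝ (Fin d)) 1, g z)) := by
    intro g hg
    rw [← integral_indicator Metric.isOpen_ball.measurableSet]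
    apply tendsto_integral_of_dominated_convergence
      (bound := (Metric.ball (0 : EuclideanSpace ℝ (Fin d)) 1).indicator fun z => |g z|)
    · exact fun n => (integrable_weight_mul (hw n) (hw1 n) hg).aestronglyMeasurable
    · rw [integrable_indicator_iff Metric.isOpen_ball.measurableSet]
      exact (hg.abs.continuousOn.integrableOn_compact
        (isCompact_closedBall (0 : EuclideanSpace ℝ (Fin d)) 1)).mono_set
        Metric.ball_subset_closedBall
    · refine fun n => Eventually.of_forall fun z => ?_
      by_cases hz : z ∈ Metric.ball (0 : EuclideanSpace ℝ (Fin d)) 1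
      · rw [indicator_of_mem hz, norm_mul, Real.norm_eq_abs, abs_of_nonneg (hw0 _ _),
          Real.norm_eq_abs]
        exact mul_le_of_le_one_left (abs_nonneg _) (hwle _ _)
      · rw [indicator_of_notMem hz, hw1, zero_mul, norm_zero]
        simp only [Metric.mem_ball, dist_zero_right, not_lt] at hz
        nlinarith
    · refine Eventually.of_forall fun z => ?_
      by_cases hz : z ∈ Metric.ball (0 : EuclideanSpace ℝ (Fin d)) 1
      · rw [indicator_of_mem hz]
        apply tendsto_const_nhds.congr'
        simp only [Metric.mem_ball, dist_zero_right] at hz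
        have h1 : 0 < 1 - ‖z‖ ^ 2 := by nlinarith [norm_nonneg z]
        obtain ⟨N, hN⟩ := exists_nat_gt (1 / (1 - ‖z‖ ^ 2))
        filter_upwards [eventually_ge_atTop N] with n hn
        have h2 : 1 ≤ n * (1 - ‖z‖ ^ 2) := by
          rw [div_lt_iff₀ h1] at hN
          have : (N : ℝ) ≤ n := by exact_mod_cast hn
          nlinarith
        simp [hwdef, min_eq_left h2]
      · rw [indicator_of_notMem hz]
        apply tendsto_const_nhds.congr
        intro n
        rw [hw1, zero_mul]
        simp only [Metric.mem_ball, dist_zero_right, not_lt] at hz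
        nlinarith
  have key : ∫ z in Metric.ball (0 : EuclideanSpace ℝ (Fin d)) 1, f x ≤
      ∫ z in Metric.ball (0 : EuclideanSpace ℝ (Fin d)) 1, f (x + R • z) :=
    le_of_tendsto_of_tendsto' (hlim (fun _ => f x) continuous_const)
      (hlim (fun z => f (x + R • z)) (hf.continuous.comp (by fun_prop)))
      fun n => weighted_submean (hw n) (hw0 n) (hw1 n) hf hR hl
  rw [setAverage_eq, smul_eq_mul]
  rw [setIntegral_const, smul_eq_mul] at key
  have hpos : 0 < volume.real (Metric.ball (0 : EuclideanSpace ℝ (Fin d)) 1) :=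
    ENNReal.toReal_pos (Metric.measure_ball_pos _ _ one_pos).ne' measure_ball_lt_top.ne
  rwa [le_inv_mul_iff₀ hpos]

/-! ### Calculus of the Laplacian and of ball averages. -/

theorem lap_congr {d : ℕ} {f g : EuclideanSpace ℝ (Fin d) → ℝ} {x : EuclideanSpace ℝ (Fin d)}
    (h : f =ᶠ[𝓝 x] g) : lap f x = lap g x := by
  unfold lap
  refine Finset.sum_congr rfl fun i _ => ?_
  have : (fun y => fderiv ℝ f y (EuclideanSpace.single i 1)) =ᶠ[𝓝 x]
      fun y => fderiv ℝ g y (EuclideanSpace.single i 1) := by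
    filter_upwards [h.eventuallyEq_nhds] with y hy
    rw [hy.fderiv_eq]
  rw [this.fderiv_eq]

theorem differentiableAt_fderiv_apply {d : ℕ} {f : EuclideanSpace ℝ (Fin d) → ℝ}
    {x : EuclideanSpace ℝ (Fin d)} (hf : ContDiffAt ℝ 2 f x) (v : EuclideanSpace ℝ (Fin d)) :
    DifferentiableAt ℝ (fun y => fderiv ℝ f y v) x :=
  ((hf.fderiv_right (m := 1) (by norm_num)).differentiableAt (by norm_num)).clm_apply
    (differentiableAt_const v)

theorem lap_add {d : ℕ} {f g : EuclideanSpace ℝ (Fin d) → ℝ} {x : EuclideanSpace ℝ (Fin d)}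
    (hf : ContDiffAt ℝ 2 f x) (hg : ContDiffAt ℝ 2 g x) :
    lap (fun y => f y + g y) x = lap f x + lap g x := by
  unfold lap
  rw [← Finset.sum_add_distrib]
  refine Finset.sum_congr rfl fun i _ => ?_
  have : (fun y => fderiv ℝ (fun y => f y + g y) y (EuclideanSpace.single i 1)) =ᶠ[𝓝 x]
      fun y => fderiv ℝ f y (EuclideanSpace.single i 1) +
        fderiv ℝ g y (EuclideanSpace.single i 1) := by
    filter_upwards [hf.eventually (by norm_num), hg.eventually (by norm_num)] with y hy hy'
    rw [fderiv_fun_add (hy.differentiableAt (by norm_num)) (hy'.differentiableAt (by norm_num))]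
    rfl
  rw [this.fderiv_eq, fderiv_fun_add (differentiableAt_fderiv_apply hf _)
    (differentiableAt_fderiv_apply hg _)]
  rfl

theorem lap_neg {d : ℕ} (f : EuclideanSpace ℝ (Fin d) → ℝ) (x : EuclideanSpace ℝ (Fin d)) :
    lap (fun y => -f y) x = -lap f x := by
  unfold lap
  rw [← Finset.sum_neg_distrib]
  refine Finset.sum_congr rfl fun i _ => ?_
  simp only [fderiv_fun_neg, neg_apply]

theorem lap_const_mul_norm_sub_sq {d : ℕ} (c : ℝ) (a x : EuclideanSpace ℝ (Fin d)) :
    lap (fun y => c * ‖y - a‖ ^ 2) x = 2 * d * c := by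
  have h1 : ∀ (i : Fin d) (y : EuclideanSpace ℝ (Fin d)),
      fderiv ℝ (fun y : EuclideanSpace ℝ (Fin d) => c * ‖y - a‖ ^ 2) y
        (EuclideanSpace.single i 1) = c * (2 * (y i - a i)) := by
    intro i y
    have h := (((hasStrictFDerivAt_norm_sq (y - a)).hasFDerivAt.comp y
      ((hasFDerivAt_id y).sub_const a)).const_mul c).fderiv
    simp only [Function.comp_def, id] at h
    rw [h]
    simp [EuclideanSpace.inner_single_right]
  unfold lap
  simp only [h1]
  have h2 : ∀ i : Fin d, fderiv ℝ (fun y : EuclideanSpace ℝ (Fin d) => c * (2 * (y i - a i))) x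
      (EuclideanSpace.single i 1) = 2 * c := by
    intro i
    have hp : HasFDerivAt (fun y : EuclideanSpace ℝ (Fin d) => y i)
        (EuclideanSpace.proj (𝕜 := ℝ) i : EuclideanSpace ℝ (Fin d) →L[ℝ] ℝ) x :=
      (EuclideanSpace.proj (𝕜 := ℝ) i : EuclideanSpace ℝ (Fin d) →L[ℝ] ℝ).hasFDerivAt
    rw [(((hp.sub_const (a i)).const_mul 2).const_mul c).fderiv]
    simp
    ring
  simp [h2]
  ring

theorem laplacian_eq_zero_of_harmonicAt {d : ℕ} {f : EuclideanSpace ℝ (Fin d) → ℝ} {x : EuclideanSpace ℝ (Fin d)}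
    (hf : InnerProductSpace.HarmonicAt f x) : lap f x = 0 := by
  have h0 := hf.2.self_of_nhds
  rw [InnerProductSpace.laplacian_eq_iteratedFDeriv_orthonormalBasis f
    (EuclideanSpace.basisFun (Fin d) ℝ)] at h0
  simp only [Pi.zero_apply] at h0
  rw [← h0]
  unfold lap
  refine Finset.sum_congr rfl fun i _ => ?_
  rw [iteratedFDeriv_two_apply]
  have hd : DifferentiableAt ℝ (fderiv ℝ f) x :=
    (hf.1.fderiv_right (m := 1) (by norm_num)).differentiableAt (by norm_num)
  rw [fderiv_clm_apply hd (differentiableAt_const _)]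
  simp

theorem integrableOn_ball {d : ℕ} {f : EuclideanSpace ℝ (Fin d) → ℝ}
    {x : EuclideanSpace ℝ (Fin d)} {r : ℝ} (hf : ContinuousOn f (Metric.closedBall x r)) :
    IntegrableOn f (Metric.ball x r) :=
  (hf.integrableOn_compact (isCompact_closedBall x r)).mono_set Metric.ball_subset_closedBall

theorem volume_real_ball_pos {d : ℕ} (x : EuclideanSpace ℝ (Fin d)) {r : ℝ} (hr : 0 < r) :
    0 < volume.real (Metric.ball x r) :=
  ENNReal.toReal_pos (Metric.measure_ball_pos _ _ hr).ne' measure_ball_lt_top.ne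

theorem average_ball_mono {d : ℕ} {f g : EuclideanSpace ℝ (Fin d) → ℝ}
    {x : EuclideanSpace ℝ (Fin d)} {r : ℝ} (hf : ContinuousOn f (Metric.closedBall x r))
    (hg : ContinuousOn g (Metric.closedBall x r)) (h : ∀ y ∈ Metric.ball x r, f y ≤ g y) :
    ⨍ y in Metric.ball x r, f y ≤ ⨍ y in Metric.ball x r, g y := by
  rw [setAverage_eq, setAverage_eq]
  exact mul_le_mul_of_nonneg_left (setIntegral_mono_on (integrableOn_ball hf)
    (integrableOn_ball hg) Metric.isOpen_ball.measurableSet h) (by positivity)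

theorem average_ball_congr {d : ℕ} {f g : EuclideanSpace ℝ (Fin d) → ℝ}
    {x : EuclideanSpace ℝ (Fin d)} {r : ℝ} (h : ∀ y ∈ Metric.ball x r, f y = g y) :
    ⨍ y in Metric.ball x r, f y = ⨍ y in Metric.ball x r, g y := by
  rw [setAverage_eq, setAverage_eq, setIntegral_congr_fun Metric.isOpen_ball.measurableSet h]

theorem average_ball_const {d : ℕ} (x : EuclideanSpace ℝ (Fin d)) {r : ℝ} (hr : 0 < r) (c : ℝ) :
    ⨍ _y in Metric.ball x r, c = c :=
  setAverage_const (Metric.measure_ball_pos _ _ hr).ne' measure_ball_lt_top.ne c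

theorem average_ball_add {d : ℕ} {f g : EuclideanSpace ℝ (Fin d) → ℝ}
    {x : EuclideanSpace ℝ (Fin d)} {r : ℝ} (hf : ContinuousOn f (Metric.closedBall x r))
    (hg : ContinuousOn g (Metric.closedBall x r)) :
    ⨍ y in Metric.ball x r, (f y + g y) =
      (⨍ y in Metric.ball x r, f y) + ⨍ y in Metric.ball x r, g y := by
  rw [setAverage_eq, setAverage_eq, setAverage_eq,
    integral_add (integrableOn_ball hf) (integrableOn_ball hg), smul_add]

theorem average_ball_const_mul {d : ℕ} (f : EuclideanSpace ℝ (Fin d) → ℝ)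
    (x : EuclideanSpace ℝ (Fin d)) (r c : ℝ) :
    ⨍ y in Metric.ball x r, c * f y = c * ⨍ y in Metric.ball x r, f y := by
  rw [setAverage_eq, setAverage_eq, integral_const_mul, smul_eq_mul, smul_eq_mul]
  ring

theorem average_ball_neg {d : ℕ} (f : EuclideanSpace ℝ (Fin d) → ℝ)
    (x : EuclideanSpace ℝ (Fin d)) (r : ℝ) :
    ⨍ y in Metric.ball x r, -f y = -⨍ y in Metric.ball x r, f y := by
  have := average_ball_const_mul f x r (-1)
  simpa only [neg_one_mul] using this

/-! ### Sub- and superharmonic functions through mean values. -/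

section MeanValue
variable {d : ℕ} {f g : EuclideanSpace ℝ (Fin d) → ℝ} {S S' : Set (EuclideanSpace ℝ (Fin d))}

theorem isSuperharmonicOn_iff_neg : IsSuperharmonicOn f S ↔ IsSubharmonicOn (fun y => -f y) S := by
  unfold IsSuperharmonicOn IsSubharmonicOn
  refine and_congr ⟨fun h => h.neg, fun h => h.neg.congr fun x _ => (neg_neg (f x)).symm⟩ ?_
  refine forall_congr' fun x => forall_congr' fun r => forall_congr' fun hr =>
    forall_congr' fun hS => ?_
  rw [average_ball_neg, neg_le_neg_iff]

theorem IsSubharmonicOn.mono (h : IsSubharmonicOn f S) (hS : S' ⊆ S) : IsSubharmonicOn f S' :=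
  ⟨h.1.mono hS, fun x r hr hx => h.2 x r hr (hx.trans hS)⟩

theorem IsSuperharmonicOn.mono (h : IsSuperharmonicOn f S) (hS : S' ⊆ S) :
    IsSuperharmonicOn f S' :=
  ⟨h.1.mono hS, fun x r hr hx => h.2 x r hr (hx.trans hS)⟩

theorem IsSubharmonicOn.congr (h : IsSubharmonicOn f S) (hfg : ∀ x ∈ S, g x = f x) :
    IsSubharmonicOn g S := by
  refine ⟨h.1.congr hfg, fun x r hr hx => ?_⟩
  rw [hfg x (hx (Metric.mem_closedBall_self hr.le)),
    average_ball_congr fun y hy => hfg y (hx (Metric.ball_subset_closedBall hy))]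
  exact h.2 x r hr hx

theorem IsSuperharmonicOn.congr (h : IsSuperharmonicOn f S) (hfg : ∀ x ∈ S, g x = f x) :
    IsSuperharmonicOn g S := by
  rw [isSuperharmonicOn_iff_neg] at h ⊢
  exact h.congr fun x hx => by rw [hfg x hx]

theorem isSubharmonicOn_const (c : ℝ) : IsSubharmonicOn (fun _ => c) S :=
  ⟨continuousOn_const, fun x _ hr _ => (average_ball_const x hr c).ge⟩

theorem isSuperharmonicOn_const (c : ℝ) : IsSuperharmonicOn (fun _ => c) S :=
  ⟨continuousOn_const, fun x _ hr _ => (average_ball_const x hr c).le⟩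

theorem IsSubharmonicOn.add (hf : IsSubharmonicOn f S) (hg : IsSubharmonicOn g S) :
    IsSubharmonicOn (fun x => f x + g x) S := by
  refine ⟨hf.1.add hg.1, fun x r hr hx => ?_⟩
  rw [average_ball_add (hf.1.mono hx) (hg.1.mono hx)]
  exact add_le_add (hf.2 x r hr hx) (hg.2 x r hr hx)

theorem IsSubharmonicOn.sub (hf : IsSubharmonicOn f S) (hg : IsSuperharmonicOn g S) :
    IsSubharmonicOn (fun x => f x - g x) S := by
  rw [isSuperharmonicOn_iff_neg] at hg
  simpa only [sub_eq_add_neg] using hf.add hg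

theorem IsSubharmonicOn.const_mul (hf : IsSubharmonicOn f S) {c : ℝ} (hc : 0 ≤ c) :
    IsSubharmonicOn (fun x => c * f x) S := by
  refine ⟨continuousOn_const.mul hf.1, fun x r hr hx => ?_⟩
  rw [average_ball_const_mul]
  exact mul_le_mul_of_nonneg_left (hf.2 x r hr hx) hc

theorem IsSuperharmonicOn.const_mul (hf : IsSuperharmonicOn f S) {c : ℝ} (hc : 0 ≤ c) :
    IsSuperharmonicOn (fun x => c * f x) S := by
  rw [isSuperharmonicOn_iff_neg] at hf ⊢
  simpa using hf.const_mul hc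

theorem IsSubharmonicOn.max (hf : IsSubharmonicOn f S) (hg : IsSubharmonicOn g S) :
    IsSubharmonicOn (fun x => Max.max (f x) (g x)) S := by
  have hc : ContinuousOn (fun x => Max.max (f x) (g x)) S := hf.1.sup hg.1
  refine ⟨hc, fun x r hr hx => max_le ?_ ?_⟩
  · exact (hf.2 x r hr hx).trans (average_ball_mono (hf.1.mono hx) (hc.mono hx)
      fun y _ => le_max_left _ _)
  · exact (hg.2 x r hr hx).trans (average_ball_mono (hg.1.mono hx) (hc.mono hx)
      fun y _ => le_max_right _ _)

theorem IsSuperharmonicOn.min (hf : IsSuperharmonicOn f S) (hg : IsSuperharmonicOn g S) :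
    IsSuperharmonicOn (fun x => Min.min (f x) (g x)) S := by
  rw [isSuperharmonicOn_iff_neg] at hf hg ⊢
  exact (hf.max hg).congr fun x _ => (max_neg_neg (f x) (g x)).symm

theorem IsSubharmonicOn.comp_smul (hf : IsSubharmonicOn f S) {c : ℝ} (hc : 0 < c) :
    IsSubharmonicOn (fun x => f (c • x)) {x | c • x ∈ S} := by
  refine ⟨hf.1.comp (by fun_prop) fun x hx => hx, fun x r hr hx => ?_⟩
  have h := hf.2 (c • x) (c * r) (by positivity) ?_
  · rw [average_ball_eq _ _ (by positivity : 0 < c * r)] at h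
    rw [average_ball_eq _ _ hr]
    simpa [smul_smul] using h
  · intro y hy
    have := @hx (c⁻¹ • y) ?_
    · simpa [smul_smul, hc.ne'] using this
    · have : c⁻¹ • y - x = c⁻¹ • (y - c • x) := by
        rw [smul_sub, smul_smul, inv_mul_cancel₀ hc.ne', one_smul]
      rw [Metric.mem_closedBall, dist_eq_norm] at hy ⊢
      rw [this, norm_smul, Real.norm_of_nonneg (by positivity), inv_mul_le_iff₀ hc]
      exact hy

theorem IsSuperharmonicOn.comp_smul (hf : IsSuperharmonicOn f S) {c : ℝ} (hc : 0 < c) :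
    IsSuperharmonicOn (fun x => f (c • x)) {x | c • x ∈ S} := by
  rw [isSuperharmonicOn_iff_neg] at hf ⊢
  exact hf.comp_smul hc

theorem exists_closedBall_subset_of_closedBall_subset (hS : IsOpen S)
    {x : EuclideanSpace ℝ (Fin d)} {r : ℝ} (hr : 0 ≤ r) (h : Metric.closedBall x r ⊆ S) :
    ∃ η > 0, Metric.closedBall x (r + η) ⊆ S := by
  obtain ⟨δ, hδ, h2⟩ := (isCompact_closedBall x r).exists_cthickening_subset_open hS h
  refine ⟨δ, hδ, ?_⟩
  rwa [cthickening_closedBall hδ.le hr, add_comm] at h2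

theorem isSubharmonicOn_of_lap_nonneg (hS : IsOpen S) (hf : ContDiffOn ℝ 2 f S)
    (hl : ∀ x ∈ S, 0 ≤ lap f x) : IsSubharmonicOn f S := by
  refine ⟨hf.continuousOn, fun x r hr hx => ?_⟩
  obtain ⟨η, hη, hx2⟩ := exists_closedBall_subset_of_closedBall_subset hS hr.le hx
  -- The cutoff equals 1 on a ball larger than the given one, so `χ * f` is globally `C²` without
  -- changing `f` or its Laplacian where they are used.
  let χ : ContDiffBump x := ⟨r + η / 2, r + η, by linarith, by linarith⟩
  have hχ : ∀ y ∈ Metric.ball x (r + η / 2), χ y * f y = f y := fun y hy => by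
    rw [χ.one_of_mem_closedBall (Metric.ball_subset_closedBall hy), one_mul]
  have hC : ContDiff ℝ 2 fun y => χ y * f y := by
    rw [contDiff_iff_contDiffAt]
    intro y
    by_cases hy : y ∈ S
    · exact χ.contDiffAt.mul (hf.contDiffAt (hS.mem_nhds hy))
    · have : (fun y => χ y * f y) =ᶠ[𝓝 y] fun _ => 0 := by
        have hy' : y ∈ (Metric.closedBall x (r + η))ᶜ := fun h => hy (hx2 h)
        filter_upwards [Metric.isClosed_closedBall.isOpen_compl.mem_nhds hy'] with z hz
        simp only [mem_compl_iff, Metric.mem_closedBall, not_le] at hz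
        rw [χ.zero_of_le_dist hz.le, zero_mul]
      exact contDiffAt_const.congr_of_eventuallyEq this
  have h := submean_of_lap_nonneg hC (x := x) hr ?_
  · rw [hχ x (Metric.mem_ball_self (by linarith)), average_ball_congr fun y hy =>
      hχ y (Metric.ball_subset_ball (by linarith) hy)] at h
    exact h
  · intro y hy
    have : (fun y => χ y * f y) =ᶠ[𝓝 y] f := by
      filter_upwards [Metric.isOpen_ball.mem_nhds
        (Metric.ball_subset_ball (by linarith : r ≤ r + η / 2) hy)] with z hz using hχ z hz
    rw [lap_congr this]
    exact hl y (hx (Metric.ball_subset_closedBall hy))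

theorem isSuperharmonicOn_of_lap_nonpos (hS : IsOpen S) (hf : ContDiffOn ℝ 2 f S)
    (hl : ∀ x ∈ S, lap f x ≤ 0) : IsSuperharmonicOn f S := by
  rw [isSuperharmonicOn_iff_neg]
  exact isSubharmonicOn_of_lap_nonneg hS hf.neg fun x hx => by
    rw [lap_neg]; linarith [hl x hx]

theorem continuousOn_of_local (h : ∀ x ∈ S, ∃ δ > 0, ContinuousOn f (Metric.ball x δ)) :
    ContinuousOn f S := fun x hx => by
  obtain ⟨δ, hδ, h⟩ := h x hx
  exact (h.continuousAt (Metric.ball_mem_nhds x hδ)).continuousWithinAt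

/-- If the Laplacian were negative at `x`, then `-f` minus a small multiple of `‖y - x‖ ^ 2` would
still have nonnegative Laplacian nearby. Its sub-mean value property would make the average of `f`
strictly smaller than `f x`. -/
theorem lap_nonneg_of_submean (hf : ContDiff ℝ 2 f) (x : EuclideanSpace ℝ (Fin d)) {δ : ℝ}
    (hδ : 0 < δ) (h : ∀ ρ, 0 < ρ → ρ < δ → f x ≤ ⨍ y in Metric.ball x ρ, f y) : 0 ≤ lap f x := by
  by_contra! hneg
  rcases Nat.eq_zero_or_pos d with rfl | hd
  · simp [lap] at hneg
  have hd' : (0 : ℝ) < d := by exact_mod_cast hd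
  -- The Laplacian of `-c * ‖y - x‖ ^ 2` is then `lap f x / 2`, which uses up half of the negativity
  -- and leaves the other half for continuity.
  set c := -lap f x / (4 * d) with hc
  have hc0 : 0 < c := by rw [hc]; apply div_pos <;> linarith
  have hcq : ∀ a : EuclideanSpace ℝ (Fin d), ContDiff ℝ 2 fun y => -c * ‖y - a‖ ^ 2 := fun a =>
    contDiff_const.mul ((contDiff_id.sub contDiff_const).norm_sq ℝ)
  have hcont : Continuous (lap f) := by
    unfold lap
    refine continuous_finsetSum _ fun i _ => ?_
    have : ContDiff ℝ 1 fun y => fderiv ℝ f y (EuclideanSpace.single i 1) :=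
      (hf.fderiv_right (m := 1) (by norm_num)).clm_apply contDiff_const
    exact (this.continuous_fderiv (by norm_num)).clm_apply continuous_const
  have h1 : ∀ᶠ y in 𝓝 x, lap f y < lap f x / 2 :=
    hcont.continuousAt.eventually (gt_mem_nhds (by linarith))
  obtain ⟨ε, hε, h2⟩ := Metric.eventually_nhds_iff_ball.1 h1
  set ρ := min (δ / 2) (ε / 2) with hρ
  have hρ0 : 0 < ρ := by positivity
  have hρδ : ρ < δ := (min_le_left _ _).trans_lt (by linarith)
  have hρε : ρ < ε := (min_le_right _ _).trans_lt (by linarith)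
  have h3 := submean_of_lap_nonneg (f := fun y => -f y + -c * ‖y - x‖ ^ 2)
    (hf.neg.add (hcq x)) (x := x) hρ0 ?_
  · rw [average_ball_add hf.neg.continuous.continuousOn (hcq x).continuous.continuousOn,
      average_ball_neg, average_ball_const_mul] at h3
    have h4 := h ρ hρ0 hρδ
    have h5 : 0 < ⨍ y in Metric.ball x ρ, ‖y - x‖ ^ 2 := by
      rw [setAverage_eq, smul_eq_mul]
      refine mul_pos (inv_pos.2 (volume_real_ball_pos x hρ0)) ?_
      rw [setIntegral_pos_iff_support_of_nonneg_ae]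
      · have : ({x}ᶜ : Set (EuclideanSpace ℝ (Fin d))) ∩ Metric.ball x ρ ⊆
            (Function.support fun y => ‖y - x‖ ^ 2) ∩ Metric.ball x ρ := by
          rintro y ⟨hy, hy'⟩
          refine ⟨?_, hy'⟩
          simpa [sub_eq_zero] using hy
        refine lt_of_lt_of_le ?_ (measure_mono this)
        have : Nonempty (Fin d) := ⟨⟨0, hd⟩⟩
        have hop : IsOpen (({x}ᶜ : Set (EuclideanSpace ℝ (Fin d))) ∩ Metric.ball x ρ) :=
          isOpen_compl_singleton.inter Metric.isOpen_ball
        refine hop.measure_pos _ ⟨x + EuclideanSpace.single ⟨0, hd⟩ (ρ / 2), ?_, ?_⟩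
        · simp [hρ0.ne']
        · simp [abs_of_pos hρ0, hρ0]
      · exact Eventually.of_forall fun y => by positivity
      · exact integrableOn_ball (by fun_prop)
    simp only [sub_self, norm_zero] at h3
    nlinarith
  · intro y hy
    rw [lap_add hf.contDiffAt.neg (hcq x).contDiffAt, lap_neg, lap_const_mul_norm_sub_sq]
    have := h2 y (Metric.ball_subset_ball hρε.le hy)
    have e : 2 * d * -c = lap f x / 2 := by rw [hc]; field_simp; ring
    rw [e]; linarith

/-- Averaging over a ball commutes with translation, so by Fubini the average of a mollification is
the mollification of the averages. -/
theorem mollification_submean {f : EuclideanSpace ℝ (Fin d) → ℝ} (hf : Continuous f)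
    (hfc : HasCompactSupport f) (φ : ContDiffBump (0 : EuclideanSpace ℝ (Fin d)))
    {y : EuclideanSpace ℝ (Fin d)} {ρ : ℝ} (hρ : 0 < ρ)
    (h : ∀ t ∈ Metric.ball (0 : EuclideanSpace ℝ (Fin d)) φ.rOut,
      f (y - t) ≤ ⨍ z in Metric.ball (y - t) ρ, f z) :
    ∫ t, φ.normed volume t * f (y - t) ≤
      ⨍ z in Metric.ball y ρ, ∫ t, φ.normed volume t * f (z - t) := by
  obtain ⟨C, hC⟩ := hfc.exists_bound_of_continuous hf
  have hφi : Integrable (φ.normed (volume : Measure (EuclideanSpace ℝ (Fin d)))) :=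
    φ.integrable_normed
  have hint : ∀ a : EuclideanSpace ℝ (Fin d),
      Integrable (fun t => φ.normed volume t * f (a - t)) := fun a =>
    hφi.mul_bdd (c := C) (by fun_prop) (Eventually.of_forall fun t => hC _)
  set B := Metric.ball (0 : EuclideanSpace ℝ (Fin d)) 1
  have hfin : IsFiniteMeasure ((volume : Measure (EuclideanSpace ℝ (Fin d))).restrict B) :=
    ⟨by rw [Measure.restrict_apply_univ]; exact measure_ball_lt_top⟩
  have hswap : ∫ z in B, ∫ t, φ.normed volume t * f (y + ρ • z - t) =
      ∫ t, ∫ z in B, φ.normed volume t * f (y + ρ • z - t) := by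
    apply integral_integral_swap
    have h1 : Integrable (fun p : EuclideanSpace ℝ (Fin d) × EuclideanSpace ℝ (Fin d) =>
        φ.normed volume p.2) ((volume.restrict B).prod volume) := hφi.comp_snd _
    refine h1.mul_bdd (c := C) ?_ (Eventually.of_forall fun t => hC _)
    exact (hf.comp (by fun_prop)).aestronglyMeasurable
  have havg : ∀ t, ∫ z in B, φ.normed volume t * f (y + ρ • z - t) =
      volume.real B * (φ.normed volume t * ⨍ z in Metric.ball (y - t) ρ, f z) := by
    intro t
    rw [average_ball_eq f (y - t) hρ, setAverage_eq, integral_const_mul, smul_eq_mul]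
    have : ∀ z, y + ρ • z - t = y - t + ρ • z := fun z => by abel
    simp only [this]
    have hB : volume.real B ≠ 0 := (volume_real_ball_pos _ one_pos).ne'
    change _ = volume.real B * (_ * ((volume.real B)⁻¹ * ∫ z in B, f (y - t + ρ • z)))
    field_simp
  rw [average_ball_eq (fun z => ∫ t, φ.normed volume t * f (z - t)) y hρ, setAverage_eq, hswap,
    smul_eq_mul, ← integral_const_mul]
  refine integral_mono (hint y) ?_ fun t => ?_
  · have h1 : Integrable (fun p : EuclideanSpace ℝ (Fin d) × EuclideanSpace ℝ (Fin d) =>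
        φ.normed volume p.1) (volume.prod (volume.restrict B)) := hφi.comp_fst _
    have h2 : Integrable (fun p : EuclideanSpace ℝ (Fin d) × EuclideanSpace ℝ (Fin d) =>
        φ.normed volume p.1 * f (y + ρ • p.2 - p.1)) (volume.prod (volume.restrict B)) :=
      h1.mul_bdd (c := C) (hf.comp (by fun_prop)).aestronglyMeasurable
        (Eventually.of_forall fun t => hC _)
    exact Integrable.const_mul (Integrable.integral_prod_left h2) _
  · simp only
    rw [havg t, ← mul_assoc, inv_mul_cancel₀
      (volume_real_ball_pos (0 : EuclideanSpace ℝ (Fin d)) one_pos).ne', one_mul]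
    by_cases ht : t ∈ Metric.ball (0 : EuclideanSpace ℝ (Fin d)) φ.rOut
    · exact mul_le_mul_of_nonneg_left (h t ht) (φ.nonneg_normed t)
    · have : φ.normed volume t = 0 := by
        rw [← Function.notMem_support, φ.support_normed_eq]; exact ht
      rw [this, zero_mul, zero_mul]

end MeanValue

/-! ### Locality of subharmonicity and the maximum principle. -/

section Locality
variable {d : ℕ} {f g : EuclideanSpace ℝ (Fin d) → ℝ} {S S' : Set (EuclideanSpace ℝ (Fin d))}

/-- Mollification keeps the sub-mean property for small radii, and for a smooth function this
amounts to a nonnegative Laplacian, which gives the property at the full radius. Uniform closeness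
of the mollification returns it to `f`. -/
theorem submean_of_local {x : EuclideanSpace ℝ (Fin d)} {r η δ : ℝ} (hr : 0 < r) (hη : 0 < η)
    (hδ : 0 < δ) (hf : Continuous f) (hfc : HasCompactSupport f)
    (h : ∀ y ∈ Metric.closedBall x (r + η), ∀ ρ, 0 < ρ → ρ < δ →
      f y ≤ ⨍ z in Metric.ball y ρ, f z) :
    f x ≤ ⨍ y in Metric.ball x r, f y := by
  refine le_of_forall_pos_le_add fun e he => ?_
  obtain ⟨κ, hκ, hu⟩ := Metric.uniformContinuous_iff.1 (hfc.uniformContinuous_of_continuous hf) (e / 2) (by linarith)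
  set ε := min κ (η / 2) with hε
  have hε0 : 0 < ε := by positivity
  let φ : ContDiffBump (0 : EuclideanSpace ℝ (Fin d)) := ⟨ε / 2, ε, by linarith, by linarith⟩
  set F : EuclideanSpace ℝ (Fin d) → ℝ := fun y => ∫ t, φ.normed volume t * f (y - t) with hF
  have hFconv : F = MeasureTheory.convolution (φ.normed volume) f (ContinuousLinearMap.lsmul ℝ ℝ)
      volume := by
    ext y; simp [hF, MeasureTheory.convolution]
  have hFC : ContDiff ℝ 2 F := by
    rw [hFconv]
    exact φ.hasCompactSupport_normed.contDiff_convolution_left _ φ.contDiff_normed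
      hf.locallyIntegrable
  have hclose : ∀ y, |F y - f y| ≤ e / 2 := by
    intro y
    rw [← Real.dist_eq, hFconv]
    refine φ.dist_normed_convolution_le hf.aestronglyMeasurable fun z hz => ?_
    exact (hu (lt_of_lt_of_le hz (min_le_left _ _))).le
  have hsub := submean_of_lap_nonneg hFC (x := x) hr fun y hy => ?_
  · have h1 := hclose x
    have h2 : ⨍ y in Metric.ball x r, F y ≤ (⨍ y in Metric.ball x r, f y) + e / 2 := by
      calc ⨍ y in Metric.ball x r, F y ≤ ⨍ y in Metric.ball x r, (f y + e / 2) :=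
            average_ball_mono hFC.continuous.continuousOn (hf.add continuous_const).continuousOn
              fun y _ => by linarith [(abs_le.1 (hclose y)).2]
        _ = _ := by
          rw [average_ball_add hf.continuousOn continuousOn_const, average_ball_const x hr]
    linarith [(abs_le.1 h1).1]
  · refine lap_nonneg_of_submean hFC y hδ fun ρ hρ hρδ => ?_
    refine mollification_submean hf hfc φ hρ fun t ht => h _ ?_ ρ hρ hρδ
    have ht' : ‖t‖ < ε := by simpa using ht
    have h3 : ‖y - x‖ < r := by simpa [dist_eq_norm] using hy
    have h4 : ε ≤ η / 2 := min_le_right _ _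
    rw [Metric.mem_closedBall, dist_eq_norm]
    have : y - t - x = (y - x) - t := by abel
    rw [this]
    linarith [norm_sub_le (y - x) t]

/-- Subharmonicity is a local property. -/
theorem isSubharmonicOn_of_local (hS : IsOpen S)
    (h : ∀ x ∈ S, ∃ δ > 0, IsSubharmonicOn f (Metric.ball x δ)) : IsSubharmonicOn f S := by
  have hc : ContinuousOn f S := continuousOn_of_local fun x hx => by
    obtain ⟨δ, hδ, h⟩ := h x hx
    exact ⟨δ, hδ, h.1⟩
  refine ⟨hc, fun x r hr hx => ?_⟩
  obtain ⟨η, hη, hx2⟩ := exists_closedBall_subset_of_closedBall_subset hS hr.le hx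
  let χ : ContDiffBump x := ⟨r + 2 * η / 3, r + η, by linarith, by linarith⟩
  have hχ : ∀ y ∈ Metric.ball x (r + 2 * η / 3), χ y * f y = f y := fun y hy => by
    rw [χ.one_of_mem_closedBall (Metric.ball_subset_closedBall hy), one_mul]
  have hχ0 : ∀ y ∉ Metric.closedBall x (r + η), χ y * f y = 0 := fun y hy => by
    simp only [Metric.mem_closedBall, not_le] at hy
    rw [χ.zero_of_le_dist hy.le, zero_mul]
  have hC : Continuous fun y => χ y * f y := by
    rw [continuous_iff_continuousAt]
    intro y
    by_cases hy : y ∈ S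
    · exact χ.continuous.continuousAt.mul (hc.continuousAt (hS.mem_nhds hy))
    · have : (fun y => χ y * f y) =ᶠ[𝓝 y] fun _ => 0 := by
        have hy' : y ∈ (Metric.closedBall x (r + η))ᶜ := fun h => hy (hx2 h)
        filter_upwards [Metric.isClosed_closedBall.isOpen_compl.mem_nhds hy'] with z hz using hχ0 z hz
      exact continuousAt_const.congr this.symm
  have hcpt : IsCompact (Metric.closedBall x (r + η / 3)) := isCompact_closedBall _ _
  have hKS : Metric.closedBall x (r + η / 3) ⊆ S :=
    (Metric.closedBall_subset_closedBall (by linarith)).trans hx2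
  choose! δ hδ0 hδ using h
  -- A Lebesgue number turns the pointwise radii into a single one valid on the whole compact ball.
  obtain ⟨δ₁, hδ₁, hL⟩ := lebesgue_number_lemma_of_metric (c := fun y : S => Metric.ball (y : EuclideanSpace ℝ (Fin d)) (δ y)) hcpt (fun _ => Metric.isOpen_ball)
    fun y hy => mem_iUnion.2 ⟨⟨y, hKS hy⟩, Metric.mem_ball_self (hδ0 y (hKS hy))⟩
  have := submean_of_local (f := fun y => χ y * f y) (x := x) (r := r) (η := η / 3)
    (δ := min δ₁ (η / 3)) hr (by linarith) (by positivity) hC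
    (HasCompactSupport.intro (isCompact_closedBall x (r + η)) hχ0) ?_
  · rw [hχ x (Metric.mem_ball_self (by linarith)), average_ball_congr fun y hy =>
      hχ y (Metric.ball_subset_ball (by linarith) hy)] at this
    exact this
  · intro y hy ρ hρ hρδ
    obtain ⟨⟨i, hi⟩, hbi⟩ := hL y hy
    have hb : Metric.closedBall y ρ ⊆ Metric.ball i (δ i) :=
      (Metric.closedBall_subset_ball (hρδ.trans_le (min_le_left _ _))).trans hbi
    have hsub : Metric.closedBall y ρ ⊆ Metric.ball x (r + 2 * η / 3) := by
      intro z hz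
      have h1 : ρ < η / 3 := hρδ.trans_le (min_le_right _ _)
      rw [Metric.mem_closedBall] at hz hy
      rw [Metric.mem_ball]
      linarith [dist_triangle z y x]
    rw [hχ y (hsub (Metric.mem_closedBall_self hρ.le)), average_ball_congr fun z hz =>
      hχ z (hsub (Metric.ball_subset_closedBall hz))]
    exact (hδ i hi).2 y ρ hρ hb

/-- Superharmonicity is a local property. -/
theorem isSuperharmonicOn_of_local (hS : IsOpen S)
    (h : ∀ x ∈ S, ∃ δ > 0, IsSuperharmonicOn f (Metric.ball x δ)) : IsSuperharmonicOn f S := by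
  rw [isSuperharmonicOn_iff_neg]
  refine isSubharmonicOn_of_local hS fun x hx => ?_
  obtain ⟨δ, hδ, h⟩ := h x hx
  exact ⟨δ, hδ, isSuperharmonicOn_iff_neg.1 h⟩

/-- At an interior maximum point the sub-mean property makes `f` constant on a ball. Choosing the
maximum point with the largest first coordinate gives a contradiction at once, with no connectedness
argument; this needs a coordinate, hence `0 < d`. -/
theorem IsSubharmonicOn.le_of_le_frontier (hd : 0 < d) (hS : IsOpen S)
    (hSb : Bornology.IsBounded S) (hfc : ContinuousOn f (closure S)) (hf : IsSubharmonicOn f S)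
    {M : ℝ} (hM : ∀ x ∈ frontier S, f x ≤ M) : ∀ x ∈ closure S, f x ≤ M := by
  intro x₀ hx₀
  by_contra! hlt
  have hcpt : IsCompact (closure S) := hSb.isCompact_closure
  obtain ⟨x₁, hx₁, hmax⟩ := hcpt.exists_isMaxOn ⟨x₀, hx₀⟩ hfc
  set N := f x₁ with hN
  have hNM : M < N := hlt.trans_le (hmax hx₀)
  have hA : IsCompact (closure S ∩ f ⁻¹' {N}) :=
    hcpt.of_isClosed_subset (hfc.preimage_isClosed_of_isClosed isClosed_closure isClosed_singleton)
      inter_subset_left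
  obtain ⟨x, ⟨hxS, hxN⟩, hxmax⟩ := hA.exists_isMaxOn (f := fun y : EuclideanSpace ℝ (Fin d) => y ⟨0, hd⟩)
    ⟨x₁, hx₁, rfl⟩ (by fun_prop)
  simp only [mem_preimage, mem_singleton_iff] at hxN
  have hxS' : x ∈ S := by
    by_contra hxn
    have := hM x ⟨hxS, by rwa [hS.interior_eq]⟩
    linarith
  obtain ⟨r, hr, hball⟩ := Metric.nhds_basis_closedBall.mem_iff.1 (hS.mem_nhds hxS')
  have hfb : ContinuousOn f (Metric.closedBall x r) := hf.1.mono hball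
  have h1 := hf.2 x r hr hball
  have hle : ∀ y ∈ Metric.ball x r, f y ≤ N := fun y hy =>
    hmax (subset_closure (hball (Metric.ball_subset_closedBall hy)))
  have h2 : ∫ y in Metric.ball x r, (N - f y) ≤ 0 := by
    have h3 : ⨍ y in Metric.ball x r, (N + -f y) ≤ 0 := by
      rw [average_ball_add continuousOn_const hfb.fun_neg, average_ball_const x hr, average_ball_neg]
      linarith
    rw [setAverage_eq, smul_eq_mul, inv_mul_le_iff₀ (volume_real_ball_pos x hr), mul_zero] at h3
    simpa only [sub_eq_add_neg] using h3
  have hnn : 0 ≤ᵐ[volume.restrict (Metric.ball x r)] fun y => N - f y := by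
    filter_upwards [ae_restrict_mem Metric.isOpen_ball.measurableSet] with y hy
    simpa using hle y hy
  have hint : IntegrableOn (fun y => N - f y) (Metric.ball x r) :=
    integrableOn_ball (continuousOn_const.sub hfb)
  have h4 := (integral_eq_zero_iff_of_nonneg_ae hnn hint).1
    (le_antisymm h2 (integral_nonneg_of_ae hnn))
  have h5 := Measure.eqOn_open_of_ae_eq h4 Metric.isOpen_ball
    ((continuousOn_const.sub hfb).mono Metric.ball_subset_closedBall) continuousOn_const
  set y := x + EuclideanSpace.single ⟨0, hd⟩ (r / 2) with hy
  have hyb : y ∈ Metric.ball x r := by simp [hy, abs_of_pos hr, hr]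
  have h6 := h5 hyb
  simp only [Pi.zero_apply] at h6
  have h7 := hxmax (show y ∈ closure S ∩ f ⁻¹' {N} from
    ⟨subset_closure (hball (Metric.ball_subset_closedBall hyb)), by simp; linarith⟩)
  simp [hy] at h7
  linarith

theorem IsSuperharmonicOn.le_of_frontier_le (hd : 0 < d) (hS : IsOpen S)
    (hSb : Bornology.IsBounded S) (hfc : ContinuousOn f (closure S)) (hf : IsSuperharmonicOn f S)
    {M : ℝ} (hM : ∀ x ∈ frontier S, M ≤ f x) : ∀ x ∈ closure S, M ≤ f x := fun x hx => by
  have := (isSuperharmonicOn_iff_neg.1 hf).le_of_le_frontier hd hS hSb hfc.fun_neg (M := -M)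
    (fun y hy => neg_le_neg (hM y hy)) x hx
  linarith

/-- A subharmonic function lies below a superharmonic one if it does so on the boundary. -/
theorem IsSubharmonicOn.le_on (hd : 0 < d) (hS : IsOpen S)
    (hSb : Bornology.IsBounded S) (hfc : ContinuousOn f (closure S))
    (hgc : ContinuousOn g (closure S)) (hf : IsSubharmonicOn f S) (hg : IsSuperharmonicOn g S)
    (hM : ∀ x ∈ frontier S, f x ≤ g x) : ∀ x ∈ closure S, f x ≤ g x := fun x hx => by
  have := (hf.sub hg).le_of_le_frontier hd hS hSb (hfc.fun_sub hgc) (M := 0)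
    (fun y hy => by linarith [hM y hy]) x hx
  linarith

/-- A nonnegative continuous function that is subharmonic where it is positive
is subharmonic. -/
theorem isSubharmonicOn_of_pos (hS : IsOpen S) (hc : ContinuousOn f S) (h0 : ∀ x ∈ S, 0 ≤ f x)
    (h : IsSubharmonicOn f {x | x ∈ S ∧ 0 < f x}) : IsSubharmonicOn f S := by
  -- After truncation at height `ε` the function vanishes identically near each zero of `f`, so no
  -- zero lies on the boundary of the region where subharmonicity is known. Locality applies, and
  -- then `ε` tends to 0.
  have hε : ∀ ε > 0, IsSubharmonicOn (fun x => max (f x - ε) 0) S := by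
    intro ε hε
    refine isSubharmonicOn_of_local hS fun x hx => ?_
    have hcx : ContinuousAt f x := hc.continuousAt (hS.mem_nhds hx)
    rcases (h0 x hx).eq_or_lt with h1 | h1
    · have : ∀ᶠ y in 𝓝 x, f y < ε := hcx.eventually (gt_mem_nhds (by linarith))
      obtain ⟨δ, hδ, hb⟩ := Metric.eventually_nhds_iff_ball.1 this
      refine ⟨δ, hδ, (isSubharmonicOn_const 0).congr fun y hy => max_eq_right ?_⟩
      linarith [hb y hy]
    · have : ∀ᶠ y in 𝓝 x, y ∈ S ∧ 0 < f y :=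
        (hS.eventually_mem hx).and (hcx.eventually (lt_mem_nhds h1))
      obtain ⟨δ, hδ, hb⟩ := Metric.eventually_nhds_iff_ball.1 this
      exact ⟨δ, hδ, ((h.mono hb).sub (isSuperharmonicOn_const ε)).max (isSubharmonicOn_const 0)⟩
  refine ⟨hc, fun x r hr hx => le_of_forall_pos_le_add fun ε hε0 => ?_⟩
  have h1 := (hε ε hε0).2 x r hr hx
  have h2 : ⨍ y in Metric.ball x r, max (f y - ε) 0 ≤ ⨍ y in Metric.ball x r, f y :=
    average_ball_mono ((hε ε hε0).1.mono hx) (hc.mono hx) fun y hy =>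
      max_le (by linarith) (h0 y (hx (Metric.ball_subset_closedBall hy)))
  linarith [le_max_left (f x - ε) 0]

end Locality

/-! ### Harmonic polynomials and the approximate Dirichlet problem on a ball. -/

section Poly
open MvPolynomial

theorem contDiff_eval {d : ℕ} (p : MvPolynomial (Fin d) ℝ) :
    ContDiff ℝ 2 fun x : EuclideanSpace ℝ (Fin d) => eval x.ofLp p := by
  induction p using MvPolynomial.induction_on with
  | C a => simpa using contDiff_const
  | add p q hp hq => simpa using hp.add hq
  | mul_X p i hp =>
    simp only [map_mul, eval_X]
    exact hp.mul (EuclideanSpace.proj (𝕜 := ℝ) i : EuclideanSpace ℝ (Fin d) →L[ℝ] ℝ).contDiff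

theorem fderiv_eval {d : ℕ} (p : MvPolynomial (Fin d) ℝ) (i : Fin d)
    (x : EuclideanSpace ℝ (Fin d)) :
    fderiv ℝ (fun x : EuclideanSpace ℝ (Fin d) => eval x.ofLp p) x (EuclideanSpace.single i 1) =
      eval x.ofLp (pderiv i p) := by
  have hdiff : ∀ p : MvPolynomial (Fin d) ℝ, DifferentiableAt ℝ
      (fun x : EuclideanSpace ℝ (Fin d) => eval x.ofLp p) x := fun p =>
    (contDiff_eval p).differentiable (by norm_num) x
  induction p using MvPolynomial.induction_on with
  | C a => simp
  | add p q hp hq =>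
    simp only [map_add]
    rw [fderiv_fun_add (hdiff p) (hdiff q), add_apply, hp, hq]
  | mul_X p j hp =>
    have hX : HasFDerivAt (fun y : EuclideanSpace ℝ (Fin d) => y.ofLp j)
        (EuclideanSpace.proj (𝕜 := ℝ) j : EuclideanSpace ℝ (Fin d) →L[ℝ] ℝ) x :=
      (EuclideanSpace.proj (𝕜 := ℝ) j : EuclideanSpace ℝ (Fin d) →L[ℝ] ℝ).hasFDerivAt
    simp only [map_mul, eval_X]
    rw [fderiv_fun_mul (hdiff p) hX.differentiableAt, hX.fderiv, pderiv_mul, add_apply, smul_apply,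
      smul_apply, hp, pderiv_X, map_add, map_mul, map_mul, eval_X]
    by_cases hij : j = i
    · subst hij; simp; ring
    · simp [hij]; ring

/-- The Laplacian of a polynomial. -/
noncomputable def polyLap {d : ℕ} : MvPolynomial (Fin d) ℝ →ₗ[ℝ] MvPolynomial (Fin d) ℝ :=
  ∑ i, (pderiv i).toLinearMap ∘ₗ (pderiv i).toLinearMap

theorem lap_eval {d : ℕ} (p : MvPolynomial (Fin d) ℝ) (x : EuclideanSpace ℝ (Fin d)) :
    lap (fun x : EuclideanSpace ℝ (Fin d) => eval x.ofLp p) x = eval x.ofLp (polyLap p) := by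
  simp [lap, fderiv_eval, polyLap, map_sum]

theorem totalDegree_pderiv_le {d : ℕ} (i : Fin d) {p : MvPolynomial (Fin d) ℝ} {n : ℕ}
    (hp : p.totalDegree ≤ n + 1) : (pderiv i p).totalDegree ≤ n := by
  rw [p.as_sum, map_sum]
  refine totalDegree_finsetSum_le fun s hs => ?_
  rw [pderiv_monomial]
  by_cases hsi : s i = 0
  · simp [hsi]
  · refine (totalDegree_monomial_le _ _).trans ?_
    have h1 : (s.sum fun _ => id) ≤ n + 1 := (le_totalDegree hs).trans hp
    have h2 : s = (s - Finsupp.single i 1) + Finsupp.single i 1 := by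
      ext j
      by_cases hj : i = j
      · subst hj; simp; omega
      · simp [hj]
    have h3 : (s.sum fun _ => id) = ((s - Finsupp.single i 1).sum fun _ => id) + 1 := by
      conv_lhs => rw [h2]
      rw [Finsupp.sum_add_index' (by simp) (by simp)]
      simp
    change ((s - Finsupp.single i 1).sum fun _ => id) ≤ n
    omega

theorem totalDegree_polyLap_le {d : ℕ} {p : MvPolynomial (Fin d) ℝ} {n : ℕ}
    (hp : p.totalDegree ≤ n + 2) : (polyLap p).totalDegree ≤ n := by
  simp only [polyLap, LinearMap.sum_apply]
  refine totalDegree_finsetSum_le fun i _ => ?_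
  exact totalDegree_pderiv_le i (totalDegree_pderiv_le i hp)

/-- A ball contains a product of infinite sets, on which a nonzero polynomial cannot vanish. -/
theorem eval_eq_zero_of_ball {d : ℕ} {p : MvPolynomial (Fin d) ℝ} {a : EuclideanSpace ℝ (Fin d)}
    {R : ℝ} (hR : 0 < R) (h : ∀ x ∈ Metric.ball a R, eval x.ofLp p = 0) : p = 0 := by
  have ho : IsOpen ((WithLp.toLp 2 : (Fin d → ℝ) → EuclideanSpace ℝ (Fin d)) ⁻¹' Metric.ball a R) :=
    Metric.isOpen_ball.preimage (PiLp.continuous_toLp 2 _)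
  have ha : a.ofLp ∈ ((WithLp.toLp 2 : (Fin d → ℝ) → EuclideanSpace ℝ (Fin d)) ⁻¹'
      Metric.ball a R) := by simpa using hR
  obtain ⟨δ, hδ, hb⟩ := Metric.isOpen_iff.1 ho _ ha
  refine funext_set (fun i => Metric.ball (a i) δ) (fun i => ?_) fun x hx => ?_
  · rw [Real.ball_eq_Ioo]; exact Ioo_infinite (by linarith)
  · rw [map_zero]
    refine h (WithLp.toLp 2 x) (hb ?_)
    rw [ball_pi _ hδ]
    exact hx

theorem harmonic_eval {d : ℕ} {p : MvPolynomial (Fin d) ℝ} (hp : polyLap p = 0) :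
    IsSubharmonicOn (fun x : EuclideanSpace ℝ (Fin d) => eval x.ofLp p) univ ∧
      IsSuperharmonicOn (fun x : EuclideanSpace ℝ (Fin d) => eval x.ofLp p) univ :=
  ⟨isSubharmonicOn_of_lap_nonneg isOpen_univ (contDiff_eval p).contDiffOn fun x _ => by
      rw [lap_eval, hp, map_zero],
    isSuperharmonicOn_of_lap_nonpos isOpen_univ (contDiff_eval p).contDiffOn fun x _ => by
      rw [lap_eval, hp, map_zero]⟩

/-- Every polynomial agrees on a sphere with a harmonic polynomial. -/
theorem exists_harmonic_poly_eq {d : ℕ} (hd : 0 < d) (a : EuclideanSpace ℝ (Fin d)) {R : ℝ}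
    (hR : 0 < R) (q : MvPolynomial (Fin d) ℝ) :
    ∃ h : MvPolynomial (Fin d) ℝ, polyLap h = 0 ∧
      ∀ x ∈ Metric.sphere a R, eval x.ofLp h = eval x.ofLp q := by
  set Q : MvPolynomial (Fin d) ℝ := ∑ i, (X i - C (a i)) ^ 2 - C (R ^ 2) with hQ
  have hQe : ∀ x : EuclideanSpace ℝ (Fin d), eval x.ofLp Q = ‖x - a‖ ^ 2 - R ^ 2 := by
    intro x
    simp [hQ, EuclideanSpace.norm_sq_eq]
  have hQd : Q.totalDegree ≤ 2 := by
    refine (totalDegree_sub _ _).trans (max_le (totalDegree_finsetSum_le fun i _ => ?_)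
      ((totalDegree_C (σ := Fin d) (R ^ 2)).trans_le (by norm_num)))
    refine (totalDegree_pow _ _).trans ?_
    have : (X i - C (a i) : MvPolynomial (Fin d) ℝ).totalDegree ≤ 1 :=
      (totalDegree_sub _ _).trans (max_le (by simp) (by simp))
    omega
  set n := q.totalDegree
  -- With `Q = ‖x - a‖ ^ 2 - R ^ 2`, the map `p ↦ Δ(Q p)` preserves degree at most `n`, since `Q`
  -- adds two degrees and the Laplacian removes two. It is injective by the maximum principle: a
  -- harmonic `Q p` vanishing on the sphere vanishes in the ball, where `Q` has no zeros. In finite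
  -- dimension it is therefore onto, so some `p` satisfies `Δ(Q p) = Δ q`, and `q - Q p` is the
  -- harmonic polynomial sought.
  let T : restrictTotalDegree (Fin d) ℝ n →ₗ[ℝ] restrictTotalDegree (Fin d) ℝ n :=
    LinearMap.codRestrict _ ((polyLap ∘ₗ LinearMap.mulLeft ℝ Q) ∘ₗ Submodule.subtype _) <| by
      rintro ⟨p, hp⟩
      rw [mem_restrictTotalDegree] at hp ⊢
      refine totalDegree_polyLap_le ((totalDegree_mul _ _).trans ?_)
      change _ + p.totalDegree ≤ _
      omega
  have hTv : ∀ p : restrictTotalDegree (Fin d) ℝ n, (T p : MvPolynomial (Fin d) ℝ) =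
      polyLap (Q * (p : MvPolynomial (Fin d) ℝ)) := fun p => rfl
  have hinj : Function.Injective T := by
    rw [← LinearMap.ker_eq_bot, LinearMap.ker_eq_bot']
    intro p hp
    have h0 : polyLap (Q * (p : MvPolynomial (Fin d) ℝ)) = 0 := by rw [← hTv, hp]; rfl
    obtain ⟨hsub, hsup⟩ := harmonic_eval h0
    have hcont := (contDiff_eval (Q * (p : MvPolynomial (Fin d) ℝ))).continuous
    have hfr : ∀ x ∈ frontier (Metric.ball a R),
        eval x.ofLp (Q * (p : MvPolynomial (Fin d) ℝ)) = 0 := by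
      intro x hx
      rw [frontier_ball a hR.ne', mem_sphere_iff_norm] at hx
      rw [map_mul, hQe, hx, sub_self, zero_mul]
    have h1 := (hsub.mono (subset_univ _)).le_of_le_frontier hd Metric.isOpen_ball
      Metric.isBounded_ball hcont.continuousOn (fun x hx => (hfr x hx).le)
    have h2 := (hsup.mono (subset_univ _)).le_of_frontier_le hd Metric.isOpen_ball
      Metric.isBounded_ball hcont.continuousOn (fun x hx => (hfr x hx).ge)
    apply Subtype.ext
    refine eval_eq_zero_of_ball hR (a := a) fun x hx => ?_
    have h3 := le_antisymm (h1 x (subset_closure hx)) (h2 x (subset_closure hx))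
    rw [map_mul, hQe, mul_eq_zero] at h3
    refine h3.resolve_left fun h4 => ?_
    rw [mem_ball_iff_norm] at hx
    nlinarith [norm_nonneg (x - a)]
  obtain ⟨p, hp⟩ := LinearMap.injective_iff_surjective.1 hinj
    ⟨polyLap q, (mem_restrictTotalDegree _ _ _).2 (totalDegree_polyLap_le (by omega))⟩
  have hp' : polyLap (Q * (p : MvPolynomial (Fin d) ℝ)) = polyLap q := by rw [← hTv, hp]
  refine ⟨q - Q * p, by rw [map_sub, hp', sub_self], fun x hx => ?_⟩
  rw [mem_sphere_iff_norm] at hx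
  rw [map_sub, map_mul, hQe, hx, sub_self, zero_mul, sub_zero]

/-- Stone–Weierstrass for the algebra generated by the coordinates, which separate points. -/
theorem exists_poly_near {d : ℕ} {K : Set (EuclideanSpace ℝ (Fin d))} (hK : IsCompact K)
    {g : EuclideanSpace ℝ (Fin d) → ℝ} (hg : ContinuousOn g K) {ε : ℝ} (hε : 0 < ε) :
    ∃ p : MvPolynomial (Fin d) ℝ, ∀ x ∈ K, |eval x.ofLp p - g x| < ε := by
  have : CompactSpace K := isCompact_iff_compactSpace.1 hK
  let co : Fin d → C(K, ℝ) := fun i => ⟨fun x => x.1 i, by fun_prop⟩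
  let φ : MvPolynomial (Fin d) ℝ →ₐ[ℝ] C(K, ℝ) := aeval co
  have hφ : ∀ p (x : K), φ p x = eval x.1.ofLp p := by
    intro p x
    induction p using MvPolynomial.induction_on with
    | C a => simp [φ, _root_.algebraMap_apply]
    | add p q hp hq => simp [hp, hq]
    | mul_X p i hp => simp [hp]; left; simp [φ, co]
  have hsep : φ.range.SeparatesPoints := by
    rintro ⟨x, hx⟩ ⟨y, hy⟩ hxy
    have : ∃ i, x i ≠ y i := by
      by_contra! h
      exact hxy (Subtype.ext (PiLp.ext h))
    obtain ⟨i, hi⟩ := this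
    refine ⟨φ (X i), ⟨φ (X i), ⟨X i, rfl⟩, rfl⟩, ?_⟩
    rw [hφ, hφ]
    simpa using hi
  obtain ⟨⟨_, p, rfl⟩, hp⟩ := ContinuousMap.exists_mem_subalgebra_near_continuous_of_separatesPoints
    φ.range hsep (K.domRestrict g) hg.domRestrict ε hε
  refine ⟨p, fun x hx => ?_⟩
  have := hp ⟨x, hx⟩
  rw [Real.norm_eq_abs] at this
  change |φ p ⟨x, hx⟩ - g x| < ε at this
  rwa [hφ] at this

/-- Continuous data on a sphere are approximated by harmonic functions. -/
theorem exists_harmonic_near {d : ℕ} (hd : 0 < d) (a : EuclideanSpace ℝ (Fin d)) {R : ℝ}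
    (hR : 0 < R) {g : EuclideanSpace ℝ (Fin d) → ℝ} (hg : ContinuousOn g (Metric.sphere a R))
    {ε : ℝ} (hε : 0 < ε) :
    ∃ h : EuclideanSpace ℝ (Fin d) → ℝ, IsSubharmonicOn h univ ∧ IsSuperharmonicOn h univ ∧
      ∀ x ∈ Metric.sphere a R, |h x - g x| < ε := by
  obtain ⟨q, hq⟩ := exists_poly_near (isCompact_sphere a R) hg hε
  obtain ⟨h, hh, he⟩ := exists_harmonic_poly_eq hd a hR q
  exact ⟨fun x => eval x.ofLp h, (harmonic_eval hh).1, (harmonic_eval hh).2, fun x hx => by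
    simpa only [he x hx] using hq x hx⟩

end Poly

/-! ### Pointwise germs of super- and subsolutions. -/

/-- The germ at `x` of a supersolution with slope bound `Q`. -/
def SuperAt {d : ℕ} (Q : ℝ) (v : EuclideanSpace ℝ (Fin d) → ℝ) (x : EuclideanSpace ℝ (Fin d)) :
    Prop :=
  ContinuousAt v x ∧ (0 < v x → ∃ δ > 0, IsSuperharmonicOn v (Metric.ball x δ)) ∧
    (v x = 0 → ∀ p ∈ subDiff v x, ‖p‖ ^ 2 ≤ Q)

/-- `p` is a superdifferential at `x` of `v` restricted to the set where `v` is positive. -/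
def IsPosSuperDiff {d : ℕ} (v : EuclideanSpace ℝ (Fin d) → ℝ) (x p : EuclideanSpace ℝ (Fin d)) :
    Prop :=
  ∀ ε : ℝ, 0 < ε → ∀ᶠ y in 𝓝 x, 0 < v y → v y ≤ inner ℝ p (y - x) + ε * ‖y - x‖

/-- The germ at `x` of a subsolution with slope bound `Q`. -/
def SubAt {d : ℕ} (Q : ℝ) (v : EuclideanSpace ℝ (Fin d) → ℝ) (x : EuclideanSpace ℝ (Fin d)) :
    Prop :=
  ContinuousAt v x ∧ (∃ δ > 0, IsSubharmonicOn v (Metric.ball x δ)) ∧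
    (v x = 0 → (∃ᶠ y in 𝓝 x, 0 < v y) → ∀ p, IsPosSuperDiff v x p → Q ≤ ‖p‖ ^ 2)

section Germ
variable {d : ℕ} {U : Set (EuclideanSpace ℝ (Fin d))} {v g ψ : EuclideanSpace ℝ (Fin d) → ℝ}
  {x : EuclideanSpace ℝ (Fin d)} {Q μ : ℝ}

theorem IsState.continuousAt (hU : IsOpen U) (hv : IsState U v) (hx : x ∈ U) : ContinuousAt v x :=
  hv.1.continuousAt (mem_of_superset (hU.mem_nhds hx) subset_closure)

theorem mem_frontier_posSet_iff (hU : IsOpen U) (hv : IsState U v) (hx : x ∈ U) :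
    x ∈ frontier (posSet U v) ↔ v x = 0 ∧ ∃ᶠ y in 𝓝 x, 0 < v y := by
  have hc := hv.continuousAt hU hx
  constructor
  · rintro ⟨h1, h2⟩
    refine ⟨?_, (mem_closure_iff_frequently.1 h1).mono fun y hy => hy.2⟩
    refine ((hv.2 x (subset_closure hx)).eq_or_lt.resolve_right fun h => h2 ?_).symm
    rw [mem_interior_iff_mem_nhds]
    filter_upwards [hU.mem_nhds hx, hc.eventually (lt_mem_nhds h)] with y hy hy'
    exact ⟨subset_closure hy, hy'⟩
  · rintro ⟨h1, h2⟩
    refine ⟨mem_closure_iff_frequently.2 ?_, fun h => ?_⟩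
    · exact (h2.and_eventually (hU.mem_nhds hx)).mono fun y hy => ⟨subset_closure hy.2, hy.1⟩
    · exact (interior_subset h).2.ne' h1

/-- By continuity of both sides, an inequality valid where `v` is positive near `x` extends to the
closure of the positivity set. -/
theorem mem_superDiff_iff (hU : IsOpen U) (hv : IsState U v) (hx : x ∈ U)
    (p : EuclideanSpace ℝ (Fin d)) : p ∈ superDiff U v x ↔ IsPosSuperDiff v x p := by
  refine forall_congr' fun ε => forall_congr' fun hε => ?_
  rw [eventually_nhdsWithin_iff]
  constructor
  · intro h
    filter_upwards [h, hU.mem_nhds hx] with y hy hyU hpos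
    exact hy (subset_closure ⟨subset_closure hyU, hpos⟩)
  · intro h
    filter_upwards [h.eventually_nhds, hU.mem_nhds hx] with y hy hyU hcl
    by_contra! hlt
    have hc : Continuous fun z : EuclideanSpace ℝ (Fin d) => inner ℝ p (z - x) + ε * ‖z - x‖ := by
      fun_prop
    have h1 := hc.continuousAt.eventually_lt (hv.continuousAt hU hyU) hlt
    obtain ⟨z, hz, hz1, hz2⟩ := ((mem_closure_iff_frequently.1 hcl).and_eventually
      (h1.and hy)).exists
    exact (hz2 hz.2).not_gt hz1

theorem IsState.isOpen_posSet_inter (hU : IsOpen U) (hv : IsState U v) :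
    IsOpen (posSet U v ∩ U) := by
  rw [isOpen_iff_mem_nhds]
  rintro y ⟨hy, hyU⟩
  filter_upwards [hU.mem_nhds hyU, (hv.continuousAt hU hyU).eventually (lt_mem_nhds hy.2)]
    with z hz hz'
  exact ⟨⟨subset_closure hz, hz'⟩, hz⟩

theorem mem_subDiff_of_eventually_zero (h : v =ᶠ[𝓝 x] 0) {p : EuclideanSpace ℝ (Fin d)}
    (hp : p ∈ subDiff v x) : p = 0 := by
  by_contra hne
  have hn : 0 < ‖p‖ := norm_pos_iff.2 hne
  have h1 := (hp (‖p‖ / 2) (by positivity)).and h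
  have hlim : Tendsto (fun t : ℝ => x + t • p) (𝓝[>] 0) (𝓝 x) := by
    have : Continuous fun t : ℝ => x + t • p := by fun_prop
    simpa using (this.tendsto 0).mono_left nhdsWithin_le_nhds
  obtain ⟨t, ⟨h2, h3⟩, h4⟩ := ((hlim.eventually h1).and self_mem_nhdsWithin).exists
  replace h4 : 0 < t := h4
  simp only [h3, Pi.zero_apply, add_sub_cancel_left, inner_smul_right, real_inner_self_eq_norm_sq,
    norm_smul, Real.norm_eq_abs, abs_of_pos h4] at h2
  have : 0 < t * ‖p‖ ^ 2 := by positivity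
  nlinarith

/-- In the interior of the zero set the only subdifferential is 0, which obeys any nonnegative slope
bound. The germ condition can thus be asked at every zero without mentioning the free boundary. -/
theorem IsSupersolution.superAt (hU : IsOpen U) (hμ : 0 < μ) (hv : IsSupersolution U μ v)
    (hx : x ∈ U) : SuperAt (1 + μ) v x := by
  obtain ⟨hs, hh, hp⟩ := hv
  refine ⟨hs.continuousAt hU hx, fun h => ?_, fun h0 p hpd => ?_⟩
  · obtain ⟨δ, hδ, hb⟩ := Metric.isOpen_iff.1 (hs.isOpen_posSet_inter hU) x
      ⟨⟨subset_closure hx, h⟩, hx⟩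
    exact ⟨δ, hδ, hh.mono hb⟩
  · by_cases hf : ∃ᶠ y in 𝓝 x, 0 < v y
    · exact hp x ⟨(mem_frontier_posSet_iff hU hs hx).2 ⟨h0, hf⟩, hx⟩ p hpd
    · rw [not_frequently] at hf
      have : v =ᶠ[𝓝 x] 0 := by
        filter_upwards [hf, hU.mem_nhds hx] with y hy hyU
        exact le_antisymm (not_lt.1 hy) (hs.2 y (subset_closure hyU))
      rw [mem_subDiff_of_eventually_zero this hpd]
      simp; linarith

theorem isSupersolution_of_superAt (hU : IsOpen U) (hs : IsState U v)
    (h : ∀ x ∈ U, SuperAt (1 + μ) v x) : IsSupersolution U μ v := by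
  refine ⟨hs, isSuperharmonicOn_of_local (hs.isOpen_posSet_inter hU) fun y hy =>
    (h y hy.2).2.1 hy.1.2, fun y hy p hp => ?_⟩
  exact (h y hy.2).2.2 ((mem_frontier_posSet_iff hU hs hy.2).1 hy.1).1 p hp

theorem IsSubsolution.isSubharmonicOn (hU : IsOpen U) (hv : IsSubsolution U μ v) :
    IsSubharmonicOn v U :=
  isSubharmonicOn_of_pos hU (hv.1.1.mono subset_closure) (fun y hy => hv.1.2 y (subset_closure hy))
    (hv.2.1.mono fun _ hy => ⟨⟨subset_closure hy.1, hy.2⟩, hy.1⟩)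

/-- A subsolution is subharmonic across its free boundary, being nonnegative and subharmonic where
positive, so the germ asks for subharmonicity at every point. The slope condition still needs
positive values accumulating at the point. -/
theorem IsSubsolution.subAt (hU : IsOpen U) (hv : IsSubsolution U μ v)
    (hx : x ∈ U) : SubAt (1 - μ) v x := by
  refine ⟨hv.1.continuousAt hU hx, ?_, fun h0 hf p hpd => ?_⟩
  · obtain ⟨δ, hδ, hb⟩ := Metric.isOpen_iff.1 hU x hx
    exact ⟨δ, hδ, (hv.isSubharmonicOn hU).mono hb⟩
  · exact hv.2.2 x ⟨(mem_frontier_posSet_iff hU hv.1 hx).2 ⟨h0, hf⟩, hx⟩ p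
      ((mem_superDiff_iff hU hv.1 hx p).2 hpd)

theorem isSubsolution_of_subAt (hU : IsOpen U) (hs : IsState U v)
    (h : ∀ x ∈ U, SubAt (1 - μ) v x) : IsSubsolution U μ v := by
  refine ⟨hs, (isSubharmonicOn_of_local hU fun y hy => (h y hy).2.1).mono inter_subset_right,
    fun y hy p hp => ?_⟩
  obtain ⟨h0, hf⟩ := (mem_frontier_posSet_iff hU hs hy.2).1 hy.1
  exact (h y hy.2).2.2 h0 hf p ((mem_superDiff_iff hU hs hy.2 p).1 hp)

theorem exists_ball_of_eventually {P : EuclideanSpace ℝ (Fin d) → Prop} (h : ∀ᶠ y in 𝓝 x, P y)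
    {δ : ℝ} (hδ : 0 < δ) : ∃ η > 0, η ≤ δ ∧ ∀ y ∈ Metric.ball x η, P y := by
  obtain ⟨η, hη, hb⟩ := Metric.eventually_nhds_iff_ball.1 h
  exact ⟨min η δ, by positivity, min_le_right _ _, fun y hy =>
    hb y (Metric.ball_subset_ball (min_le_left _ _) hy)⟩

theorem SuperAt.congr (h : SuperAt Q v x) (hvg : v =ᶠ[𝓝 x] g) : SuperAt Q g x := by
  have hx := hvg.self_of_nhds
  refine ⟨h.1.congr hvg, fun hpos => ?_, fun h0 p hp => h.2.2 (hx.trans h0) p fun ε hε => ?_⟩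
  · obtain ⟨δ, hδ, hs⟩ := h.2.1 (hx ▸ hpos)
    obtain ⟨η, hη, hle, hb⟩ := exists_ball_of_eventually hvg hδ
    exact ⟨η, hη, (hs.mono (Metric.ball_subset_ball hle)).congr fun y hy => (hb y hy).symm⟩
  · filter_upwards [hp ε hε, hvg] with y hy hy'
    rwa [hy']

theorem SubAt.congr (h : SubAt Q v x) (hvg : v =ᶠ[𝓝 x] g) : SubAt Q g x := by
  have hx := hvg.self_of_nhds
  refine ⟨h.1.congr hvg, ?_, fun h0 hf p hp => h.2.2 (hx.trans h0) ?_ p fun ε hε => ?_⟩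
  · obtain ⟨δ, hδ, hs⟩ := h.2.1
    obtain ⟨η, hη, hle, hb⟩ := exists_ball_of_eventually hvg hδ
    exact ⟨η, hη, (hs.mono (Metric.ball_subset_ball hle)).congr fun y hy => (hb y hy).symm⟩
  · exact (hf.and_eventually hvg).mono fun y hy => hy.2 ▸ hy.1
  · filter_upwards [hp ε hε, hvg] with y hy hy'
    rwa [hy']

/-- At a zero of the minimum, one of the two functions vanishes and lies above the minimum, so it
inherits every subdifferential. -/
theorem SuperAt.min (hv : SuperAt Q v x) (hg : SuperAt Q g x) :
    SuperAt Q (fun y => Min.min (v y) (g y)) x := by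
  refine ⟨hv.1.min hg.1, fun hpos => ?_, fun h0 p hp => ?_⟩
  · obtain ⟨h1, h2⟩ := lt_min_iff.1 hpos
    obtain ⟨δ₁, hδ₁, hs₁⟩ := hv.2.1 h1
    obtain ⟨δ₂, hδ₂, hs₂⟩ := hg.2.1 h2
    exact ⟨Min.min δ₁ δ₂, lt_min hδ₁ hδ₂,
      (hs₁.mono (Metric.ball_subset_ball (min_le_left _ _))).min
        (hs₂.mono (Metric.ball_subset_ball (min_le_right _ _)))⟩
  · rcases min_choice (v x) (g x) with h | h
    · refine hv.2.2 (h ▸ h0) p fun ε hε => ?_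
      filter_upwards [hp ε hε] with y hy using hy.trans (min_le_left _ _)
    · refine hg.2.2 (h ▸ h0) p fun ε hε => ?_
      filter_upwards [hp ε hε] with y hy using hy.trans (min_le_right _ _)

/-- At a zero of the maximum both functions vanish, and one of them is positive at points
accumulating there; that one lies below the maximum and inherits its superdifferentials. -/
theorem SubAt.max (hv : SubAt Q v x) (hg : SubAt Q g x) (hv0 : 0 ≤ v x) (hg0 : 0 ≤ g x) :
    SubAt Q (fun y => Max.max (v y) (g y)) x := by
  refine ⟨hv.1.max hg.1, ?_, fun h0 hf p hp => ?_⟩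
  · obtain ⟨δ₁, hδ₁, hs₁⟩ := hv.2.1
    obtain ⟨δ₂, hδ₂, hs₂⟩ := hg.2.1
    exact ⟨Min.min δ₁ δ₂, lt_min hδ₁ hδ₂,
      (hs₁.mono (Metric.ball_subset_ball (min_le_left _ _))).max
        (hs₂.mono (Metric.ball_subset_ball (min_le_right _ _)))⟩
  · have hv1 : v x = 0 := le_antisymm ((le_max_left _ _).trans h0.le) hv0
    have hg1 : g x = 0 := le_antisymm ((le_max_right _ _).trans h0.le) hg0
    have hf' : ∃ᶠ y in 𝓝 x, 0 < v y ∨ 0 < g y := hf.mono fun y hy => lt_max_iff.1 hy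
    rcases frequently_or_distrib.1 hf' with h | h
    · refine hv.2.2 hv1 h p fun ε hε => ?_
      filter_upwards [hp ε hε] with y hy hpos
      exact (le_max_left _ _).trans (hy (lt_max_of_lt_left hpos))
    · refine hg.2.2 hg1 h p fun ε hε => ?_
      filter_upwards [hp ε hε] with y hy hpos
      exact (le_max_right _ _).trans (hy (lt_max_of_lt_right hpos))

theorem tendsto_inv_smul_nhds {c : ℝ} (hc : 0 < c) :
    Tendsto (fun z : EuclideanSpace ℝ (Fin d) => c⁻¹ • z) (𝓝 (c • x)) (𝓝 x) := by
  have : Continuous fun z : EuclideanSpace ℝ (Fin d) => c⁻¹ • z := by fun_prop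
  simpa [smul_smul, hc.ne'] using this.tendsto (c • x)

theorem ball_subset_preimage_smul {c δ : ℝ} (hc : 0 < c) :
    Metric.ball x (δ / c) ⊆ {y | c • y ∈ Metric.ball (c • x) δ} := by
  intro y hy
  simp only [mem_ofPred_eq, Metric.mem_ball, dist_smul₀, Real.norm_of_nonneg hc.le] at hy ⊢
  rw [lt_div_iff₀ hc] at hy
  linarith

/-- The factor `c⁻¹` compensates the dilation of the argument, so slopes, and hence the same `Q`,
are preserved. -/
theorem SuperAt.dilate {c : ℝ} (hc : 0 < c) (h : SuperAt Q v (c • x)) :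
    SuperAt Q (fun y => c⁻¹ * v (c • y)) x := by
  have hci : 0 < c⁻¹ := inv_pos.2 hc
  refine ⟨?_, fun hpos => ?_, fun h0 p hp => ?_⟩
  · exact continuousAt_const.mul (ContinuousAt.comp (f := fun y => c • y) h.1 (by fun_prop))
  · obtain ⟨δ, hδ, hs⟩ := h.2.1 (pos_of_mul_pos_right hpos hci.le)
    exact ⟨δ / c, by positivity,
      ((hs.comp_smul hc).mono (ball_subset_preimage_smul hc)).const_mul hci.le⟩
  · refine h.2.2 ((mul_eq_zero.1 h0).resolve_left hci.ne') p fun ε hε => ?_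
    filter_upwards [(tendsto_inv_smul_nhds hc).eventually (hp ε hε)] with z hz
    have e1 : c⁻¹ • z - x = c⁻¹ • (z - c • x) := by
      rw [smul_sub, smul_smul, inv_mul_cancel₀ hc.ne', one_smul]
    rw [e1, smul_smul, mul_inv_cancel₀ hc.ne', one_smul, inner_smul_right, norm_smul,
      Real.norm_of_nonneg hci.le] at hz
    have : c⁻¹ * (inner ℝ p (z - c • x) - ε * ‖z - c • x‖) ≤ c⁻¹ * v z := by linarith
    exact le_of_mul_le_mul_left this hci

theorem SubAt.dilate {c : ℝ} (hc : 0 < c) (h : SubAt Q v (c • x)) :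
    SubAt Q (fun y => c⁻¹ * v (c • y)) x := by
  have hci : 0 < c⁻¹ := inv_pos.2 hc
  refine ⟨?_, ?_, fun h0 hf p hp => ?_⟩
  · exact continuousAt_const.mul (ContinuousAt.comp (f := fun y => c • y) h.1 (by fun_prop))
  · obtain ⟨δ, hδ, hs⟩ := h.2.1
    exact ⟨δ / c, by positivity,
      ((hs.comp_smul hc).mono (ball_subset_preimage_smul hc)).const_mul hci.le⟩
  · have hlim : Tendsto (fun y : EuclideanSpace ℝ (Fin d) => c • y) (𝓝 x) (𝓝 (c • x)) :=
      (continuous_const_smul c).tendsto x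
    refine h.2.2 ((mul_eq_zero.1 h0).resolve_left hci.ne')
      (hlim.frequently (hf.mono fun y hy => pos_of_mul_pos_right hy hci.le)) p fun ε hε => ?_
    filter_upwards [(tendsto_inv_smul_nhds hc).eventually (hp ε hε)] with z hz hpos
    have e1 : c⁻¹ • z - x = c⁻¹ • (z - c • x) := by
      rw [smul_sub, smul_smul, inv_mul_cancel₀ hc.ne', one_smul]
    rw [e1, smul_smul, mul_inv_cancel₀ hc.ne', one_smul, inner_smul_right, norm_smul,
      Real.norm_of_nonneg hci.le] at hz
    have : c⁻¹ * v z ≤ c⁻¹ * (inner ℝ p (z - c • x) + ε * ‖z - c • x‖) := by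
      linarith [hz (by positivity)]
    exact le_of_mul_le_mul_left this hci

theorem superAt_of_superharmonic {δ : ℝ} (hδ : 0 < δ)
    (h : IsSuperharmonicOn v (Metric.ball x δ)) (hpos : 0 < v x) : SuperAt Q v x :=
  ⟨h.1.continuousAt (Metric.ball_mem_nhds x hδ), fun _ => ⟨δ, hδ, h⟩, fun h0 => absurd h0 hpos.ne'⟩

theorem subAt_of_subharmonic {δ : ℝ} (hδ : 0 < δ)
    (h : IsSubharmonicOn v (Metric.ball x δ)) (hpos : 0 < v x) : SubAt Q v x :=
  ⟨h.1.continuousAt (Metric.ball_mem_nhds x hδ), ⟨δ, hδ, h⟩, fun h0 => absurd h0 hpos.ne'⟩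

theorem eventually_taylor {w : EuclideanSpace ℝ (Fin d)} (hw : HasFDerivAt ψ (innerSL ℝ w) x)
    (q : EuclideanSpace ℝ (Fin d)) {ε : ℝ} (hε : 0 < ε) :
    ∀ᶠ t in 𝓝[>] (0 : ℝ), |ψ (x + t • q) - ψ x - t * inner ℝ w q| ≤ ε * t := by
  have h1 : HasDerivAt (fun t : ℝ => ψ (x + t • q)) (inner ℝ w q) 0 := by
    have h2 : HasDerivAt (fun t : ℝ => x + t • q) q 0 := by
      simpa using ((hasDerivAt_id (0 : ℝ)).smul_const q).const_add x
    have hw' : HasFDerivAt ψ (innerSL ℝ w) (x + (0 : ℝ) • q) := by simpa using hw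
    exact hw'.comp_hasDerivAt (0 : ℝ) h2
  have h3 := (hasDerivAt_iff_isLittleO.1 h1).def hε
  filter_upwards [h3.filter_mono nhdsWithin_le_nhds, self_mem_nhdsWithin] with t ht ht0
  simp only [mem_Ioi] at ht0
  simpa [abs_of_pos ht0] using ht

theorem tendsto_add_smul (x q : EuclideanSpace ℝ (Fin d)) :
    Tendsto (fun t : ℝ => x + t • q) (𝓝[>] 0) (𝓝 x) := by
  have : Continuous fun t : ℝ => x + t • q := by fun_prop
  simpa using (this.tendsto 0).mono_left nhdsWithin_le_nhds

/-- At a zero of `ψ`, a subdifferential `p` of the positive part cannot be longer than the gradient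
`w`: test along the direction `p` itself. -/
theorem superAt_posPart {w : EuclideanSpace ℝ (Fin d)} (hQ : 0 ≤ Q)
    (hw : HasFDerivAt ψ (innerSL ℝ w) x)
    (hs : 0 < ψ x → ∃ δ > 0, IsSuperharmonicOn ψ (Metric.ball x δ))
    (hwQ : ψ x = 0 → ‖w‖ ^ 2 ≤ Q) : SuperAt Q (fun y => max (ψ y) 0) x := by
  refine ⟨hw.continuousAt.max continuousAt_const, fun hpos => ?_, fun h0 p hp => ?_⟩
  · have hx : 0 < ψ x := by simpa using hpos
    obtain ⟨δ, hδ, h⟩ := hs hx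
    obtain ⟨η, hη, hle, hb⟩ := exists_ball_of_eventually
      (hw.continuousAt.eventually (lt_mem_nhds hx)) hδ
    exact ⟨η, hη, (h.mono (Metric.ball_subset_ball hle)).congr fun y hy => max_eq_left (hb y hy).le⟩
  · rcases (max_eq_right_iff.1 h0).eq_or_lt with h1 | h1
    · refine le_trans ?_ (hwQ h1)
      by_contra! hlt
      have hlt' : ‖w‖ < ‖p‖ := lt_of_pow_lt_pow_left₀ 2 (norm_nonneg _) hlt
      have hpn : 0 < ‖p‖ := (norm_nonneg _).trans_lt hlt'
      set ε := (‖p‖ - ‖w‖) / 4 with hε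
      have hε0 : 0 < ε := by rw [hε]; linarith
      obtain ⟨t, ⟨ht1, ht2⟩, ht0⟩ := ((((tendsto_add_smul x p).eventually (hp ε hε0)).and
        (eventually_taylor hw p (mul_pos hε0 hpn))).and self_mem_nhdsWithin).exists
      replace ht0 : 0 < t := ht0
      simp only [add_sub_cancel_left, inner_smul_right, real_inner_self_eq_norm_sq,
        norm_smul, Real.norm_eq_abs, abs_of_pos ht0] at ht1
      rw [h1, sub_zero] at ht2
      have h3 := (abs_le.1 ht2).2
      have h4 : inner ℝ w p ≤ ‖w‖ * ‖p‖ := real_inner_le_norm w p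
      have h5 : max (ψ (x + t • p)) 0 ≤ t * (‖w‖ * ‖p‖) + ε * ‖p‖ * t := by
        apply max_le
        · nlinarith
        · positivity
      have h6 : t * ‖p‖ * (‖p‖ - ‖w‖ - 2 * ε) ≤ 0 := by nlinarith
      have h7 : 0 < t * ‖p‖ * (‖p‖ - ‖w‖ - 2 * ε) := by
        apply mul_pos (mul_pos ht0 hpn); rw [hε]; linarith
      linarith
    · have : (fun y => max (ψ y) 0) =ᶠ[𝓝 x] 0 := by
        filter_upwards [hw.continuousAt.eventually (gt_mem_nhds h1)] with y hy
        exact max_eq_right hy.le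
      rw [mem_subDiff_of_eventually_zero this hp]
      simpa using hQ

/-- At a zero of `ψ`, a superdifferential cannot be shorter than the gradient `w`: test along `w`,
in whose direction `ψ` becomes positive. -/
theorem subAt_posPart {w : EuclideanSpace ℝ (Fin d)}
    (hw : HasFDerivAt ψ (innerSL ℝ w) x) {δ : ℝ} (hδ : 0 < δ)
    (hs : IsSubharmonicOn ψ (Metric.ball x δ))
    (hwQ : ψ x = 0 → Q ≤ ‖w‖ ^ 2) : SubAt Q (fun y => max (ψ y) 0) x := by
  refine ⟨hw.continuousAt.max continuousAt_const, ⟨δ, hδ, hs.max (isSubharmonicOn_const 0)⟩,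
    fun h0 hf p hp => ?_⟩
  rcases (max_eq_right_iff.1 h0).eq_or_lt with h1 | h1
  · refine (hwQ h1).trans ?_
    by_contra! hlt
    have hlt' : ‖p‖ < ‖w‖ := lt_of_pow_lt_pow_left₀ 2 (norm_nonneg _) hlt
    have hwn : 0 < ‖w‖ := (norm_nonneg _).trans_lt hlt'
    set ε := (‖w‖ - ‖p‖) / 4 with hε
    have hε0 : 0 < ε := by rw [hε]; linarith
    obtain ⟨t, ⟨ht1, ht2⟩, ht0⟩ := ((((tendsto_add_smul x w).eventually (hp ε hε0)).and
      (eventually_taylor hw w (mul_pos hε0 hwn))).and self_mem_nhdsWithin).exists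
    replace ht0 : 0 < t := ht0
    simp only [add_sub_cancel_left, inner_smul_right,
      norm_smul, Real.norm_eq_abs, abs_of_pos ht0] at ht1
    rw [h1, sub_zero, real_inner_self_eq_norm_sq] at ht2
    have h3 := (abs_le.1 ht2).1
    have h4 : inner ℝ p w ≤ ‖p‖ * ‖w‖ := real_inner_le_norm p w
    have h7 : 0 < t * ‖w‖ * (‖w‖ - ‖p‖ - 2 * ε) := by
      apply mul_pos (mul_pos ht0 hwn); rw [hε]; linarith
    have h8 : 0 < t * ‖w‖ * (‖w‖ - ε) := by
      apply mul_pos (mul_pos ht0 hwn); rw [hε]; linarith [norm_nonneg p]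
    have h9 : 0 < ψ (x + t • w) := by nlinarith
    rw [max_eq_left h9.le] at ht1
    have h10 := ht1 h9
    have h11 : t * inner ℝ p w ≤ t * (‖p‖ * ‖w‖) := mul_le_mul_of_nonneg_left h4 ht0.le
    nlinarith
  · exfalso
    refine hf ?_
    filter_upwards [hw.continuousAt.eventually (gt_mem_nhds h1)] with y hy
    rw [max_eq_right hy.le]
    exact lt_irrefl 0

end Germ

/-! ### Explicit barriers at the free boundary. -/

section Barrier
variable {d : ℕ}

theorem lap_of_gradient {ψ : EuclideanSpace ℝ (Fin d) → ℝ}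
    {G : EuclideanSpace ℝ (Fin d) → EuclideanSpace ℝ (Fin d)} {x : EuclideanSpace ℝ (Fin d)}
    {L : EuclideanSpace ℝ (Fin d) →L[ℝ] EuclideanSpace ℝ (Fin d)}
    (hG : ∀ y, HasFDerivAt ψ (innerSL ℝ (G y)) y) (hL : HasFDerivAt G L x) :
    lap ψ x = ∑ i, L (EuclideanSpace.single i 1) i := by
  unfold lap
  refine Finset.sum_congr rfl fun i _ => ?_
  have h1 : (fun y => fderiv ℝ ψ y (EuclideanSpace.single i 1)) = fun y => G y i := by
    ext y
    rw [(hG y).fderiv]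
    simp [EuclideanSpace.inner_single_right]
  rw [h1]
  have h2 : HasFDerivAt (fun y => G y i)
      ((EuclideanSpace.proj (𝕜 := ℝ) i : EuclideanSpace ℝ (Fin d) →L[ℝ] ℝ).comp L) x :=
    (EuclideanSpace.proj (𝕜 := ℝ) i : EuclideanSpace ℝ (Fin d) →L[ℝ] ℝ).hasFDerivAt.comp x hL
  rw [h2.fderiv]
  simp

theorem hasFDerivAt_norm_sub_sq (a y : EuclideanSpace ℝ (Fin d)) :
    HasFDerivAt (fun y => ‖y - a‖ ^ 2) (innerSL ℝ ((2 : ℝ) • (y - a))) y := by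
  have h := (hasStrictFDerivAt_norm_sq (y - a)).hasFDerivAt.comp y
      ((hasFDerivAt_id y).sub_const a)
  refine h.congr_fderiv ?_
  ext v; simp

theorem hasFDerivAt_inner_sub (e a y : EuclideanSpace ℝ (Fin d)) :
    HasFDerivAt (fun y => inner ℝ e (y - a)) (innerSL ℝ e) y := by
  have h := (innerSL ℝ e).hasFDerivAt.comp y ((hasFDerivAt_id y).sub_const a)
  exact h.congr_fderiv (by ext v; simp)

/-- A harmonic quadratic polynomial of slope close to `b`, concentrated near a hyperplane. -/
noncomputable def quadBarrier (a e : EuclideanSpace ℝ (Fin d)) (b k ρ : ℝ)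
    (y : EuclideanSpace ℝ (Fin d)) : ℝ :=
  (b + k) * inner ℝ e (y - a) + k / (d * ρ) * ‖y - a‖ ^ 2 - k / ρ * inner ℝ e (y - a) ^ 2
    - k / (2 * d) * ρ

/-- The gradient of `quadBarrier`. -/
noncomputable def quadBarrierGrad (a e : EuclideanSpace ℝ (Fin d)) (b k ρ : ℝ)
    (y : EuclideanSpace ℝ (Fin d)) : EuclideanSpace ℝ (Fin d) :=
  (b + k) • e + (2 * (k / (d * ρ))) • (y - a) - (2 * (k / ρ) * inner ℝ e (y - a)) • e

theorem quadBarrier_hasFDerivAt (a e : EuclideanSpace ℝ (Fin d)) (b k ρ : ℝ)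
    (y : EuclideanSpace ℝ (Fin d)) :
    HasFDerivAt (quadBarrier a e b k ρ) (innerSL ℝ (quadBarrierGrad a e b k ρ y)) y := by
  have h := ((((hasFDerivAt_inner_sub e a y).const_mul (b + k)).add
    ((hasFDerivAt_norm_sub_sq a y).const_mul (k / (d * ρ)))).sub
    (((hasFDerivAt_inner_sub e a y).pow 2).const_mul (k / ρ))).sub_const (k / (2 * d) * ρ)
  refine h.congr_fderiv ?_
  ext v
  simp [quadBarrierGrad]
  ring

theorem quadBarrier_contDiff (a e : EuclideanSpace ℝ (Fin d)) (b k ρ : ℝ) :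
    ContDiff ℝ 2 (quadBarrier a e b k ρ) := by
  unfold quadBarrier
  have h1 : ContDiff ℝ 2 fun y : EuclideanSpace ℝ (Fin d) => inner ℝ e (y - a) :=
    contDiff_const.inner ℝ (contDiff_id.sub contDiff_const)
  have h2 : ContDiff ℝ 2 fun y : EuclideanSpace ℝ (Fin d) => ‖y - a‖ ^ 2 :=
    (contDiff_id.sub contDiff_const).norm_sq ℝ
  exact (((contDiff_const.mul h1).add (contDiff_const.mul h2)).sub
    (contDiff_const.mul (h1.pow 2))).sub contDiff_const

theorem quadBarrier_lap (hd : 0 < d) (a : EuclideanSpace ℝ (Fin d)) {e : EuclideanSpace ℝ (Fin d)}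
    (he : ‖e‖ = 1) (b k ρ : ℝ) (y : EuclideanSpace ℝ (Fin d)) :
    lap (quadBarrier a e b k ρ) y = 0 := by
  have hG : HasFDerivAt (quadBarrierGrad a e b k ρ)
      ((2 * (k / (d * ρ))) • ContinuousLinearMap.id ℝ (EuclideanSpace ℝ (Fin d)) -
        ((2 * (k / ρ)) • innerSL ℝ e).smulRight e) y := by
    have h0 : HasFDerivAt (fun y : EuclideanSpace ℝ (Fin d) => y - a)
        (ContinuousLinearMap.id ℝ (EuclideanSpace ℝ (Fin d))) y := (hasFDerivAt_id y).sub_const a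
    have h1 := (h0.const_smul (2 * (k / (d * ρ)))).const_add ((b + k) • e)
    have h2 := ((hasFDerivAt_inner_sub e a y).const_mul (2 * (k / ρ))).smul_const e
    exact h1.sub h2
  rw [lap_of_gradient (quadBarrier_hasFDerivAt a e b k ρ) hG]
  have hsum : ∑ i, e i ^ 2 = 1 := by
    rw [← EuclideanSpace.real_norm_sq_eq, he, one_pow]
  have : ∀ i : Fin d, (((2 * (k / (d * ρ))) • ContinuousLinearMap.id ℝ (EuclideanSpace ℝ (Fin d)) -
        ((2 * (k / ρ)) • innerSL ℝ e).smulRight e) (EuclideanSpace.single i 1)) i =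
      2 * (k / (d * ρ)) - 2 * (k / ρ) * e i ^ 2 := by
    intro i
    simp [EuclideanSpace.inner_single_right]
    ring
  simp only [this]
  rw [Finset.sum_sub_distrib, ← Finset.mul_sum (a := 2 * (k / ρ)), hsum]
  have hd' : (d : ℝ) ≠ 0 := by positivity
  simp
  field_simp
  ring

theorem quadBarrier_harmonic (hd : 0 < d) (a : EuclideanSpace ℝ (Fin d))
    {e : EuclideanSpace ℝ (Fin d)} (he : ‖e‖ = 1) (b k ρ : ℝ) :
    IsSubharmonicOn (quadBarrier a e b k ρ) univ ∧
      IsSuperharmonicOn (quadBarrier a e b k ρ) univ :=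
  ⟨isSubharmonicOn_of_lap_nonneg isOpen_univ (quadBarrier_contDiff a e b k ρ).contDiffOn
      fun x _ => (quadBarrier_lap hd a he b k ρ x).ge,
    isSuperharmonicOn_of_lap_nonpos isOpen_univ (quadBarrier_contDiff a e b k ρ).contDiffOn
      fun x _ => (quadBarrier_lap hd a he b k ρ x).le⟩

theorem quadBarrierGrad_near (hd : 0 < d) (a : EuclideanSpace ℝ (Fin d))
    {e : EuclideanSpace ℝ (Fin d)} (he : ‖e‖ = 1) (b k : ℝ) {ρ : ℝ} (hρ : 0 < ρ)
    {y : EuclideanSpace ℝ (Fin d)} (hy : ‖y - a‖ ≤ ρ) :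
    ‖quadBarrierGrad a e b k ρ y - b • e‖ ≤ 5 * |k| := by
  have hd' : (1 : ℝ) ≤ d := by exact_mod_cast hd
  have e1 : quadBarrierGrad a e b k ρ y - b • e =
      k • e + (2 * (k / (d * ρ))) • (y - a) - (2 * (k / ρ) * inner ℝ e (y - a)) • e := by
    unfold quadBarrierGrad; module
  have h1 : ‖(2 * (k / (d * ρ))) • (y - a)‖ ≤ 2 * |k| := by
    rw [norm_smul, Real.norm_eq_abs, abs_mul, abs_div, abs_of_pos (by positivity : (0:ℝ) < d * ρ),
      abs_of_pos (by norm_num : (0:ℝ) < 2)]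
    calc 2 * (|k| / (d * ρ)) * ‖y - a‖ ≤ 2 * (|k| / (1 * ρ)) * ρ := by gcongr
      _ = 2 * |k| := by field_simp
  have h2 : ‖(2 * (k / ρ) * inner ℝ e (y - a)) • e‖ ≤ 2 * |k| := by
    rw [norm_smul, he, mul_one, Real.norm_eq_abs, abs_mul, abs_mul, abs_div, abs_of_pos hρ,
      abs_of_pos (by norm_num : (0:ℝ) < 2)]
    have : |inner ℝ e (y - a)| ≤ ρ := by
      have := abs_real_inner_le_norm e (y - a)
      rw [he, one_mul] at this; linarith
    calc 2 * (|k| / ρ) * |inner ℝ e (y - a)| ≤ 2 * (|k| / ρ) * ρ := by gcongr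
      _ = 2 * |k| := by field_simp
  have h3 : ‖k • e‖ = |k| := by rw [norm_smul, he, mul_one, Real.norm_eq_abs]
  rw [e1]
  linarith [norm_sub_le (k • e + (2 * (k / (d * ρ))) • (y - a))
    ((2 * (k / ρ) * inner ℝ e (y - a)) • e), norm_add_le (k • e) ((2 * (k / (d * ρ))) • (y - a))]

/-- Against the linear profile of slope `b`, the barrier gains on the relevant part of the sphere
while its value at the center is `-k / (2 * d) * ρ`, of the opposite sign. Replacing `k` by `-k`
exchanges the roles of super- and subsolution. -/
theorem quadBarrier_on_sphere (hd : 0 < d) (a e : EuclideanSpace ℝ (Fin d)) (b k : ℝ) {ρ : ℝ}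
    (hρ : 0 < ρ) {y : EuclideanSpace ℝ (Fin d)} (hy : ‖y - a‖ = ρ) :
    quadBarrier a e b k ρ y - b * inner ℝ e (y - a) =
      k * (inner ℝ e (y - a) + ρ / (2 * d) - inner ℝ e (y - a) ^ 2 / ρ) := by
  have hd' : (d : ℝ) ≠ 0 := by positivity
  unfold quadBarrier
  rw [hy]
  field_simp
  ring

/-- The bracket in `quadBarrier_on_sphere` is positive away from the lower half of the sphere. -/
theorem bracket_lower {b k n ρ τ : ℝ} (hb : 0 < b) (hk : 0 < k) (hn : 0 < n) (hρ : 0 < ρ)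
    (hτ : |τ| ≤ ρ) (hτ2 : -(k / (4 * n) * b / (b + 2 * k) * ρ) ≤ b * τ) :
    k / (4 * n) * b / (b + 2 * k) * ρ < k * (τ + ρ / (2 * n) - τ ^ 2 / ρ) := by
  -- The value solves `η * (1 + 2 * k / b) = k / (4 * n)`. For `τ < 0` the bracket is at least `2 *
  -- τ + ρ / (2 * n)` and `τ ≥ -η * ρ / b`, so `η` spends only half of the available `k * ρ / (2 *
  -- n)`.
  set η := k / (4 * n) * b / (b + 2 * k) with hη
  have hη0 : 0 < η := by positivity
  have hηe : η * (b + 2 * k) = k / (4 * n) * b := by rw [hη]; field_simp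
  obtain ⟨h1, h2⟩ := abs_le.1 hτ
  have h3 : τ ^ 2 / ρ ≤ |τ| := by
    rw [div_le_iff₀ hρ, ← sq_abs]; nlinarith [abs_nonneg τ]
  have h4 : k * (ρ / (2 * n)) = 2 * (k / (4 * n)) * ρ := by field_simp; ring
  set A := k / (4 * n)
  have hA : 0 < A := by positivity
  have h5 : k * (τ - |τ|) ≤ k * (τ - τ ^ 2 / ρ) := by gcongr
  rcases le_total 0 τ with h | h
  · rw [abs_of_nonneg h] at h5
    have : η ≤ A := by
      have : η * b ≤ A * b := by nlinarith
      exact le_of_mul_le_mul_right this hb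
    nlinarith [mul_pos hA hρ]
  · rw [abs_of_nonpos h] at h5
    have h6 : η * ρ - 2 * k * τ ≤ A * ρ := by
      have : b * (η * ρ - 2 * k * τ) ≤ b * (A * ρ) := by nlinarith
      exact le_of_mul_le_mul_left this hb
    nlinarith [mul_pos hA hρ]

/-- The radial barrier. -/
noncomputable def radBarrier (a : EuclideanSpace ℝ (Fin d)) (M α s : ℝ)
    (y : EuclideanSpace ℝ (Fin d)) : ℝ :=
  M * (Real.exp (-s) - Real.exp (-α * ‖y - a‖ ^ 2))

/-- The gradient of `radBarrier`. -/
noncomputable def radBarrierGrad (a : EuclideanSpace ℝ (Fin d)) (M α : ℝ)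
    (y : EuclideanSpace ℝ (Fin d)) : EuclideanSpace ℝ (Fin d) :=
  (2 * α * M * Real.exp (-α * ‖y - a‖ ^ 2)) • (y - a)

theorem hasFDerivAt_exp_norm_sq (α : ℝ) (a y : EuclideanSpace ℝ (Fin d)) :
    HasFDerivAt (fun y => Real.exp (-α * ‖y - a‖ ^ 2))
      ((-2 * α * Real.exp (-α * ‖y - a‖ ^ 2)) • innerSL ℝ (y - a)) y := by
  refine ((hasFDerivAt_norm_sub_sq a y).const_mul (-α)).exp.congr_fderiv ?_
  ext v
  simp
  ring

theorem radBarrier_hasFDerivAt (a : EuclideanSpace ℝ (Fin d)) (M α s : ℝ)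
    (y : EuclideanSpace ℝ (Fin d)) :
    HasFDerivAt (radBarrier a M α s) (innerSL ℝ (radBarrierGrad a M α y)) y := by
  refine (((hasFDerivAt_exp_norm_sq α a y).const_sub (Real.exp (-s))).const_mul M).congr_fderiv ?_
  ext v
  simp [radBarrierGrad]
  ring

theorem radBarrier_contDiff (a : EuclideanSpace ℝ (Fin d)) (M α s : ℝ) :
    ContDiff ℝ 2 (radBarrier a M α s) := by
  unfold radBarrier
  have h2 : ContDiff ℝ 2 fun y : EuclideanSpace ℝ (Fin d) => ‖y - a‖ ^ 2 :=
    (contDiff_id.sub contDiff_const).norm_sq ℝ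
  exact contDiff_const.mul (contDiff_const.sub (contDiff_const.mul h2).exp)

theorem radBarrier_lap (a : EuclideanSpace ℝ (Fin d)) (M α s : ℝ)
    (y : EuclideanSpace ℝ (Fin d)) :
    lap (radBarrier a M α s) y =
      2 * α * M * Real.exp (-α * ‖y - a‖ ^ 2) * (d - 2 * α * ‖y - a‖ ^ 2) := by
  have h0 : HasFDerivAt (fun y : EuclideanSpace ℝ (Fin d) => y - a)
      (ContinuousLinearMap.id ℝ (EuclideanSpace ℝ (Fin d))) y := (hasFDerivAt_id y).sub_const a
  have hG := ((hasFDerivAt_exp_norm_sq α a y).const_mul (2 * α * M)).smul h0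
  rw [lap_of_gradient (radBarrier_hasFDerivAt a M α s) hG, EuclideanSpace.real_norm_sq_eq]
  simp [EuclideanSpace.inner_single_right, Finset.sum_add_distrib]
  rw [mul_sub, Finset.mul_sum, Finset.mul_sum, sub_eq_add_neg]
  congr 1
  · ring
  · rw [neg_inj, Finset.mul_sum]
    refine Finset.sum_congr rfl fun i _ => ?_
    ring

/-- A supersolution barrier pushing the free boundary inwards at a point where the slope
is too small. -/
theorem exists_super_barrier (hd : 0 < d) (x₀ p : EuclideanSpace ℝ (Fin d)) {Q : ℝ}
    (hp : ‖p‖ ^ 2 < Q) : ∃ η > 0, ∀ ρ > 0, ∃ g : EuclideanSpace ℝ (Fin d) → ℝ,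
      Continuous g ∧ (∀ y, 0 ≤ g y) ∧ g =ᶠ[𝓝 x₀] 0 ∧
      (∀ y ∈ Metric.ball x₀ ρ, SuperAt Q g y) ∧
      ∀ y ∈ Metric.sphere x₀ ρ, ∀ s, 0 ≤ s → s ≤ inner ℝ p (y - x₀) + η * ρ → s < g y := by
  have hd' : (1 : ℝ) ≤ d := by exact_mod_cast hd
  have hQ : 0 < Q := (sq_nonneg _).trans_lt hp
  -- For `p = 0` there is no direction to align a quadratic with, so a radial barrier is used. With
  -- `α = 2 * d / ρ ^ 2` and level `d / 2` its zero set is the sphere of radius `ρ / 2`, outside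
  -- which it is superharmonic, and `M` makes the slope there at most `√Q`.
  rcases eq_or_ne p 0 with rfl | hp0
  · set M := √Q / (2 * d) with hM
    have hM0 : 0 < M := by positivity
    have hexp : 0 < Real.exp (-(d / 2 : ℝ)) - Real.exp (-(2 * d : ℝ)) := by
      rw [sub_pos, Real.exp_lt_exp]; linarith
    refine ⟨M * (Real.exp (-(d / 2 : ℝ)) - Real.exp (-(2 * d : ℝ))) / 2, by positivity,
      fun ρ hρ => ?_⟩
    set α := 2 * d / ρ ^ 2 with hα
    have hα0 : 0 < α := by positivity
    set ψ := radBarrier x₀ (M * ρ) α (d / 2) with hψ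
    have hψc : Continuous ψ := (radBarrier_contDiff _ _ _ _).continuous
    have hMρ : 0 < M * ρ := by positivity
    refine ⟨fun y => max (ψ y) 0, by fun_prop, fun y => le_max_right _ _, ?_, fun y hy => ?_, ?_⟩
    · have : ψ x₀ < 0 := by
        simp only [hψ, radBarrier, sub_self, norm_zero]
        apply mul_neg_of_pos_of_neg hMρ
        rw [sub_neg, Real.exp_lt_exp]
        simp; linarith
      filter_upwards [hψc.continuousAt.eventually (gt_mem_nhds this)] with y hy
      exact max_eq_right hy.le
    · have hψpos : ∀ y, 0 < ψ y → (d : ℝ) / 2 < α * ‖y - x₀‖ ^ 2 := by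
        intro y hy
        simp only [hψ, radBarrier] at hy
        have := pos_of_mul_pos_right hy hMρ.le
        rw [sub_pos, Real.exp_lt_exp] at this
        linarith
      refine superAt_posPart hQ.le (radBarrier_hasFDerivAt x₀ (M * ρ) α (d / 2) y) (fun hpos => ?_)
        fun h0 => ?_
      · obtain ⟨δ, hδ, hb⟩ := Metric.eventually_nhds_iff_ball.1
          (hψc.continuousAt.eventually (lt_mem_nhds hpos))
        refine ⟨δ, hδ, isSuperharmonicOn_of_lap_nonpos Metric.isOpen_ball
          (radBarrier_contDiff _ _ _ _).contDiffOn fun z hz => ?_⟩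
        rw [radBarrier_lap]
        have := hψpos z (hb z hz)
        apply mul_nonpos_of_nonneg_of_nonpos (by positivity)
        linarith
      · have h1 : α * ‖y - x₀‖ ^ 2 = d / 2 := by
          simp only [hψ, radBarrier] at h0
          have := (mul_eq_zero.1 h0).resolve_left hMρ.ne'
          rw [sub_eq_zero, Real.exp_eq_exp] at this
          linarith
        have h2 : ‖y - x₀‖ ^ 2 = (ρ / 2) ^ 2 := by
          rw [hα] at h1; field_simp at h1; nlinarith
        have h3 : ‖y - x₀‖ = ρ / 2 := by
          rwa [sq_eq_sq₀ (norm_nonneg _) (by positivity)] at h2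
        have h4 : ‖radBarrierGrad x₀ (M * ρ) α y‖ ≤ √Q := by
          rw [radBarrierGrad, norm_smul, Real.norm_of_nonneg (by positivity), h3]
          calc 2 * α * (M * ρ) * Real.exp (-α * (ρ / 2) ^ 2) * (ρ / 2)
              ≤ 2 * α * (M * ρ) * 1 * (ρ / 2) := by
                gcongr
                rw [Real.exp_le_one_iff]
                have : 0 ≤ α * (ρ / 2) ^ 2 := by positivity
                linarith
            _ = √Q := by rw [hα, hM]; field_simp
        calc ‖radBarrierGrad x₀ (M * ρ) α y‖ ^ 2 ≤ √Q ^ 2 := by gcongr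
          _ = Q := Real.sq_sqrt hQ.le
    · intro y hy s hs hs2
      refine lt_max_of_lt_left ?_
      rw [mem_sphere_iff_norm] at hy
      rw [inner_zero_left, zero_add] at hs2
      have h1 : ψ y = M * ρ * (Real.exp (-(d / 2 : ℝ)) - Real.exp (-(2 * d : ℝ))) := by
        simp only [hψ, radBarrier, hy]
        congr 3
        rw [hα]; field_simp
      rw [h1]
      nlinarith [mul_pos hMρ hexp]
  · set b := ‖p‖ with hb
    have hb0 : 0 < b := norm_pos_iff.2 hp0
    have hbQ : b < √Q := Real.lt_sqrt_of_sq_lt hp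
    -- The gradient deviates from `b • e` by at most `5 * k`, so its norm stays below `√Q` on the
    -- ball.
    set k := (√Q - b) / 5 with hk
    have hk0 : 0 < k := by rw [hk]; linarith
    set e := b⁻¹ • p with he
    have he1 : ‖e‖ = 1 := by rw [he, norm_smul, norm_inv, norm_norm]; field_simp
    have hbe : ∀ z, inner ℝ p z = b * inner ℝ e z := by
      intro z; rw [he, real_inner_smul_left]; field_simp
    refine ⟨k / (4 * d) * b / (b + 2 * k), by positivity, fun ρ hρ => ?_⟩
    set ψ := quadBarrier x₀ e b k ρ with hψ
    have hψc : Continuous ψ := (quadBarrier_contDiff _ _ _ _ _).continuous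
    obtain ⟨hsub, hsup⟩ := quadBarrier_harmonic hd x₀ he1 b k ρ
    refine ⟨fun y => max (ψ y) 0, by fun_prop, fun y => le_max_right _ _, ?_, fun y hy => ?_, ?_⟩
    · have : ψ x₀ < 0 := by
        simp [hψ, quadBarrier]
        positivity
      filter_upwards [hψc.continuousAt.eventually (gt_mem_nhds this)] with y hy
      exact max_eq_right hy.le
    · refine superAt_posPart hQ.le (quadBarrier_hasFDerivAt x₀ e b k ρ y)
        (fun _ => ⟨1, one_pos, hsup.mono (subset_univ _)⟩) fun _ => ?_
      rw [mem_ball_iff_norm] at hy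
      have h1 := quadBarrierGrad_near hd x₀ he1 b k hρ hy.le
      have h2 : ‖b • e‖ = b := by rw [norm_smul, he1, mul_one, Real.norm_of_nonneg hb0.le]
      have h3 : ‖quadBarrierGrad x₀ e b k ρ y‖ ≤ √Q := by
        have := norm_sub_norm_le (quadBarrierGrad x₀ e b k ρ y) (b • e)
        rw [abs_of_pos hk0] at h1
        rw [hk] at h1
        linarith
      calc ‖quadBarrierGrad x₀ e b k ρ y‖ ^ 2 ≤ √Q ^ 2 := by gcongr
        _ = Q := Real.sq_sqrt hQ.le
    · intro y hy s hs hs2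
      refine lt_max_of_lt_left ?_
      rw [mem_sphere_iff_norm] at hy
      rw [hbe] at hs2
      have h1 := quadBarrier_on_sphere hd x₀ e b k hρ hy
      have hτ : |inner ℝ e (y - x₀)| ≤ ρ := by
        have := abs_real_inner_le_norm e (y - x₀)
        rwa [he1, one_mul, hy] at this
      have h2 := bracket_lower hb0 hk0 (by linarith : (0 : ℝ) < d) hρ hτ (by linarith)
      rw [← h1] at h2
      linarith

/-- A subsolution barrier pushing the free boundary outwards at a point where the slope
is too large. -/
theorem exists_sub_barrier (hd : 0 < d) (x₀ p : EuclideanSpace ℝ (Fin d)) {Q : ℝ} (hQ : 0 < Q)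
    (hp : Q < ‖p‖ ^ 2) : ∃ η > 0, ∃ M > 0, ∀ ρ > 0, ∃ g : EuclideanSpace ℝ (Fin d) → ℝ,
      Continuous g ∧ (∀ y, 0 ≤ g y) ∧ 0 < g x₀ ∧ (∀ y ∈ Metric.ball x₀ ρ, g y ≤ M * ρ) ∧
      (∀ y ∈ Metric.ball x₀ ρ, SubAt Q g y) ∧
      ∀ y ∈ Metric.sphere x₀ ρ, ∀ s, 0 ≤ s → inner ℝ p (y - x₀) - η * ρ ≤ s →
        g y < s ∨ g =ᶠ[𝓝 y] 0 := by
  have hd' : (1 : ℝ) ≤ d := by exact_mod_cast hd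
  set b := ‖p‖ with hb
  have hbQ : √Q < b := by
    rw [Real.sqrt_lt hQ.le (norm_nonneg _)]; exact hp
  have hb0 : 0 < b := (Real.sqrt_nonneg Q).trans_lt hbQ
  set k := (b - √Q) / 5 with hk
  have hk0 : 0 < k := by rw [hk]; linarith
  have hkb : 5 * k ≤ b := by rw [hk]; linarith [Real.sqrt_nonneg Q]
  set e := b⁻¹ • p with he
  have he1 : ‖e‖ = 1 := by
    have : p ≠ 0 := norm_pos_iff.1 hb0
    rw [he, norm_smul, norm_inv, norm_norm]; field_simp
  have hbe : ∀ z, inner ℝ p z = b * inner ℝ e z := by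
    intro z; rw [he, real_inner_smul_left]; field_simp
  refine ⟨k / (4 * d) * b / (b + 2 * k), by positivity, b + 2 * k, by positivity, fun ρ hρ => ?_⟩
  set ψ := quadBarrier x₀ e b (-k) ρ with hψ
  have hψc : Continuous ψ := (quadBarrier_contDiff _ _ _ _ _).continuous
  obtain ⟨hsub, hsup⟩ := quadBarrier_harmonic hd x₀ he1 b (-k) ρ
  have hτ : ∀ y, |inner ℝ e (y - x₀)| ≤ ‖y - x₀‖ := fun y => by
    have := abs_real_inner_le_norm e (y - x₀)
    rwa [he1, one_mul] at this
  refine ⟨fun y => max (ψ y) 0, by fun_prop, fun y => le_max_right _ _, ?_, fun y hy => ?_,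
    fun y hy => ?_, ?_⟩
  · have : 0 < ψ x₀ := by
      simp only [hψ, quadBarrier, sub_self, inner_zero_right, norm_zero]
      have : 0 < k / (2 * d) * ρ := by positivity
      have e1 : -k / (2 * d) * ρ = -(k / (2 * d) * ρ) := by ring
      rw [e1]
      linarith
    exact lt_max_of_lt_left this
  · rw [mem_ball_iff_norm] at hy
    refine max_le ?_ (by positivity)
    have h1 := abs_le.1 ((hτ y).trans hy.le)
    set τ := inner ℝ e (y - x₀) with hτd
    have h2 : ψ y = (b - k) * τ - k / (d * ρ) * ‖y - x₀‖ ^ 2 + k / ρ * τ ^ 2 + k / (2 * d) * ρ := by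
      simp only [hψ, quadBarrier]; ring
    have h3 : k / ρ * τ ^ 2 ≤ k * ρ := by
      have : τ ^ 2 ≤ ρ ^ 2 := sq_le_sq' h1.1 h1.2
      calc k / ρ * τ ^ 2 ≤ k / ρ * ρ ^ 2 := by gcongr
        _ = k * ρ := by field_simp
    have h4 : k / (2 * d) * ρ ≤ k * ρ := by
      gcongr
      apply div_le_self hk0.le; linarith
    have h5 : 0 ≤ k / (d * ρ) * ‖y - x₀‖ ^ 2 := by positivity
    have h6 : (b - k) * τ ≤ b * ρ := by nlinarith
    rw [h2]
    linarith
  · refine subAt_posPart (quadBarrier_hasFDerivAt x₀ e b (-k) ρ y) one_pos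
      (hsub.mono (subset_univ _)) fun _ => ?_
    rw [mem_ball_iff_norm] at hy
    have h1 := quadBarrierGrad_near hd x₀ he1 b (-k) hρ hy.le
    have h2 : ‖b • e‖ = b := by rw [norm_smul, he1, mul_one, Real.norm_of_nonneg hb0.le]
    have h3 : √Q ≤ ‖quadBarrierGrad x₀ e b (-k) ρ y‖ := by
      have := norm_sub_norm_le (b • e) (quadBarrierGrad x₀ e b (-k) ρ y)
      rw [norm_sub_rev, abs_neg, abs_of_pos hk0, hk] at h1
      linarith
    calc Q = √Q ^ 2 := (Real.sq_sqrt hQ.le).symm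
      _ ≤ ‖quadBarrierGrad x₀ e b (-k) ρ y‖ ^ 2 := by gcongr
  · intro y hy s hs hs2
    suffices h0 : ψ y < s by
      rcases hs.eq_or_lt with rfl | hs
      · right
        filter_upwards [hψc.continuousAt.eventually (gt_mem_nhds h0)] with z hz
        exact max_eq_right hz.le
      · exact Or.inl (max_lt h0 hs)
    rw [mem_sphere_iff_norm] at hy
    rw [hbe] at hs2
    have h1 := quadBarrier_on_sphere hd x₀ e b (-k) hρ hy
    have h3 := (hτ y).trans hy.le
    change ψ y - _ = _ at h1
    set τ := inner ℝ e (y - x₀) with hτd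
    -- Where the linear profile is well below zero, the comparison value `s` is only known to be
    -- nonnegative; there the barrier itself is negative because `2 * k < b`.
    rcases le_total (-(k / (4 * d) * b / (b + 2 * k) * ρ)) (b * τ) with h | h
    · have h2 := bracket_lower hb0 hk0 (by linarith : (0 : ℝ) < d) hρ h3 h
      linarith
    · have hτ0 : τ ≤ 0 := by
        have h4 : 0 ≤ k / (4 * d) * b / (b + 2 * k) * ρ := by positivity
        by_contra! h5
        have := mul_pos hb0 h5
        linarith
      have h5 : τ ^ 2 / ρ ≤ -τ := by
        rw [abs_of_nonpos hτ0] at h3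
        rw [div_le_iff₀ hρ]; nlinarith
      have h6 : 0 < k * (ρ / (2 * d)) := by positivity
      have h7 : k * (τ ^ 2 / ρ) ≤ k * -τ := by gcongr
      have h8 : (b - 2 * k) * τ ≤ 0 := mul_nonpos_of_nonneg_of_nonpos (by linarith) hτ0
      linarith

end Barrier

/-! ### Local comparison with extremal solutions, and recovery of the missing half of stability. -/

section Compare
variable {d : ℕ} {U D : Set (EuclideanSpace ℝ (Fin d))} {v g w : EuclideanSpace ℝ (Fin d) → ℝ}
  {μ μ' f : ℝ}

/-- Local comparison with the minimal supersolution. -/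
theorem IsMinimalSupersolutionAbove.le_of_local (hU : IsOpen U) (hμ : 0 < μ)
    (hv : IsMinimalSupersolutionAbove U μ f w v) (hD : IsOpen D) (hDU : closure D ⊆ U)
    (hg0 : ∀ y ∈ D, 0 ≤ g y) (hg : ∀ y ∈ D, SuperAt (1 + μ) g y)
    (hfr : ∀ y ∈ frontier D, ∀ᶠ z in 𝓝 y, z ∈ D → v z ≤ g z) (hw : ∀ y ∈ D, w y ≤ g y) :
    ∀ y ∈ D, v y ≤ g y := by
  classical
  obtain ⟨⟨hvs, hvf, hvw⟩, hmin⟩ := hv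
  -- Near every frontier point of `D` the competitor coincides with `v`, by the neighborhood form of
  -- `hfr`; an inequality on the frontier alone would not give the germ there.
  set m : EuclideanSpace ℝ (Fin d) → ℝ := fun y => if y ∈ D then min (v y) (g y) else v y with hm
  have hmout : ∀ y ∉ closure D, v =ᶠ[𝓝 y] m := fun y hy => by
    filter_upwards [isClosed_closure.isOpen_compl.mem_nhds hy] with z hz
    rw [hm]; simp only
    rw [if_neg fun h => hz (subset_closure h)]
  have hmU : ∀ y ∈ U, SuperAt (1 + μ) m y := by
    intro y hy
    have hvy := hvs.superAt hU hμ hy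
    by_cases hyD : y ∈ D
    · refine (hvy.min (hg y hyD)).congr ?_
      filter_upwards [hD.mem_nhds hyD] with z hz
      rw [hm]; simp only
      rw [if_pos hz]
    · refine hvy.congr ?_
      by_cases hyc : y ∈ closure D
      · filter_upwards [hfr y ⟨hyc, by rwa [hD.interior_eq]⟩] with z hz
        rw [hm]; simp only
        split_ifs with h
        · rw [min_eq_left (hz h)]
        · rfl
      · exact hmout y hyc
  have hstate : IsState U m := by
    refine ⟨fun y hy => ?_, fun y hy => ?_⟩
    · by_cases hyU : y ∈ U
      · exact (hmU y hyU).1.continuousWithinAt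
      · have h1 := hmout y fun h => hyU (hDU h)
        exact (hvs.1.1 y hy).congr_of_eventuallyEq (h1.symm.filter_mono nhdsWithin_le_nhds)
          h1.self_of_nhds.symm
    · simp only [hm]
      split_ifs with h
      · exact le_min (hvs.1.2 y hy) (hg0 y h)
      · exact hvs.1.2 y hy
  have hle := hmin m ⟨isSupersolution_of_superAt hU hstate hmU, fun y hy => ?_, fun y hy => ?_⟩
  · intro y hy
    have := hle y (subset_closure (hDU (subset_closure hy)))
    simp only [hm, if_pos hy] at this
    exact this.trans (min_le_right _ _)
  · rw [← hvf y hy]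
    simp only [hm]
    rw [if_neg]
    intro hyD
    have := hDU (subset_closure hyD)
    rw [hU.frontier_eq] at hy
    exact hy.2 this
  · simp only [hm]
    split_ifs with h
    · exact le_min (hvw y hy) (hw y h)
    · exact hvw y hy

/-- Local comparison with the maximal subsolution. -/
theorem IsMaximalSubsolutionBelow.le_of_local (hU : IsOpen U)
    (hv : IsMaximalSubsolutionBelow U μ f w v) (hD : IsOpen D) (hDU : closure D ⊆ U)
    (hg0 : ∀ y ∈ D, 0 ≤ g y) (hg : ∀ y ∈ D, SubAt (1 - μ) g y)
    (hfr : ∀ y ∈ frontier D, ∀ᶠ z in 𝓝 y, z ∈ D → g z ≤ v z) (hw : ∀ y ∈ D, g y ≤ w y) :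
    ∀ y ∈ D, g y ≤ v y := by
  classical
  obtain ⟨⟨hvs, hvf, hvw⟩, hmax⟩ := hv
  set m : EuclideanSpace ℝ (Fin d) → ℝ := fun y => if y ∈ D then max (v y) (g y) else v y with hm
  have hmout : ∀ y ∉ closure D, v =ᶠ[𝓝 y] m := fun y hy => by
    filter_upwards [isClosed_closure.isOpen_compl.mem_nhds hy] with z hz
    rw [hm]; simp only
    rw [if_neg fun h => hz (subset_closure h)]
  have hmU : ∀ y ∈ U, SubAt (1 - μ) m y := by
    intro y hy
    have hvy := hvs.subAt hU hy
    by_cases hyD : y ∈ D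
    · refine (hvy.max (hg y hyD) (hvs.1.2 y (subset_closure hy)) (hg0 y hyD)).congr ?_
      filter_upwards [hD.mem_nhds hyD] with z hz
      rw [hm]; simp only
      rw [if_pos hz]
    · refine hvy.congr ?_
      by_cases hyc : y ∈ closure D
      · filter_upwards [hfr y ⟨hyc, by rwa [hD.interior_eq]⟩] with z hz
        rw [hm]; simp only
        split_ifs with h
        · rw [max_eq_left (hz h)]
        · rfl
      · exact hmout y hyc
  have hstate : IsState U m := by
    refine ⟨fun y hy => ?_, fun y hy => ?_⟩
    · by_cases hyU : y ∈ U
      · exact (hmU y hyU).1.continuousWithinAt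
      · have h1 := hmout y fun h => hyU (hDU h)
        exact (hvs.1.1 y hy).congr_of_eventuallyEq (h1.symm.filter_mono nhdsWithin_le_nhds)
          h1.self_of_nhds.symm
    · simp only [hm]
      split_ifs with h
      · exact le_max_of_le_left (hvs.1.2 y hy)
      · exact hvs.1.2 y hy
  have hle := hmax m ⟨isSubsolution_of_subAt hU hstate hmU, fun y hy => ?_, fun y hy => ?_⟩
  · intro y hy
    have := hle y (subset_closure (hDU (subset_closure hy)))
    simp only [hm, if_pos hy] at this
    exact (le_max_right _ _).trans this
  · rw [← hvf y hy]
    simp only [hm]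
    rw [if_neg]
    intro hyD
    have := hDU (subset_closure hyD)
    rw [hU.frontier_eq] at hy
    exact hy.2 this
  · simp only [hm]
    split_ifs with h
    · exact max_le (hvw y hy) (hw y h)
    · exact hvw y hy

theorem sphere_of_mem_frontier_ball {x y : EuclideanSpace ℝ (Fin d)} {r : ℝ} (hr : 0 < r)
    (hy : y ∈ frontier (Metric.ball x r)) : y ∈ Metric.sphere x r := by
  rwa [frontier_ball x hr.ne'] at hy

/-- The minimal supersolution above a subsolution is a subsolution. -/
theorem IsMinimalSupersolutionAbove.isSubsolution (hd : 0 < d) (hU : IsOpen U) (hμ : 0 < μ)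
    (hμ' : 0 < μ') (hw : IsSubsolution U μ' w)
    (hv : IsMinimalSupersolutionAbove U μ f w v) : IsSubsolution U μ' v := by
  have hvs := hv.1.1
  have hvw := hv.1.2.2
  refine ⟨hvs.1, ⟨hvs.2.1.1, fun x r hr hx => ?_⟩, fun x hx p hp => ?_⟩
  · refine le_of_forall_pos_le_add fun ε hε => ?_
    have hcb : closure (Metric.ball x r) = Metric.closedBall x r := closure_ball x hr.ne'
    have hcv : ContinuousOn v (Metric.closedBall x r) := hvs.2.1.1.mono hx
    obtain ⟨z, hz, hzmin⟩ := (isCompact_closedBall x r).exists_isMinOn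
      (Metric.nonempty_closedBall.2 hr.le) hcv
    have hvz : 0 < v z := (hx hz).1.2
    -- A harmonic `h` with `v < h < v + ε` on the sphere. It is positive in the ball and lies above
    -- the subharmonic `w`, so minimality gives `v ≤ h`; superharmonicity of `v` gives `h ≤ v + ε`.
    -- The mean value identity for `h` passes to `v` up to `ε`.
    obtain ⟨h, hsub, hsup, hh⟩ := exists_harmonic_near hd x hr
      ((hcv.mono Metric.sphere_subset_closedBall).add (continuousOn_const (c := ε / 2)))
      (by linarith : 0 < ε / 2)
    have hhc : Continuous h := by rw [← continuousOn_univ]; exact hsub.1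
    have hfr1 : ∀ y ∈ frontier (Metric.ball x r), v y < h y := fun y hy => by
      have := (abs_lt.1 (hh y (sphere_of_mem_frontier_ball hr hy))).1
      simp only [Pi.add_apply] at this
      linarith
    have hfr2 : ∀ y ∈ frontier (Metric.ball x r), h y < v y + ε := fun y hy => by
      have := (abs_lt.1 (hh y (sphere_of_mem_frontier_ball hr hy))).2
      simp only [Pi.add_apply] at this
      linarith
    have hfrc : frontier (Metric.ball x r) ⊆ Metric.closedBall x r := fun y hy =>
      Metric.sphere_subset_closedBall (sphere_of_mem_frontier_ball hr hy)
    have hpos : ∀ y ∈ Metric.ball x r, v z ≤ h y := fun y hy =>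
      (hsup.mono (subset_univ _)).le_of_frontier_le hd Metric.isOpen_ball Metric.isBounded_ball
        hhc.continuousOn (fun y hy => (hzmin (hfrc hy)).trans (hfr1 y hy).le) y (subset_closure hy)
    have hle1 : ∀ y ∈ Metric.ball x r, v y ≤ h y := by
      refine hv.le_of_local hU hμ Metric.isOpen_ball (hcb ▸ hx.trans inter_subset_right)
        (fun y hy => hvz.le.trans (hpos y hy)) (fun y hy => superAt_of_superharmonic one_pos
          (hsup.mono (subset_univ _)) (hvz.trans_le (hpos y hy))) (fun y hy => ?_) fun y hy => ?_
      · have hyU : y ∈ U := (hx (hfrc hy)).2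
        filter_upwards [(hvs.1.continuousAt hU hyU).eventually_lt hhc.continuousAt (hfr1 y hy)]
          with y' hy' _ using hy'.le
      · have hwU := hw.isSubharmonicOn hU
        have hbU : Metric.closedBall x r ⊆ U := hx.trans inter_subset_right
        exact (hwU.mono (Metric.ball_subset_closedBall.trans hbU)).le_on hd Metric.isOpen_ball
          Metric.isBounded_ball (hwU.1.mono (hcb ▸ hbU)) hhc.continuousOn
          (hsup.mono (subset_univ _)) (fun y hy => (hvw y (subset_closure (hbU (hfrc hy)))).trans
            (hfr1 y hy).le) y (subset_closure hy)
    have hle2 : ∀ y ∈ Metric.ball x r, h y ≤ v y + ε := by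
      intro y hy
      have := ((hsub.mono (subset_univ _)).sub (isSuperharmonicOn_const ε)).le_on (g := v) hd
        Metric.isOpen_ball Metric.isBounded_ball (hhc.fun_sub continuous_const).continuousOn
        (hcb ▸ hcv) (hvs.2.1.mono (Metric.ball_subset_closedBall.trans hx))
        (fun y hy => by linarith [hfr2 y hy]) y (subset_closure hy)
      linarith
    calc v x ≤ h x := hle1 x (Metric.mem_ball_self hr)
      _ ≤ ⨍ y in Metric.ball x r, h y := hsub.2 x r hr (subset_univ _)
      _ ≤ ⨍ y in Metric.ball x r, (v y + ε) :=
        average_ball_mono hhc.continuousOn (hcv.add continuousOn_const) hle2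
      _ = _ := by rw [average_ball_add hcv continuousOn_const, average_ball_const x hr]
  · obtain ⟨hxf, hxU⟩ := hx
    obtain ⟨hv0, hfreq⟩ := (mem_frontier_posSet_iff hU hvs.1 hxU).1 hxf
    have hw0 : w x = 0 := le_antisymm (hv0 ▸ hvw x (subset_closure hxU))
      (hw.1.2 x (subset_closure hxU))
    -- If `w` is positive arbitrarily close to `x`, then `p` is also a superdifferential of `w ≤ v`,
    -- and its slope condition applies. Otherwise the obstacle vanishes near `x`, so a slope below
    -- the threshold lets the barrier push `v` down to 0 near `x`, contradicting that `x` is on the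
    -- free boundary.
    by_cases hwf : ∃ᶠ y in 𝓝 x, 0 < w y
    · refine (hw.subAt hU hxU).2.2 hw0 hwf p fun ε hε => ?_
      filter_upwards [(mem_superDiff_iff hU hvs.1 hxU p).1 hp ε hε, hU.mem_nhds hxU]
        with y hy hyU hpos
      have := hvw y (subset_closure hyU)
      exact this.trans (hy (hpos.trans_le this))
    · by_contra! hlt
      rw [not_frequently] at hwf
      obtain ⟨η, hη, hbar⟩ := exists_super_barrier hd x p (Q := 1 + μ) (by linarith)
      have hpe := (eventually_nhdsWithin_iff.1 (hp (η / 2) (by positivity)))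
      obtain ⟨δ, hδ, hball⟩ := Metric.eventually_nhds_iff_ball.1
        ((hpe.and hwf).and (hU.eventually_mem hxU))
      obtain ⟨g, hgc, hg0, hgz, hgS, hgs⟩ := hbar (δ / 2) (by positivity)
      have hcb : closure (Metric.ball x (δ / 2)) ⊆ Metric.ball x δ := by
        rw [closure_ball x (by positivity)]
        exact Metric.closedBall_subset_ball (by linarith)
      have hle := hv.le_of_local hU hμ (g := g) (Metric.isOpen_ball (x := x) (ε := δ / 2))
        (fun y hy => (hball y (hcb hy)).2) (fun y _ => hg0 y) hgS (fun y hy => ?_) (fun y hy => ?_)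
      · have hz : v =ᶠ[𝓝 x] 0 := by
          filter_upwards [hgz, Metric.ball_mem_nhds x (by positivity : 0 < δ / 2)] with y hy hyb
          refine le_antisymm ((hle y hyb).trans hy.le) (hvs.1.2 y (subset_closure ?_))
          exact (hball y (hcb (subset_closure hyb))).2
        obtain ⟨y, hy, hy'⟩ := (hfreq.and_eventually hz).exists
        simp only [hy', Pi.zero_apply, lt_self_iff_false] at hy
      · have hyb := hball y (hcb hy.1)
        have hys := sphere_of_mem_frontier_ball (by positivity) hy
        have hvy := hvs.1.2 y (subset_closure hyb.2)
        by_cases hyc : y ∈ closure (posSet U v)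
        · have h1 := hyb.1.1 hyc
          have hyn : ‖y - x‖ = δ / 2 := by rwa [mem_sphere_iff_norm] at hys
          rw [hyn] at h1
          have h2 := hgs y hys (v y) hvy (by nlinarith)
          filter_upwards [(hvs.1.continuousAt hU hyb.2).eventually_lt hgc.continuousAt h2]
            with z hz _ using hz.le
        · filter_upwards [isClosed_closure.isOpen_compl.mem_nhds hyc, hU.mem_nhds hyb.2]
            with z hz hzU _
          refine le_trans (not_lt.1 fun h => hz (subset_closure ⟨subset_closure hzU, h⟩)) (hg0 z)
      · exact (not_lt.1 (hball y (hcb (subset_closure hy))).1.2).trans (hg0 y)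

/-- The maximal subsolution below a supersolution is a supersolution. -/
theorem IsMaximalSubsolutionBelow.isSupersolution (hd : 0 < d) (hU : IsOpen U) (hμ : 0 < μ)
    (hμ1 : μ < 1) (hμ' : 0 < μ') (hw : IsSupersolution U μ' w)
    (hv : IsMaximalSubsolutionBelow U μ f w v) : IsSupersolution U μ' v := by
  have hvs := hv.1.1
  have hvw := hv.1.2.2
  have hwpos : posSet U v ∩ U ⊆ posSet U w ∩ U := fun y hy =>
    ⟨⟨hy.1.1, hy.1.2.trans_le (hvw y hy.1.1)⟩, hy.2⟩
  refine ⟨hvs.1, ⟨hvs.2.1.1, fun x r hr hx => ?_⟩, fun x hx p hp => ?_⟩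
  · refine le_of_forall_pos_le_add fun ε hε => ?_
    have hcb : closure (Metric.ball x r) = Metric.closedBall x r := closure_ball x hr.ne'
    have hcv : ContinuousOn v (Metric.closedBall x r) := hvs.2.1.1.mono hx
    obtain ⟨z, hz, hzmin⟩ := (isCompact_closedBall x r).exists_isMinOn
      (Metric.nonempty_closedBall.2 hr.le) hcv
    have hvz : 0 < v z := (hx hz).1.2
    -- The harmonic function will satisfy `v - 2 * κ < h < v` on the sphere: the first bound keeps
    -- it within `ε` of `v`, the second keeps it at least `v z / 2`, hence positive.
    set κ := min (ε / 2) (v z / 4) with hκ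
    have hκ0 : 0 < κ := by positivity
    have hκ1 : κ ≤ ε / 2 := min_le_left _ _
    have hκ2 : κ ≤ v z / 4 := min_le_right _ _
    obtain ⟨h, hsub, hsup, hh⟩ := exists_harmonic_near hd x hr
      ((hcv.mono Metric.sphere_subset_closedBall).sub (continuousOn_const (c := κ))) hκ0
    have hhc : Continuous h := by rw [← continuousOn_univ]; exact hsub.1
    have hfr1 : ∀ y ∈ frontier (Metric.ball x r), h y < v y := fun y hy => by
      have := (abs_lt.1 (hh y (sphere_of_mem_frontier_ball hr hy))).2
      simp only [Pi.sub_apply] at this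
      linarith
    have hfr2 : ∀ y ∈ frontier (Metric.ball x r), v y - 2 * κ < h y := fun y hy => by
      have := (abs_lt.1 (hh y (sphere_of_mem_frontier_ball hr hy))).1
      simp only [Pi.sub_apply] at this
      linarith
    have hfrc : frontier (Metric.ball x r) ⊆ Metric.closedBall x r := fun y hy =>
      Metric.sphere_subset_closedBall (sphere_of_mem_frontier_ball hr hy)
    have hpos : ∀ y ∈ Metric.ball x r, v z / 2 ≤ h y := fun y hy =>
      (hsup.mono (subset_univ _)).le_of_frontier_le hd Metric.isOpen_ball Metric.isBounded_ball
        hhc.continuousOn (fun y hy => by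
          have h1 : v z ≤ v y := hzmin (hfrc hy)
          linarith [hfr2 y hy]) y (subset_closure hy)
    have hle1 : ∀ y ∈ Metric.ball x r, h y ≤ v y := by
      refine hv.le_of_local hU Metric.isOpen_ball (hcb ▸ hx.trans inter_subset_right)
        (fun y hy => (half_pos hvz).le.trans (hpos y hy)) (fun y hy => subAt_of_subharmonic one_pos
          (hsub.mono (subset_univ _)) ((half_pos hvz).trans_le (hpos y hy)))
          (fun y hy => ?_) fun y hy => ?_
      · have hyU : y ∈ U := (hx (hfrc hy)).2
        filter_upwards [hhc.continuousAt.eventually_lt (hvs.1.continuousAt hU hyU) (hfr1 y hy)]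
          with y' hy' _ using hy'.le
      · have hbw : Metric.closedBall x r ⊆ posSet U w ∩ U := hx.trans hwpos
        exact (hsub.mono (subset_univ _)).le_on hd Metric.isOpen_ball
          Metric.isBounded_ball hhc.continuousOn (hw.2.1.1.mono (hcb ▸ hbw))
          (hw.2.1.mono (Metric.ball_subset_closedBall.trans hbw))
          (fun y hy => (hfr1 y hy).le.trans (hvw y (hx (hfrc hy)).1.1)) y (subset_closure hy)
    have hle2 : ∀ y ∈ Metric.ball x r, v y + -ε ≤ h y := by
      intro y hy
      have := ((hvs.2.1.mono (Metric.ball_subset_closedBall.trans hx)).sub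
        (isSuperharmonicOn_const ε)).le_on (g := h) hd
        Metric.isOpen_ball Metric.isBounded_ball (ContinuousOn.fun_sub (hcb ▸ hcv) continuousOn_const)
        hhc.continuousOn (hsup.mono (subset_univ _))
        (fun y hy => by linarith [hfr2 y hy]) y (subset_closure hy)
      linarith
    have h1 : (⨍ y in Metric.ball x r, v y) + -ε ≤ v x := calc
      (⨍ y in Metric.ball x r, v y) + -ε = ⨍ y in Metric.ball x r, (v y + -ε) := by
          rw [average_ball_add hcv continuousOn_const, average_ball_const x hr]
      _ ≤ ⨍ y in Metric.ball x r, h y :=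
        average_ball_mono (hcv.add continuousOn_const) hhc.continuousOn hle2
      _ ≤ h x := hsup.2 x r hr (subset_univ _)
      _ ≤ v x := hle1 x (Metric.mem_ball_self hr)
    linarith
  · obtain ⟨hxf, hxU⟩ := hx
    obtain ⟨hv0, hfreq⟩ := (mem_frontier_posSet_iff hU hvs.1 hxU).1 hxf
    by_contra! hlt
    -- If the obstacle touched zero at `x`, then `p` would be a subdifferential of `w` as well,
    -- whose slope is bounded. So there is room below `w` for a barrier positive at `x`, which
    -- contradicts `v x = 0`.
    have hw0 : 0 < w x := by
      refine (hw.1.2 x (subset_closure hxU)).lt_of_ne fun h0 => hlt.not_ge ?_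
      refine (hw.superAt hU hμ' hxU).2.2 h0.symm p fun ε hε => ?_
      filter_upwards [hp ε hε, hU.mem_nhds hxU] with y hy hyU
      exact hy.trans (hvw y (subset_closure hyU))
    obtain ⟨η, hη, M, hM, hbar⟩ := exists_sub_barrier hd x p (Q := 1 - μ) (by linarith)
      (by linarith)
    obtain ⟨δ, hδ, hball⟩ := Metric.eventually_nhds_iff_ball.1
      (((hp (η / 2) (by positivity)).and ((hw.1.continuousAt hU hxU).eventually
        (lt_mem_nhds (half_lt_self hw0)))).and (hU.eventually_mem hxU))
    -- The barrier is at most `M * ρ ≤ w x / 2` in the ball, hence below the obstacle.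
    set ρ := min (δ / 2) (w x / 2 / M) with hρ
    have hρ0 : 0 < ρ := by positivity
    obtain ⟨g, hgc, hg0, hgx, hgM, hgS, hgs⟩ := hbar ρ hρ0
    have hcb : closure (Metric.ball x ρ) ⊆ Metric.ball x δ := by
      rw [closure_ball x hρ0.ne']
      exact Metric.closedBall_subset_ball ((min_le_left _ _).trans_lt (by linarith))
    have hle := hv.le_of_local hU (g := g) (Metric.isOpen_ball (x := x) (ε := ρ))
      (fun y hy => (hball y (hcb hy)).2) (fun y _ => hg0 y) hgS (fun y hy => ?_) (fun y hy => ?_)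
    · have := hle x (Metric.mem_ball_self hρ0)
      linarith
    · have hyb := hball y (hcb hy.1)
      have hys := sphere_of_mem_frontier_ball hρ0 hy
      have hvy := hvs.1.2 y (subset_closure hyb.2)
      have h1 := hyb.1.1
      have hyn : ‖y - x‖ = ρ := by rwa [mem_sphere_iff_norm] at hys
      rw [hyn] at h1
      have hηρ := mul_pos hη hρ0
      rcases hgs y hys (v y) hvy (by linarith) with h2 | h2
      · filter_upwards [hgc.continuousAt.eventually_lt (hvs.1.continuousAt hU hyb.2) h2]
          with z hz _ using hz.le
      · filter_upwards [h2, hU.mem_nhds hyb.2] with z hz hzU _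
        exact hz.le.trans (hvs.1.2 z (subset_closure hzU))
    · have h1 : M * ρ ≤ w x / 2 := by
        have : ρ ≤ w x / 2 / M := min_le_right _ _
        rwa [le_div_iff₀ hM, mul_comm] at this
      exact ((hgM y hy).trans h1).trans (hball y (hcb (subset_closure hy))).1.2.le

end Compare

/-! ### Geometry of the star-shaped complement. -/

/-- If `c • x` were in `K`, a point `y` of `U` near `x` would be a convex combination of `c • x` and
a point near the origin. Star-shapedness about that point would put `y` in `K`. This strictness at
the boundary is what needs a neighborhood of centers. -/
theorem smul_mem_of_starShaped {d : ℕ} {U : Set (EuclideanSpace ℝ (Fin d))}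
    (hK : IsStronglyStarShaped Uᶜ) {c : ℝ} (hc : 1 < c) {x : EuclideanSpace ℝ (Fin d)}
    (hx : x ∈ closure U) : c • x ∈ U := by
  by_contra hn
  obtain ⟨ε, hε, hs⟩ := Metric.eventually_nhds_iff_ball.1 hK.2
  have hc0 : 0 < c := by linarith
  have hci : c⁻¹ < 1 := inv_lt_one_of_one_lt₀ hc
  obtain ⟨y, hyU, hy⟩ := Metric.mem_closure_iff.1 hx (ε * (1 - c⁻¹)) (mul_pos hε (by linarith))
  have hb : (1 - c⁻¹)⁻¹ • (y - x) ∈ Metric.ball (0 : EuclideanSpace ℝ (Fin d)) ε := by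
    rw [mem_ball_zero_iff, norm_smul, norm_inv, Real.norm_of_nonneg (by linarith),
      inv_mul_lt_iff₀ (by linarith), ← dist_eq_norm, dist_comm, mul_comm]
    exact hy
  have := hs _ hb hn (by linarith : 0 ≤ 1 - c⁻¹) (by positivity : 0 ≤ c⁻¹) (by ring)
  rw [smul_smul, smul_smul, mul_inv_cancel₀ (by linarith), inv_mul_cancel₀ hc0.ne', one_smul,
    one_smul, sub_add_cancel] at this
  exact this hyU

theorem exists_frontier_near {d : ℕ} {U : Set (EuclideanSpace ℝ (Fin d))} (hU : IsOpen U)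
    {x y : EuclideanSpace ℝ (Fin d)} (hx : x ∈ closure U) (hy : y ∉ closure U) :
    ∃ z ∈ frontier U, dist x z ≤ dist x y := by
  by_contra! hn
  have hseg : ∀ z ∈ segment ℝ x y, z ∉ frontier U := fun z hz hzf => by
    have := segment_subset_closedBall_left x y hz
    rw [Metric.mem_closedBall, dist_comm] at this
    exact (hn z hzf).not_ge this
  have hUf : ∀ z ∈ segment ℝ x y, z ∈ closure U → z ∈ U := fun z hz hzc => by
    by_contra h
    exact hseg z hz ⟨hzc, fun hi => h (interior_subset hi)⟩
  obtain ⟨z, -, hzU, hzc⟩ := (convex_segment (𝕜 := ℝ) x y).isPreconnected U (closure U)ᶜ hU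
    isClosed_closure.isOpen_compl (fun z hz => or_iff_not_imp_right.2 fun h =>
      hUf z hz (not_not.1 h)) ⟨x, left_mem_segment ℝ x y, hUf x (left_mem_segment ℝ x y) hx⟩
    ⟨y, right_mem_segment ℝ x y, hy⟩
  exact hzc (subset_closure hzU)

/-! ### Dilation estimates for a single monotone step. -/

section Steps
variable {d : ℕ} {U : Set (EuclideanSpace ℝ (Fin d))} {v g w : EuclideanSpace ℝ (Fin d) → ℝ}
  {μ μp μm f f' R R' c : ℝ}

theorem mem_or_mem_frontier {x : EuclideanSpace ℝ (Fin d)} (hx : x ∈ closure U) :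
    x ∈ U ∨ x ∈ frontier U := by
  by_cases h : x ∈ U
  · exact Or.inl h
  · exact Or.inr ⟨hx, fun hi => h (interior_subset hi)⟩

/-- The competitor `c * g (c⁻¹ • ·)` is defined only over `c • U`, so it is glued to `v` there; the
strict `f < c * f'` puts it above `v` near the boundary. Taking `g` to be the old state yields the
distance estimate, taking `g = v` propagates the dilation inequality. -/
theorem IsMinimalSupersolutionAbove.comp_smul_le (hU : IsOpen U)
    (hK : ∀ c : ℝ, 1 < c → ∀ x ∈ closure U, c • x ∈ U) (hμ : 0 < μ)
    (hv : IsMinimalSupersolutionAbove U μ f w v) (hvf : ∀ x ∈ closure U, v x ≤ f)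
    (hg : IsSupersolution U μ g) (hgf : ∀ x ∈ frontier U, g x = f') (hc : 1 < c)
    (hcf : f < c * f') (hw : ∀ x ∈ closure U, w (c • x) ≤ c * g x) :
    ∀ x ∈ closure U, v (c • x) ≤ c * g x := by
  have hc0 : 0 < c := by linarith
  have hcc : Continuous fun y : EuclideanSpace ℝ (Fin d) => c⁻¹ • y := continuous_const_smul _
  have hinv : ∀ y : EuclideanSpace ℝ (Fin d), c • c⁻¹ • y = y := fun y => by
    rw [smul_smul, mul_inv_cancel₀ hc0.ne', one_smul]
  have hinv' : ∀ y : EuclideanSpace ℝ (Fin d), c⁻¹ • c • y = y := fun y => by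
    rw [smul_smul, inv_mul_cancel₀ hc0.ne', one_smul]
  set D : Set (EuclideanSpace ℝ (Fin d)) := (fun y => c⁻¹ • y) ⁻¹' U with hD
  have hDo : IsOpen D := hU.preimage hcc
  have hDcl : ∀ y ∈ closure D, c⁻¹ • y ∈ closure U := fun y hy =>
    hcc.closure_preimage_subset U hy
  have hDU : closure D ⊆ U := fun y hy => hinv y ▸ hK c hc _ (hDcl y hy)
  have hle : ∀ y ∈ D, v y ≤ c * g (c⁻¹ • y) := by
    refine hv.le_of_local hU hμ hDo hDU
      (fun y hy => mul_nonneg hc0.le (hg.1.2 _ (subset_closure hy))) (fun y hy => ?_)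
      (fun y hy => ?_) (fun y hy => ?_)
    · have := (hg.superAt hU hμ (x := c⁻¹ • y) hy).dilate (inv_pos.2 hc0)
      rwa [inv_inv] at this
    · have hyf : c⁻¹ • y ∈ frontier U := by
        refine ⟨hDcl y hy.1, fun h => ?_⟩
        rw [hU.interior_eq] at h
        exact hy.2 (hDo.interior_eq.symm ▸ h)
      have h1 : ∀ᶠ z in 𝓝[closure U] (c⁻¹ • y), f < c * g z := by
        refine ((hg.1.1 _ hyf.1).const_mul c).eventually (lt_mem_nhds ?_)
        simpa only [hgf _ hyf] using hcf
      rw [eventually_nhdsWithin_iff] at h1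
      filter_upwards [hcc.continuousAt.eventually h1] with z hz hzD
      exact (hvf z (subset_closure (hDU (subset_closure hzD)))).trans
        (hz (subset_closure hzD)).le
    · have := hw _ (subset_closure hy : c⁻¹ • y ∈ closure U)
      rwa [hinv] at this
  intro x hx
  rcases mem_or_mem_frontier hx with h | h
  · have := hle (c • x) (by rw [hD, mem_preimage, hinv']; exact h)
    rwa [hinv'] at this
  · rw [hgf x h]
    exact (hvf _ (subset_closure (hK c hc x hx))).trans hcf.le

theorem IsMinimalSupersolutionAbove.le_boundary (hU : IsOpen U) (hμ : 0 < μ) (hf : 0 < f)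
    (hv : IsMinimalSupersolutionAbove U μ f w v) (hw : ∀ x ∈ closure U, w x ≤ f) :
    ∀ x ∈ closure U, v x ≤ f := by
  have hs : IsState U fun x => min (v x) f :=
    ⟨hv.1.1.1.1.inf continuousOn_const, fun x hx => le_min (hv.1.1.1.2 x hx) hf.le⟩
  have := hv.2 (fun x => min (v x) f) ⟨isSupersolution_of_superAt hU hs fun x hx =>
    (hv.1.1.superAt hU hμ hx).min (superAt_of_superharmonic one_pos (isSuperharmonicOn_const f) hf),
    fun x hx => by simp [hv.1.2.1 x hx], fun x hx => le_min (hv.1.2.2 x hx) (hw x hx)⟩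
  exact fun x hx => (this x hx).trans (min_le_right _ _)

/-- Here `c⁻¹ * g (c • ·)` is defined on all of `closure U`, so its maximum with `v` is a global
competitor and a non-strict boundary inequality suffices. -/
theorem IsMaximalSubsolutionBelow.comp_smul_le (hU : IsOpen U)
    (hK : ∀ c : ℝ, 1 < c → ∀ x ∈ closure U, c • x ∈ U)
    (hv : IsMaximalSubsolutionBelow U μ f w v)
    (hg : IsSubsolution U μ g) (hc : 1 < c) (hgf : ∀ x ∈ frontier U, g (c • x) ≤ c * f)
    (hw : ∀ x ∈ closure U, g (c • x) ≤ c * w x) :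
    ∀ x ∈ closure U, g (c • x) ≤ c * v x := by
  have hc0 : 0 < c := by linarith
  have key : ∀ a b : ℝ, a ≤ c * b → c⁻¹ * a ≤ b := fun a b h => by
    rwa [inv_mul_le_iff₀ hc0]
  have hs : IsState U fun x => max (v x) (c⁻¹ * g (c • x)) := by
    refine ⟨hv.1.1.1.1.sup (continuousOn_const.mul (hg.1.1.comp (by fun_prop)
      fun x hx => subset_closure (hK c hc x hx))), fun x hx =>
      le_max_of_le_left (hv.1.1.1.2 x hx)⟩
  have := hv.2 (fun x => max (v x) (c⁻¹ * g (c • x))) ⟨isSubsolution_of_subAt hU hs fun x hx => ?_,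
    fun x hx => ?_, fun x hx => max_le (hv.1.2.2 x hx) (key _ _ (hw x hx))⟩
  · intro x hx
    have h := (le_max_right _ _).trans (this x hx)
    rwa [inv_mul_le_iff₀ hc0] at h
  · have hcx : c • x ∈ U := hK c hc x (subset_closure hx)
    exact (hv.1.1.subAt hU hx).max ((hg.subAt hU hcx).dilate hc0)
      (hv.1.1.1.2 x (subset_closure hx))
      (mul_nonneg (inv_pos.2 hc0).le (hg.1.2 _ (subset_closure hcx)))
  · simp only [hv.1.2.1 x hx]
    exact max_eq_left (key _ _ (hgf x hx))

theorem IsSubsolution.le_boundary (hd : 0 < d) (hU : IsOpen U) (hf : 0 ≤ f)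
    (hv : IsSubsolution U μ v) (hvf : ∀ x ∈ frontier U, v x = f)
    (hb : Bornology.IsBounded (posSet U v)) : ∀ x ∈ closure U, v x ≤ f := by
  have hS : IsOpen (posSet U v ∩ U) := hv.1.isOpen_posSet_inter hU
  have hcl : closure (posSet U v ∩ U) ⊆ closure U := closure_mono inter_subset_right
  have hout : ∀ x ∈ closure U, x ∉ posSet U v ∩ U → v x ≤ f := fun x hx hn => by
    rcases mem_or_mem_frontier hx with h | h
    · exact (not_lt.1 fun h' => hn ⟨⟨hx, h'⟩, h⟩).trans hf
    · exact (hvf x h).le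
  intro x hx
  by_cases h : x ∈ posSet U v ∩ U
  · refine ((hv.isSubharmonicOn hU).mono inter_subset_right).le_of_le_frontier hd hS
      (hb.subset inter_subset_left) (hv.1.1.mono hcl) (fun y hy => ?_) x (subset_closure h)
    exact hout y (hcl hy.1) fun h' => hy.2 (hS.interior_eq.symm ▸ h')
  · exact hout x hx h

/-- The properties of obstacle solutions at a fixed time: stability, the boundary value `f` is
the maximum, monotonicity under dilations, and positivity set in a ball of radius `R`. -/
structure IsStarState (U : Set (EuclideanSpace ℝ (Fin d))) (μp μm f R : ℝ)
    (w : EuclideanSpace ℝ (Fin d) → ℝ) : Prop where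
  super : IsSupersolution U μp w
  sub : IsSubsolution U μm w
  bdry : ∀ x ∈ frontier U, w x = f
  le : ∀ x ∈ closure U, w x ≤ f
  scale : ∀ c : ℝ, 1 < c → ∀ x ∈ closure U, w (c • x) ≤ c * w x
  bdd : ∀ x ∈ posSet U w, ‖x‖ ≤ R

theorem IsStarState.mono (h : IsStarState U μp μm f R w) (hR : R ≤ R') :
    IsStarState U μp μm f R' w :=
  ⟨h.super, h.sub, h.bdry, h.le, h.scale, fun x hx => (h.bdd x hx).trans hR⟩

/-- Where `w (c • x) > 0` in `U`, star-shapedness about the origin gives `w x > 0`, so `c * w` is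
superharmonic there while `w (c • ·)` is subharmonic. On the boundary of that set either `w (c • x)
= 0`, or `x ∈ ∂U` and `w (c • x) ≤ f ≤ c * f`. -/
theorem IsStable.isStarState (hd : 0 < d) (hU : IsOpen U)
    (hK : ∀ c : ℝ, 1 < c → ∀ x ∈ closure U, c • x ∈ U) (hf : 0 < f)
    (hw : IsStable U μp μm w) (hwf : ∀ x ∈ frontier U, w x = f)
    (hstar : StarConvex ℝ 0 (posSet U w ∪ Uᶜ)) (hR : ∀ x ∈ posSet U w, ‖x‖ ≤ R) :
    IsStarState U μp μm f R w := by
  obtain ⟨hs, hh, hge, hle⟩ := hw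
  have ho := hs.isOpen_posSet_inter hU
  have hsup : IsSupersolution U μp w := ⟨hs, isSuperharmonicOn_of_lap_nonpos ho hh.contDiffOn
    fun x hx => (laplacian_eq_zero_of_harmonicAt (hh x hx)).le, hle⟩
  have hsub : IsSubsolution U μm w := ⟨hs, isSubharmonicOn_of_lap_nonneg ho hh.contDiffOn
    fun x hx => (laplacian_eq_zero_of_harmonicAt (hh x hx)).ge, hge⟩
  have hb : Bornology.IsBounded (posSet U w) :=
    isBounded_iff_forall_norm_le.2 ⟨R, hR⟩
  have hlef := hsub.le_boundary hd hU hf.le hwf hb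
  refine ⟨hsup, hsub, hwf, hlef, fun c hc => ?_, hR⟩
  have hc0 : 0 < c := by linarith
  have hcont : ContinuousOn (fun x => w (c • x)) (closure U) :=
    hs.1.comp (by fun_prop) fun x hx => subset_closure (hK c hc x hx)
  set S : Set (EuclideanSpace ℝ (Fin d)) := {x | x ∈ U ∧ 0 < w (c • x)} with hS
  have hSo : IsOpen S := by
    rw [isOpen_iff_mem_nhds]
    rintro y ⟨hyU, hy⟩
    have := hcont.continuousAt (mem_of_superset (hU.mem_nhds hyU) subset_closure)
    filter_upwards [hU.mem_nhds hyU, this.eventually (lt_mem_nhds hy)] with z hz hz'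
    exact ⟨hz, hz'⟩
  have hSU : S ⊆ U := fun x hx => hx.1
  have hScl : closure S ⊆ closure U := closure_mono hSU
  have hout : ∀ x ∈ closure U, x ∉ S → w (c • x) ≤ c * w x := fun x hx hn => by
    rcases mem_or_mem_frontier hx with h | h
    · exact (not_lt.1 fun h' => hn ⟨h, h'⟩).trans (mul_nonneg hc0.le (hs.2 x hx))
    · rw [hwf x h]
      exact (hlef _ (subset_closure (hK c hc x hx))).trans (by nlinarith)
  have hSb : Bornology.IsBounded S := by
    refine isBounded_iff_forall_norm_le.2 ⟨R, fun x hx => ?_⟩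
    have h1 := hR (c • x) ⟨subset_closure (hK c hc x (subset_closure hx.1)), hx.2⟩
    rw [norm_smul, Real.norm_of_nonneg hc0.le] at h1
    nlinarith [norm_nonneg x]
  have hSp : S ⊆ posSet U w ∩ U := by
    intro x hx
    have h1 := hstar (y := c • x)
      (Or.inl ⟨subset_closure (hK c hc x (subset_closure hx.1)), hx.2⟩)
      (a := 1 - c⁻¹) (b := c⁻¹) (by linarith [inv_lt_one_of_one_lt₀ hc]) (by positivity) (by ring)
    rw [smul_zero, zero_add, smul_smul, inv_mul_cancel₀ hc0.ne', one_smul] at h1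
    exact ⟨h1.resolve_right fun h => h hx.1, hx.1⟩
  intro x hx
  by_cases hxS : x ∈ S
  · refine IsSubharmonicOn.le_on (f := fun x => w (c • x)) (g := fun x => c * w x) hd hSo hSb
      (hcont.mono hScl) (continuousOn_const.mul (hs.1.mono hScl))
      (((hsub.isSubharmonicOn hU).comp_smul hc0).mono fun y hy =>
        hK c hc y (subset_closure hy.1)) ((hsup.2.1.mono hSp).const_mul hc0.le) (fun y hy => ?_) x
      (subset_closure hxS)
    exact hout y (hScl hy.1) fun h' => hy.2 (hSo.interior_eq.symm ▸ h')
  · exact hout x hx hxS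

theorem IsStarState.increasing_le (hU : IsOpen U)
    (hK : ∀ c : ℝ, 1 < c → ∀ x ∈ closure U, c • x ∈ U) (hμp : 0 < μp) (hf : 0 < f)
    (hff : f ≤ f') (hw : IsStarState U μp μm f R w)
    (hv : IsMinimalSupersolutionAbove U μp f' w v) (hc : 1 < c) (hcf : f' < c * f) :
    ∀ x ∈ closure U, v (c • x) ≤ c * w x :=
  hv.comp_smul_le hU hK hμp (hv.le_boundary hU hμp (hf.trans_le hff)
    fun x hx => (hw.le x hx).trans hff) hw.super hw.bdry hc hcf (hw.scale c hc)

theorem IsStarState.increasing (hd : 0 < d) (hU : IsOpen U)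
    (hK : ∀ c : ℝ, 1 < c → ∀ x ∈ closure U, c • x ∈ U) (hR : ∀ x ∉ U, ‖x‖ ≤ R)
    (hμp : 0 < μp) (hμm : 0 < μm) (hf : 0 < f) (hff : f ≤ f')
    (hw : IsStarState U μp μm f R w) (hv : IsMinimalSupersolutionAbove U μp f' w v)
    (hc : 1 < c) (hcf : f' < c * f) : IsStarState U μp μm f' (c * R) v := by
  have hc0 : 0 < c := by linarith
  have hvf := hv.le_boundary hU hμp (hf.trans_le hff) fun x hx => (hw.le x hx).trans hff
  refine ⟨hv.1.1, hv.isSubsolution hd hU hμp hμm hw.sub, hv.1.2.1, hvf, fun c hc => ?_,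
    fun x hx => ?_⟩
  · refine hv.comp_smul_le hU hK hμp hvf hv.1.1 hv.1.2.1 hc (by nlinarith) fun x hx => ?_
    refine (hw.scale c hc x hx).trans ?_
    have := hv.1.2.2 x hx
    gcongr
  · have hinv : c • c⁻¹ • x = x := by rw [smul_smul, mul_inv_cancel₀ hc0.ne', one_smul]
    have h1 : ‖c⁻¹ • x‖ ≤ R := by
      by_cases h : c⁻¹ • x ∈ closure U
      · refine hw.bdd _ ⟨h, ?_⟩
        have := hw.increasing_le hU hK hμp hf hff hv hc hcf _ h
        rw [hinv] at this
        exact pos_of_mul_pos_right (hx.2.trans_le this) hc0.le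
      · exact hR _ fun h' => h (subset_closure h')
    rwa [norm_smul, Real.norm_of_nonneg (by positivity), inv_mul_le_iff₀ hc0] at h1

theorem IsStarState.decreasing (hd : 0 < d) (hU : IsOpen U)
    (hK : ∀ c : ℝ, 1 < c → ∀ x ∈ closure U, c • x ∈ U)
    (hμp : 0 < μp) (hμm : 0 < μm) (hμm1 : μm < 1) (hf' : 0 < f')
    (hw : IsStarState U μp μm f R w) (hv : IsMaximalSubsolutionBelow U μm f' w v) :
    IsStarState U μp μm f' R v := by
  have hb : ∀ x ∈ posSet U v, ‖x‖ ≤ R := fun x hx =>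
    hw.bdd x ⟨hx.1, hx.2.trans_le (hv.1.2.2 x hx.1)⟩
  have hvf := hv.1.1.le_boundary hd hU hf'.le hv.1.2.1 (isBounded_iff_forall_norm_le.2 ⟨R, hb⟩)
  refine ⟨hv.isSupersolution hd hU hμm hμm1 hμp hw.super, hv.1.1, hv.1.2.1, hvf, fun c hc => ?_, hb⟩
  refine hv.comp_smul_le hU hK hv.1.1 hc (fun x hx => ?_) fun x hx => ?_
  · exact (hvf _ (subset_closure (hK c hc x hx.1))).trans (by nlinarith)
  · exact (hv.1.2.2 _ (subset_closure (hK c hc x hx))).trans (hw.scale c hc x hx)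

theorem IsStarState.decreasing_le (hU : IsOpen U)
    (hK : ∀ c : ℝ, 1 < c → ∀ x ∈ closure U, c • x ∈ U)
    (hw : IsStarState U μp μm f R w) (hv : IsMaximalSubsolutionBelow U μm f' w v)
    (hc : 1 < c) (hcf : f ≤ c * f') : ∀ x ∈ closure U, w (c • x) ≤ c * v x :=
  hv.comp_smul_le hU hK hw.sub hc (fun x hx =>
    (hw.le _ (subset_closure (hK c hc x hx.1))).trans hcf) (hw.scale c hc)

/-- If dilating by `c` maps `v` below `c * w`, then each point of `Ω(v)` is close to `Ω(w)`. -/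
theorem exists_posSet_near (hU : IsOpen U) (hc : 1 < c) (hf : 0 < f) (hwf : ∀ x ∈ frontier U, w x = f)
    (hle : ∀ x ∈ closure U, v (c • x) ≤ c * w x)
    (hR : ∀ x ∈ posSet U v, ‖c⁻¹ • x‖ ≤ R) {x : EuclideanSpace ℝ (Fin d)}
    (hx : x ∈ posSet U v) :
    ∃ y ∈ posSet U w, edist x y ≤ ENNReal.ofReal ((c - 1) * R) := by
  have hc0 : 0 < c := by linarith
  have hinv : c • c⁻¹ • x = x := by rw [smul_smul, mul_inv_cancel₀ hc0.ne', one_smul]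
  have hdist : dist x (c⁻¹ • x) ≤ (c - 1) * R := by
    have : x - c⁻¹ • x = (c - 1) • c⁻¹ • x := by rw [sub_smul, hinv, one_smul]
    rw [dist_eq_norm, this, norm_smul, Real.norm_of_nonneg (by linarith)]
    exact mul_le_mul_of_nonneg_left (hR x hx) (by linarith)
  by_cases h : c⁻¹ • x ∈ closure U
  · refine ⟨c⁻¹ • x, ⟨h, ?_⟩, ?_⟩
    · have := hle _ h
      rw [hinv] at this
      exact pos_of_mul_pos_right (hx.2.trans_le this) hc0.le
    · rw [edist_dist]
      exact ENNReal.ofReal_le_ofReal hdist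
  -- The contraction may carry `x` into the interior of `K`; the segment then crosses `∂U`, where `w
  -- = f > 0`.
  · obtain ⟨z, hz, hzd⟩ := exists_frontier_near hU hx.1 h
    refine ⟨z, ⟨hz.1, by rw [hwf z hz]; exact hf⟩, ?_⟩
    rw [edist_dist]
    exact ENNReal.ofReal_le_ofReal (hzd.trans hdist)

/-- Dilation comparison is available only for factors strictly above the ratio of boundary values;
the limit gives the sharp factor, which is needed for a bound linear in `|t - s|`. -/
theorem le_ofReal_of_forall_gt {a : ℝ≥0∞} {c₀ R : ℝ}
    (h : ∀ c, c₀ < c → a ≤ ENNReal.ofReal ((c - 1) * R)) : a ≤ ENNReal.ofReal ((c₀ - 1) * R) := by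
  have hc : Continuous fun c : ℝ => ENNReal.ofReal ((c - 1) * R) :=
    ENNReal.continuous_ofReal.comp (by fun_prop)
  refine ge_of_tendsto ((hc.tendsto c₀).mono_left (nhdsWithin_le_nhds (s := Ioi c₀))) ?_
  filter_upwards [self_mem_nhdsWithin] with c hc using h c hc

theorem IsStarState.hausdorffEDist_increasing (hU : IsOpen U)
    (hK : ∀ c : ℝ, 1 < c → ∀ x ∈ closure U, c • x ∈ U) (hR : ∀ x ∉ U, ‖x‖ ≤ R)
    (hμp : 0 < μp) (hf : 0 < f) (hff : f ≤ f')
    (hw : IsStarState U μp μm f R w) (hv : IsMinimalSupersolutionAbove U μp f' w v) :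
    Metric.hausdorffEDist (posSet U w) (posSet U v) ≤ ENNReal.ofReal ((f' / f - 1) * R) := by
  refine le_ofReal_of_forall_gt fun c hc => ?_
  have hc1 : 1 < c := ((one_le_div hf).2 hff).trans_lt hc
  have hcf : f' < c * f := (div_lt_iff₀ hf).1 hc
  have hc0 : 0 < c := by linarith
  have hle := hw.increasing_le hU hK hμp hf hff hv hc1 hcf
  refine Metric.hausdorffEDist_le_of_mem_edist (fun x hx => ⟨x, ⟨hx.1,
    hx.2.trans_le (hv.1.2.2 x hx.1)⟩, by simp⟩) fun x hx => ?_
  refine exists_posSet_near hU hc1 hf hw.bdry hle (fun y hy => ?_) hx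
  have hinv : c • c⁻¹ • y = y := by rw [smul_smul, mul_inv_cancel₀ hc0.ne', one_smul]
  by_cases h : c⁻¹ • y ∈ closure U
  · refine hw.bdd _ ⟨h, ?_⟩
    have := hle _ h
    rw [hinv] at this
    exact pos_of_mul_pos_right (hy.2.trans_le this) hc0.le
  · exact hR _ fun h' => h (subset_closure h')

theorem IsStarState.hausdorffEDist_decreasing (hU : IsOpen U)
    (hK : ∀ c : ℝ, 1 < c → ∀ x ∈ closure U, c • x ∈ U)
    (hf' : 0 < f') (hff : f' ≤ f)
    (hw : IsStarState U μp μm f R w) (hv : IsMaximalSubsolutionBelow U μm f' w v) :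
    Metric.hausdorffEDist (posSet U w) (posSet U v) ≤ ENNReal.ofReal ((f / f' - 1) * R) := by
  refine le_ofReal_of_forall_gt fun c hc => ?_
  have hc1 : 1 < c := ((one_le_div hf').2 hff).trans_lt hc
  have hcf : f < c * f' := (div_lt_iff₀ hf').1 hc
  have hc0 : 0 < c := by linarith
  refine Metric.hausdorffEDist_le_of_mem_edist (fun x hx => ?_) (fun x hx => ⟨x, ⟨hx.1,
    hx.2.trans_le (hv.1.2.2 x hx.1)⟩, by simp⟩)
  refine exists_posSet_near hU hc1 hf' hv.1.2.1 (hw.decreasing_le hU hK hv hc1 hcf.le)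
    (fun y hy => ?_) hx
  rw [norm_smul, Real.norm_of_nonneg (by positivity)]
  exact (mul_le_of_le_one_left (norm_nonneg _) (inv_le_one_of_one_le₀ hc1.le)).trans (hw.bdd y hy)

end Steps

/-! ### Lipschitz dependence on time over monotone intervals and across `Z`. -/

section Evolution
variable {d : ℕ} {U : Set (EuclideanSpace ℝ (Fin d))} {μp μm T : ℝ} {Z : Set ℝ} {F : ℝ → ℝ}
  {u : ℝ → EuclideanSpace ℝ (Fin d) → ℝ} {m M R : ℝ} {L : ℝ≥0}

/-- The positivity sets of `u` are Lipschitz in time on `A`, in the Hausdorff distance. -/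
def PosSetLipschitzOn (U : Set (EuclideanSpace ℝ (Fin d)))
    (u : ℝ → EuclideanSpace ℝ (Fin d) → ℝ) (A : Set ℝ) : Prop :=
  ∃ C : ℝ≥0, ∀ s ∈ A, ∀ t ∈ A,
    Metric.hausdorffEDist (posSet U (u s)) (posSet U (u t)) ≤ C * ENNReal.ofReal |t - s|

theorem posSetLipschitzOn_of_lt {A : Set ℝ} (C : ℝ≥0) (h : ∀ s ∈ A, ∀ t ∈ A, s < t →
    Metric.hausdorffEDist (posSet U (u s)) (posSet U (u t)) ≤ C * ENNReal.ofReal |t - s|) :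
    PosSetLipschitzOn U u A := by
  refine ⟨C, fun s hs t ht => ?_⟩
  rcases lt_trichotomy s t with hst | rfl | hst
  · exact h s hs t ht hst
  · simp
  · rw [Metric.hausdorffEDist_comm, abs_sub_comm]
    exact h t ht s hs hst

theorem PosSetLipschitzOn.glue {a b c : ℝ} (h₁ : PosSetLipschitzOn U u (Icc a b))
    (h₂ : PosSetLipschitzOn U u (Icc b c)) : PosSetLipschitzOn U u (Icc a c) := by
  obtain ⟨C₁, h₁⟩ := h₁
  obtain ⟨C₂, h₂⟩ := h₂
  refine posSetLipschitzOn_of_lt (C₁ + C₂) fun s hs t ht hst => ?_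
  rw [ENNReal.coe_add, add_mul]
  rcases le_total t b with htb | htb
  · exact (h₁ s ⟨hs.1, hst.le.trans htb⟩ t ⟨hs.1.trans hst.le, htb⟩).trans le_self_add
  rcases le_total b s with hbs | hbs
  · exact (h₂ s ⟨hbs, hs.2⟩ t ⟨htb, ht.2⟩).trans le_add_self
  refine (Metric.hausdorffEDist_triangle (t := posSet U (u b))).trans (add_le_add ?_ ?_)
  · refine (h₁ s ⟨hs.1, hbs⟩ b ⟨hs.1.trans hbs, le_rfl⟩).trans ?_
    gcongr
  · refine (h₂ b ⟨le_rfl, htb.trans ht.2⟩ t ⟨htb, ht.2⟩).trans ?_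
    gcongr

theorem IsObstacleSolution.lipschitz_of_disjoint (hd : 0 < d) (hU : IsOpen U)
    (hK : ∀ c : ℝ, 1 < c → ∀ x ∈ closure U, c • x ∈ U) (hR : ∀ x ∉ U, ‖x‖ ≤ R) (hR0 : 0 ≤ R)
    (hμp : 0 < μp) (hμm : 0 < μm) (hμm1 : μm < 1)
    (hF : IsForcing T Z F) (hu : IsObstacleSolution U μp μm T Z F u)
    (hm : 0 < m) (hmF : ∀ t ∈ Icc 0 T, m ≤ F t) (hFM : ∀ t ∈ Icc 0 T, F t ≤ M)
    (hL : LipschitzOnWith L F (Icc 0 T)) {a b : ℝ} (ha : a ∈ Icc 0 T) (hb : b ∈ Icc 0 T)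
    (hab : a < b) (hZ : Disjoint (Ioo a b) Z) (hga : IsStarState U μp μm (F a) R (u a)) :
    ∃ R', R ≤ R' ∧ IsStarState U μp μm (F b) R' (u b) ∧ PosSetLipschitzOn U u (Icc a b) := by
  have hsub : Icc a b ⊆ Icc 0 T := fun s hs => ⟨ha.1.trans hs.1, hs.2.trans hb.2⟩
  have hMm : m ≤ M := (hmF a ha).trans (hFM a ha)
  -- This factor strictly exceeds `F s / F a` for all times. Each state is reached from time `a` in
  -- a single step, so the radius bound grows at most by the factor `c` on the whole interval.
  set c := M / m + 1 with hc
  have hc1 : 1 < c := by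
    have : 0 < M / m := div_pos (hm.trans_le hMm) hm
    linarith
  have hcm : M < c * m := by rw [hc, add_mul, div_mul_cancel₀ _ hm.ne']; linarith
  have hRc : R ≤ c * R := le_mul_of_one_le_left hR0 hc1.le
  have hgood : ∀ s ∈ Icc a b, IsStarState U μp μm (F s) (c * R) (u s) := by
    intro s hs
    rcases hs.1.eq_or_lt with rfl | has
    · exact hga.mono hRc
    have hZs : Disjoint (Ioo a s) Z := hZ.mono_left (Ioo_subset_Ioo_right hs.2)
    have hsT := hsub hs
    rcases hF.monotone a ha s hsT has hZs with hmono | hanti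
    · refine hga.increasing hd hU hK hR hμp hμm (hF.pos a ha)
        (hmono ⟨le_rfl, has.le⟩ ⟨has.le, le_rfl⟩ has.le)
        (hu.increasing a ha s hsT has hZs hmono) hc1 ?_
      have := hmF a ha
      exact (hFM s hsT).trans_lt (hcm.trans_le (by gcongr))
    · exact (hga.decreasing hd hU hK hμp hμm hμm1 (hF.pos s hsT)
        (hu.decreasing a ha s hsT has hZs hanti)).mono hRc
  refine ⟨c * R, hRc, hgood b ⟨hab.le, le_rfl⟩,
    posSetLipschitzOn_of_lt (L * (c * R / m).toNNReal) fun s hs t ht hst => ?_⟩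
  have hsT := hsub hs
  have htT := hsub ht
  have hZs : Disjoint (Ioo s t) Z := hZ.mono_left (Ioo_subset_Ioo hs.1 ht.2)
  have hcR : 0 ≤ c * R := hR0.trans hRc
  -- Converts the ratio of boundary values into a Lipschitz bound: `q / p - 1 = (q - p) / p`, and
  -- the denominator is at least `m`.
  have hquot : ∀ p q : ℝ, m ≤ p → |q - p| ≤ L * |t - s| →
      ENNReal.ofReal ((q / p - 1) * (c * R)) ≤
        (L * (c * R / m).toNNReal : ℝ≥0) * ENNReal.ofReal |t - s| := by
    intro p q hp hq
    have hp0 : 0 < p := hm.trans_le hp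
    rw [ENNReal.coe_mul, ← ENNReal.ofReal_coe_nnreal, ← ENNReal.ofReal_coe_nnreal,
      ← ENNReal.ofReal_mul (by positivity), ← ENNReal.ofReal_mul (by positivity),
      Real.coe_toNNReal _ (by positivity)]
    apply ENNReal.ofReal_le_ofReal
    have h1 : q / p - 1 ≤ L * |t - s| / m := by
      have : q / p - 1 = (q - p) / p := by field_simp
      rw [this]
      calc (q - p) / p ≤ L * |t - s| / p := by
            gcongr; exact (le_abs_self _).trans hq
        _ ≤ L * |t - s| / m := by gcongr
    calc (q / p - 1) * (c * R) ≤ L * |t - s| / m * (c * R) := by gcongr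
      _ = L * (c * R / m) * |t - s| := by ring
  have hlip : |F t - F s| ≤ L * |t - s| := by
    have := hL.dist_le_mul t htT s hsT
    simpa [Real.dist_eq] using this
  rcases hF.monotone s hsT t htT hst hZs with hmono | hanti
  · exact ((hgood s hs).hausdorffEDist_increasing hU hK (fun x hx => (hR x hx).trans hRc) hμp
      (hF.pos s hsT) (hmono ⟨le_rfl, hst.le⟩ ⟨hst.le, le_rfl⟩ hst.le)
      (hu.increasing s hsT t htT hst hZs hmono)).trans (hquot _ _ (hmF s hsT) hlip)
  · exact ((hgood s hs).hausdorffEDist_decreasing hU hK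
      (hF.pos t htT) (hanti ⟨le_rfl, hst.le⟩ ⟨hst.le, le_rfl⟩ hst.le)
      (hu.decreasing s hsT t htT hst hZs hanti)).trans
      (hquot _ _ (hmF t htT) (by rwa [abs_sub_comm]))

/-- Induction on the number of points of `Z` in `(0, t)`, cutting at the last one. The radius may
grow at each cut, but there are finitely many; Lipschitz bounds on adjacent intervals are glued by
the triangle inequality. -/
theorem IsObstacleSolution.lipschitz (hd : 0 < d) (hU : IsOpen U)
    (hK : ∀ c : ℝ, 1 < c → ∀ x ∈ closure U, c • x ∈ U) (hR : ∀ x ∉ U, ‖x‖ ≤ R) (hR0 : 0 ≤ R)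
    (hμp : 0 < μp) (hμm : 0 < μm) (hμm1 : μm < 1)
    (hF : IsForcing T Z F) (hu : IsObstacleSolution U μp μm T Z F u)
    (hm : 0 < m) (hmF : ∀ t ∈ Icc 0 T, m ≤ F t) (hFM : ∀ t ∈ Icc 0 T, F t ≤ M)
    (hL : LipschitzOnWith L F (Icc 0 T)) (h0 : IsStarState U μp μm (F 0) R (u 0)) (n : ℕ) :
    ∀ t ∈ Icc 0 T, 0 < t → (Z ∩ Ioo 0 t).ncard = n →
      ∃ R', R ≤ R' ∧ IsStarState U μp μm (F t) R' (u t) ∧ PosSetLipschitzOn U u (Icc 0 t) := by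
  induction n using Nat.strong_induction_on with
  | _ n ih =>
    intro t ht ht0 hn
    have hfin : (Z ∩ Ioo 0 t).Finite := hF.finite.subset inter_subset_left
    have h0T : (0 : ℝ) ∈ Icc 0 T := ⟨le_rfl, ht0.le.trans ht.2⟩
    rcases (Z ∩ Ioo 0 t).eq_empty_or_nonempty with he | hne
    · exact hu.lipschitz_of_disjoint hd hU hK hR hR0 hμp hμm hμm1 hF hm hmF hFM hL h0T ht ht0
        (disjoint_iff_inter_eq_empty.2 (by rwa [inter_comm])) h0
    · obtain ⟨z, ⟨hzZ, hz⟩, hzmax⟩ := hfin.exists_maximalFor id _ hne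
      have hzT : z ∈ Icc 0 T := ⟨hz.1.le, hz.2.le.trans ht.2⟩
      have hlt : (Z ∩ Ioo 0 z).ncard < n := by
        rw [← hn]
        refine Set.ncard_lt_ncard ⟨inter_subset_inter_right _ (Ioo_subset_Ioo_right hz.2.le),
          fun h => ?_⟩ hfin
        exact lt_irrefl z (h ⟨hzZ, hz⟩).2.2
      obtain ⟨R₁, hR₁, hg, hlip₁⟩ := ih _ hlt z hzT hz.1 rfl
      have hdisj : Disjoint (Ioo z t) Z := by
        rw [Set.disjoint_left]
        intro y hy hyZ
        have := hzmax (j := y) ⟨hyZ, hz.1.trans hy.1, hy.2⟩ hy.1.le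
        exact this.not_gt hy.1
      obtain ⟨R₂, hR₂, hg₂, hlip₂⟩ := hu.lipschitz_of_disjoint hd hU hK
        (fun x hx => (hR x hx).trans hR₁) (hR0.trans hR₁) hμp hμm hμm1 hF hm hmF hFM hL hzT ht
        hz.2 hdisj hg
      exact ⟨R₂, hR₁.trans hR₂, hg₂, hlip₁.glue hlip₂⟩

end Evolution

/-! ### The corollary. -/

theorem mainTheorem9 {d : ℕ} (U : Set (EuclideanSpace ℝ (Fin d))) (μp μm T : ℝ)
    (Z : Set ℝ) (F : ℝ → ℝ) (u : ℝ → EuclideanSpace ℝ (Fin d) → ℝ)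
    (hμp : 0 < μp) (hμm : 0 < μm) (hμm1 : μm < 1) (hT : 0 < T)
    (hUo : IsOpen U) (hUc : IsConnected U)
    (hF : IsForcing T Z F)
    (hu : IsObstacleSolution U μp μm T Z F u)
    (hKreg : HasC2Boundary U)
    (hKbdd : Bornology.IsBounded Uᶜ) (hKstar : IsStronglyStarShaped Uᶜ)
    (hΩbdd : Bornology.IsBounded (posSet U (u 0)))
    (hΩstar : IsStronglyStarShaped (posSet U (u 0) ∪ Uᶜ)) :
    ∃ C : ℝ≥0, ∀ s ∈ Icc 0 T, ∀ t ∈ Icc 0 T,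
      Metric.hausdorffEDist (posSet U (u s)) (posSet U (u t)) ≤ C * ENNReal.ofReal |t - s| := by
  -- In dimension 0 the space is a single point, which cannot lie both in `U` and in its nonempty
  -- complement.
  have hd : 0 < d := by
    rcases Nat.eq_zero_or_pos d with rfl | hd
    · obtain ⟨x, hx⟩ := hUc.nonempty
      obtain ⟨y, hy⟩ := hKstar.1
      exact absurd (Subsingleton.elim x y ▸ hx) hy
    · exact hd
  have hK : ∀ c : ℝ, 1 < c → ∀ x ∈ closure U, c • x ∈ U := fun c hc x hx =>
    smul_mem_of_starShaped hKstar hc hx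
  obtain ⟨L, hL⟩ := hF.lipschitz
  have h0T : (0 : ℝ) ∈ Icc 0 T := ⟨le_rfl, hT.le⟩
  obtain ⟨tm, htm, hmin⟩ := isCompact_Icc.exists_isMinOn ⟨0, h0T⟩ hL.continuousOn
  obtain ⟨tM, htM, hmax⟩ := isCompact_Icc.exists_isMaxOn ⟨0, h0T⟩ hL.continuousOn
  obtain ⟨R₁, hR₁⟩ := isBounded_iff_forall_norm_le.1 hKbdd
  obtain ⟨R₂, hR₂⟩ := isBounded_iff_forall_norm_le.1 hΩbdd
  have hR : ∀ x ∉ U, ‖x‖ ≤ max R₁ R₂ := fun x hx => (hR₁ x hx).trans (le_max_left _ _)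
  have hR0 : 0 ≤ max R₁ R₂ := by
    obtain ⟨y, hy⟩ := hKstar.1
    exact (norm_nonneg y).trans (hR y hy)
  have h0 : IsStarState U μp μm (F 0) (max R₁ R₂) (u 0) :=
    hu.initial.isStarState hd hUo hK (hF.pos 0 h0T) (hu.dirichlet 0 h0T) hΩstar.2.self_of_nhds
      fun x hx => (hR₂ x hx).trans (le_max_right _ _)
  obtain ⟨_, _, _, h⟩ := hu.lipschitz hd hUo hK hR hR0 hμp hμm hμm1 hF (hF.pos tm htm)
    (fun t ht => hmin ht) (fun t ht => hmax ht) hL h0 _ T ⟨hT.le, le_rfl⟩ hT rfl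
  exact h
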